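/- Let $A$ be a $C^*$-algebra with a strongly continuous action $\sigma$ of the circle $\mathbb T$ (written as a $2\pi$-periodic one-parameter group $\sigma_t$), and let $F=A^\sigma$ be the fixed point algebra. Write $B^\sim$ for the unitization $\mathbb C\oplus B$, and extend $\sigma$ to $A^\sim$; then $(A^\sim)^\sigma=F^\sim$. For $x\in \mathrm{Mat}_n(A^\sim)$ let $x_k=\frac1{2\pi}\int_0^{2\pi}e^{-ikt}(\sigma_t\otimes\iota)(x)\,dt$, $k\in\mathbb Z$, be its spectral components. A partial isometry $v\in \mathrm{Mat}_n(A^\sim)$ is *modular* if $v\,\sigma_t(v^*)$ and $v^*\sigma_t(v)$ lie in $\mathrm{Mat}_n(F^\sim)$ for all $t$. The group $K_1(A,\sigma)$ is the abelian group with one generator $[v]$ for each modular partial isometry $v\in\mathrm{Mat}_n(A^\sim)$, $n\in\mathbb N$, and the relations: $[v]=0$ if $v$ is over $F^\sim$; $[v]+[w]=[v\oplus w]$; and $[v_0]=[v_1]$ if $(v_t)_{t\in[0,1]}$ is a norm-continuous path of modular partial isometries in some $\mathrm{Mat}_n(A^\sim)$. Let $M(F,A)=\{f\in C_0([0,\infty),A):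 f(0)\in F\}$ be the mapping cone with the pointwise circle action. For a unital algebra $B$ with circle action $\alpha$, $K_0^{\mathbb T}(B)$ is the Grothendieck group of $\alpha\otimes\mathrm{Ad}\,U$-invariant projections in $B\otimes\mathcal B(\mathcal H_U)$, $U$ ranging over finite dimensional unitary representations of $\mathbb T$, modulo equivalence by invariant partial isometries; for non-unital $B$ it is the kernel of $K_0^{\mathbb T}(B^\sim)\to K_0^{\mathbb T}(\mathbb C)$. For a $\sigma\otimes \mathrm{Ad}\,U$-invariant partial isometry $w\in A^\sim\otimes \mathcal B(\mathcal H_U)$ with $ww^*,w^*w$ over $F^\sim$ put $$p_w(t)=\begin{pmatrix}1-ww^*+\frac{t^2}{1+t^2}ww^* & -\frac{it}{1+t^2}\,w\\ \frac{it}{1+t^2}\,w^* & \frac{1}{1+t^2}\,w^*w\end{pmatrix},\qquad t\in[0,\infty),$$ an invariant projection over $M(F^\sim,A^\sim)^\sim$ for the representation $U\oplus U$; it gives the class $[p_w]-\left[\begin{pmatrix}1&0\\0&0\end{pmatrix}\right]\in K_0^{\mathbb T}(M(F^\sim,A^\sim))$. The inclusion $M(F,A)\to M(F^\sim,A^\sim)$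 induces a map $j_*\colon K_0^{\mathbb T}(M(F,A))\to K_0^{\mathbb T}(M(F^\sim,A^\sim))$. **Proposition.** The map $j_*$ is injective. For every modular partial isometry $v\in\mathrm{Mat}_n(A^\sim)$, each $v_k$ is a partial isometry with $(\sigma_t\otimes\iota)(v_k)=e^{ikt}v_k$, only finitely many $v_k$ are nonzero, and for every $k$ there is a (necessarily unique) class $\ll\!v_k\!\gg\,\in K_0^{\mathbb T}(M(F,A))$ with $$j_*(\ll\!v_k\!\gg)=[p_{w}]-\left[\begin{pmatrix}1&0\\0&0\end{pmatrix}\right],\qquad w=\begin{pmatrix}0&v_k\\0&0\end{pmatrix}\in A^\sim\otimes\mathcal B(\mathbb C^n\oplus\mathbb C^n[k]),$$ where $\mathbb C^n$ carries the trivial representation of $\mathbb T$ and $\mathbb C^n[k]$ is the same space with the representation $t\mapsto e^{ikt}$. There is a unique group homomorphism $T\colon K_1(A,\sigma)\to K_0^{\mathbb T}(M(F,A))$ such that $$T([v])=\sum_k \ll\!v_k\!\gg$$ for every modular partial isometry $v$ over $A$. -/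

import Mathlib

set_option linter.unusedSectionVars false

open scoped Matrix NNReal ZeroAtInfty

namespace ModularK

noncomputable section

/-! ### Circle actions, fixed points, unitizations -/

/-- A strongly continuous action of the circle on a C*-algebra by star-endomorphisms.  As the
circle is a group and `hom` is a monoid homomorphism, every `hom z` is a star-automorphism. -/
structure CircleAction (A : Type*) [NonUnitalCStarAlgebra A] where
  hom : Circle →* (A →⋆ₙₐ[ℂ] A)
  cont : ∀ a : A, Continuous fun z : Circle => hom z a

section Unitize

variable {A : Type*} [NonUnitalRing A] [StarRing A] [Module ℂ A] [IsScalarTower ℂ A A]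
  [SMulCommClass ℂ A A] [StarModule ℂ A]

/-- The extension of an action to the unitization `A~ = ℂ ⊕ A` (a unit is always adjoined). -/
def unitizeHom (α : Circle →* (A →⋆ₙₐ[ℂ] A)) :
    Circle →* (Unitization ℂ A →⋆ₐ[ℂ] Unitization ℂ A) where
  toFun z := Unitization.starMap (α z)
  map_one' := by rw [map_one]; exact Unitization.starMap_id
  map_mul' z w := by rw [map_mul]; exact Unitization.starMap_comp

variable (A) in
/-- The augmentation `A~ → ℂ`. -/
def augmentation : Unitization ℂ A →⋆ₐ[ℂ] ℂ :=
  { Unitization.fstHom ℂ A with map_star' := fun _ => rfl }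

theorem unitizeHom_apply (α : Circle →* (A →⋆ₙₐ[ℂ] A)) (z : Circle) (x : Unitization ℂ A) :
    unitizeHom α z x = Unitization.inl x.fst + Unitization.inr (α z x.snd) := by
  change Unitization.starMap (α z) x = _
  conv_lhs => rw [← Unitization.inl_fst_add_inr_snd_eq x]
  rw [map_add, Unitization.starMap_inl, Unitization.starMap_inr]
  simp [Unitization.algebraMap_eq_inl]

end Unitize

section Action

variable {A : Type*} [NonUnitalCStarAlgebra A] (σ : CircleAction A)

/-- The extension of a strongly continuous action on `A` to the C*-algebra `A~`. -/
def CircleAction.unitize : CircleAction (Unitization ℂ A) where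
  hom :=
    { toFun := fun z => (unitizeHom σ.hom z : Unitization ℂ A →⋆ₐ[ℂ] Unitization ℂ A)
      map_one' := by rw [map_one]; rfl
      map_mul' := fun z w => by rw [map_mul]; rfl }
  cont x := by
    change Continuous fun z : Circle => unitizeHom σ.hom z x
    simp only [unitizeHom_apply]
    exact continuous_const.add ((Unitization.isometry_inr (𝕜 := ℂ)).continuous.comp (σ.cont _))

/-- The fixed point algebra of the action. -/
def fixedAlgebra : NonUnitalStarSubalgebra ℂ A where
  carrier := {a | ∀ z, σ.hom z a = a}
  add_mem' ha hb z := by rw [map_add, ha z, hb z]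
  zero_mem' z := map_zero _
  mul_mem' ha hb z := by rw [map_mul, ha z, hb z]
  smul_mem' c a ha z := by rw [map_smul, ha z]
  star_mem' ha z := by rw [map_star, ha z]

end Action

/-! ### Equivariant `K₀` for the circle -/

/-- A (continuous) unitary representation of the circle on `ℂ^ι`. -/
structure CircleRep (ι : Type) [Fintype ι] [DecidableEq ι] where
  hom : Circle →* Matrix.unitaryGroup ι ℂ
  cont : Continuous hom

namespace CircleRep

variable {ι κ : Type} [Fintype ι] [DecidableEq ι] [Fintype κ] [DecidableEq κ]

/-- The matrix of `U z`. -/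
def mat (U : CircleRep ι) (z : Circle) : Matrix ι ι ℂ := (U.hom z : Matrix ι ι ℂ)

theorem mat_mul_star (U : CircleRep ι) (z : Circle) : U.mat z * (U.mat z)ᴴ = 1 :=
  Matrix.mem_unitaryGroup_iff.1 (U.hom z).2

theorem mat_one (U : CircleRep ι) : U.mat 1 = 1 := by simp [mat]

theorem mat_mul (U : CircleRep ι) (z w : Circle) : U.mat (z * w) = U.mat z * U.mat w := by
  simp [mat]

theorem continuous_mat (U : CircleRep ι) : Continuous U.mat :=
  continuous_subtype_val.comp U.cont

/-- A representation from its matrices. -/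
def ofMat (M : Circle → Matrix ι ι ℂ) (h : ∀ z, M z * (M z)ᴴ = 1) (h1 : M 1 = 1)
    (hm : ∀ z w, M (z * w) = M z * M w) (hc : Continuous M) : CircleRep ι where
  hom :=
    { toFun := fun z => ⟨M z, Matrix.mem_unitaryGroup_iff.2 (h z)⟩
      map_one' := Subtype.ext h1
      map_mul' := fun z w => Subtype.ext (hm z w) }
  cont := hc.subtype_mk _

/-- The trivial representation on `ℂ^ι`. -/
def trivial (ι : Type) [Fintype ι] [DecidableEq ι] : CircleRep ι :=
  ofMat (fun _ => 1) (by simp) rfl (by simp) continuous_const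

/-- `U[k]`: the same space with the representation tensored with `χ^k`, `χ^k(z) = z^k`. -/
def twist (U : CircleRep ι) (k : ℤ) : CircleRep ι :=
  ofMat (fun z => ((z ^ k : Circle) : ℂ) • U.mat z)
    (fun z => by
      rw [Matrix.conjTranspose_smul, Matrix.smul_mul, Matrix.mul_smul, smul_smul,
        U.mat_mul_star, Complex.star_def, Complex.mul_conj, Circle.normSq_coe]
      simp)
    (by simp [U.mat_one])
    (fun z w => by
      rw [U.mat_mul, Matrix.smul_mul, Matrix.mul_smul, smul_smul, mul_zpow, Circle.coe_mul])
    (by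
      have h0 : Continuous fun z : Circle => z ^ k := continuous_zpow k
      have h1 : Continuous fun z : Circle => (z : ℂ) := continuous_subtype_val
      exact (h1.comp h0).smul U.continuous_mat)

/-- The direct sum of two representations. -/
def sum (U : CircleRep ι) (V : CircleRep κ) : CircleRep (ι ⊕ κ) :=
  ofMat (fun z => Matrix.fromBlocks (U.mat z) 0 0 (V.mat z))
    (fun z => by
      simp [Matrix.fromBlocks_conjTranspose, Matrix.fromBlocks_multiply, mat_mul_star])
    (by simp [mat_one])
    (fun z w => by simp [Matrix.fromBlocks_multiply, mat_mul])
    (U.continuous_mat.matrix_fromBlocks continuous_const continuous_const V.continuous_mat)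

end CircleRep

section KTheory

variable {B C : Type*} [Ring B] [StarRing B] [Algebra ℂ B] [StarModule ℂ B]
  [Ring C] [StarRing C] [Algebra ℂ C] [StarModule ℂ C]
  {ι κ : Type} [Fintype ι] [DecidableEq ι] [Fintype κ] [DecidableEq κ]

/-- A scalar matrix regarded as a matrix over the algebra `B`. -/
def scalarMatrix (B : Type*) [Ring B] [Algebra ℂ B] (M : Matrix ι κ ℂ) : Matrix ι κ B :=
  M.map (algebraMap ℂ B)

/-- `x` is an invariant element of `B ⊗ Hom(ℂ^κ, ℂ^ι)`, where the circle acts on `B` by `α`, on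
`ℂ^ι` by `U` and on `ℂ^κ` by `V`.  For `U = V` this is invariance under `α ⊗ Ad U`. -/
def IsInvariant (α : Circle →* (B →⋆ₐ[ℂ] B)) (U : CircleRep ι) (V : CircleRep κ)
    (x : Matrix ι κ B) : Prop :=
  ∀ z : Circle,
    scalarMatrix B (U.mat z) * x.map (α z) * (scalarMatrix B (V.mat z))ᴴ = x

/-- An `α ⊗ Ad U`-invariant projection in `B ⊗ B(ℂ^ι)`, for some finite dimensional unitary
representation `U` of the circle on some `ℂ^ι`. -/
structure InvProj (α : Circle →* (B →⋆ₐ[ℂ] B)) where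
  ι : Type
  [fintype : Fintype ι]
  [decEq : DecidableEq ι]
  rep : CircleRep ι
  proj : Matrix ι ι B
  isStarProjection : IsStarProjection proj
  invariant : IsInvariant α rep rep proj

attribute [instance] InvProj.fintype InvProj.decEq

/-- Equivariant Murray-von Neumann equivalence: `p = x x*` and `q = x* x` with `x` invariant. -/
def InvProj.Equiv {α : Circle →* (B →⋆ₐ[ℂ] B)} (p q : InvProj α) : Prop :=
  ∃ x : Matrix p.ι q.ι B, IsInvariant α p.rep q.rep x ∧ x * xᴴ = p.proj ∧ xᴴ * x = q.proj

theorem scalarMatrix_fromBlocks {ι₁ ι₂ κ₁ κ₂ : Type} (M : Matrix ι₁ κ₁ ℂ) (N : Matrix ι₁ κ₂ ℂ)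
    (P : Matrix ι₂ κ₁ ℂ) (Q : Matrix ι₂ κ₂ ℂ) :
    scalarMatrix B (Matrix.fromBlocks M N P Q) = Matrix.fromBlocks (scalarMatrix B M)
      (scalarMatrix B N) (scalarMatrix B P) (scalarMatrix B Q) :=
  Matrix.fromBlocks_map _ _ _ _ _

theorem scalarMatrix_zero : scalarMatrix B (0 : Matrix ι κ ℂ) = 0 := by
  simp [scalarMatrix]

/-- Invariance of a block matrix, blockwise. -/
theorem IsInvariant.fromBlocks {α : Circle →* (B →⋆ₐ[ℂ] B)} {U : CircleRep ι} {V : CircleRep κ}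
    {a : Matrix ι ι B} {b : Matrix ι κ B} {c : Matrix κ ι B} {d : Matrix κ κ B}
    (ha : IsInvariant α U U a) (hb : IsInvariant α U V b) (hc : IsInvariant α V U c)
    (hd : IsInvariant α V V d) :
    IsInvariant α (U.sum V) (U.sum V) (Matrix.fromBlocks a b c d) := by
  intro z
  have e : (U.sum V).mat z = Matrix.fromBlocks (U.mat z) 0 0 (V.mat z) := rfl
  rw [e, scalarMatrix_fromBlocks, Matrix.fromBlocks_map, Matrix.fromBlocks_conjTranspose,
    scalarMatrix_zero, scalarMatrix_zero, Matrix.fromBlocks_multiply, Matrix.fromBlocks_multiply]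
  simp only [Matrix.conjTranspose_zero, Matrix.zero_mul, Matrix.mul_zero, add_zero, zero_add]
  rw [ha z, hb z, hc z, hd z]

theorem isInvariant_zero (α : Circle →* (B →⋆ₐ[ℂ] B)) (U : CircleRep ι) (V : CircleRep κ) :
    IsInvariant α U V (0 : Matrix ι κ B) := fun z => by
  rw [Matrix.map_zero _ (map_zero _)]; simp

/-- The direct sum of invariant projections. -/
def InvProj.sum {α : Circle →* (B →⋆ₐ[ℂ] B)} (p q : InvProj α) : InvProj α where
  ι := p.ι ⊕ q.ι
  rep := p.rep.sum q.rep
  proj := Matrix.fromBlocks p.proj 0 0 q.proj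
  isStarProjection := by
    refine ⟨?_, ?_⟩
    · simp [IsIdempotentElem, Matrix.fromBlocks_multiply, p.isStarProjection.isIdempotentElem.eq,
        q.isStarProjection.isIdempotentElem.eq]
    · have hp := p.isStarProjection.isSelfAdjoint
      have hq := q.isStarProjection.isSelfAdjoint
      rw [IsSelfAdjoint, Matrix.star_eq_conjTranspose] at hp hq ⊢
      simp [Matrix.fromBlocks_conjTranspose, hp, hq]
  invariant := IsInvariant.fromBlocks p.invariant (isInvariant_zero _ _ _)
    (isInvariant_zero _ _ _) q.invariant

/-- The relations of `K₀`: equivalent projections are identified, and direct sum is addition. -/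
def k0Relations (α : Circle →* (B →⋆ₐ[ℂ] B)) : Set (FreeAbelianGroup (InvProj α)) :=
  {x | ∃ p q : InvProj α, p.Equiv q ∧ x = FreeAbelianGroup.of p - FreeAbelianGroup.of q} ∪
  {x | ∃ p q : InvProj α, x =
    FreeAbelianGroup.of (p.sum q) - FreeAbelianGroup.of p - FreeAbelianGroup.of q}

/-- The equivariant group `K₀^𝕋(B)` of a unital algebra `B`: the Grothendieck group of the
semigroup of equivalence classes of invariant projections under direct sum, written by generators
and relations. -/
def K0Unital (α : Circle →* (B →⋆ₐ[ℂ] B)) : Type _ :=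
  FreeAbelianGroup (InvProj α) ⧸ AddSubgroup.closure (k0Relations α)

instance (α : Circle →* (B →⋆ₐ[ℂ] B)) : AddCommGroup (K0Unital α) :=
  inferInstanceAs (AddCommGroup (FreeAbelianGroup (InvProj α) ⧸ _))

/-- The class `[p]` of an invariant projection. -/
def K0Unital.mk {α : Circle →* (B →⋆ₐ[ℂ] B)} (p : InvProj α) : K0Unital α :=
  QuotientAddGroup.mk (FreeAbelianGroup.of p)

theorem map_scalarMatrix (φ : B →⋆ₐ[ℂ] C) (M : Matrix ι κ ℂ) :
    (scalarMatrix B M).map φ = scalarMatrix C M := by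
  ext i j; simp [scalarMatrix, AlgHomClass.commutes φ]

theorem map_conjTranspose' (φ : B →⋆ₐ[ℂ] C) (M : Matrix ι κ B) :
    Mᴴ.map φ = (M.map φ)ᴴ := by
  ext i j; simp [map_star]

theorem IsInvariant.map {α : Circle →* (B →⋆ₐ[ℂ] B)} {β : Circle →* (C →⋆ₐ[ℂ] C)}
    {φ : B →⋆ₐ[ℂ] C} (hφ : ∀ z b, φ (α z b) = β z (φ b)) {U : CircleRep ι} {V : CircleRep κ}
    {x : Matrix ι κ B} (hx : IsInvariant α U V x) : IsInvariant β U V (x.map φ) := by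
  intro z
  conv_rhs => rw [← hx z]
  rw [Matrix.map_mul, Matrix.map_mul, map_conjTranspose', map_scalarMatrix, map_scalarMatrix]
  congr 2
  ext i j
  simp [hφ]

/-- The image of an invariant projection under an equivariant unital homomorphism. -/
def InvProj.map {α : Circle →* (B →⋆ₐ[ℂ] B)} {β : Circle →* (C →⋆ₐ[ℂ] C)}
    (φ : B →⋆ₐ[ℂ] C) (hφ : ∀ z b, φ (α z b) = β z (φ b)) (p : InvProj α) : InvProj β where
  ι := p.ι
  rep := p.rep
  proj := p.proj.map φ
  isStarProjection := by
    have h1 := p.isStarProjection.isIdempotentElem.eq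
    have h2 := p.isStarProjection.isSelfAdjoint
    rw [IsSelfAdjoint, Matrix.star_eq_conjTranspose] at h2
    refine ⟨?_, ?_⟩
    · rw [IsIdempotentElem, ← Matrix.map_mul, h1]
    · rw [IsSelfAdjoint, Matrix.star_eq_conjTranspose, ← map_conjTranspose', h2]
  invariant := p.invariant.map hφ

/-- Functoriality of `K₀^𝕋` for equivariant unital homomorphisms. -/
def K0Unital.map {α : Circle →* (B →⋆ₐ[ℂ] B)} {β : Circle →* (C →⋆ₐ[ℂ] C)}
    (φ : B →⋆ₐ[ℂ] C) (hφ : ∀ z b, φ (α z b) = β z (φ b)) : K0Unital α →+ K0Unital β :=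
  QuotientAddGroup.map _ _ (FreeAbelianGroup.map (InvProj.map φ hφ)) <| by
    rw [AddSubgroup.closure_le]
    rintro x (⟨p, q, ⟨y, hy, h1, h2⟩, rfl⟩ | ⟨p, q, rfl⟩)
    · refine AddSubgroup.subset_closure (Or.inl ⟨p.map φ hφ, q.map φ hφ, ⟨y.map φ, hy.map hφ,
        ?_, ?_⟩, by simp⟩)
      · change y.map φ * (y.map φ)ᴴ = p.proj.map φ
        rw [← map_conjTranspose', ← Matrix.map_mul, h1]
      · change (y.map φ)ᴴ * y.map φ = q.proj.map φ
        rw [← map_conjTranspose', ← Matrix.map_mul, h2]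
    · refine AddSubgroup.subset_closure (Or.inr ⟨p.map φ hφ, q.map φ hφ, ?_⟩)
      have : (p.sum q).map φ hφ = (p.map φ hφ).sum (q.map φ hφ) := by
        simp only [InvProj.map, InvProj.sum, Matrix.fromBlocks_map, InvProj.mk.injEq, true_and,
          Matrix.map_zero _ (map_zero φ)]
        exact ⟨HEq.rfl, HEq.rfl, HEq.rfl, HEq.rfl⟩
      simp [this]

theorem K0Unital.map_mk {α : Circle →* (B →⋆ₐ[ℂ] B)} {β : Circle →* (C →⋆ₐ[ℂ] C)}
    (φ : B →⋆ₐ[ℂ] C) (hφ : ∀ z b, φ (α z b) = β z (φ b)) (p : InvProj α) :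
    K0Unital.map φ hφ (K0Unital.mk p) = K0Unital.mk (p.map φ hφ) := by
  change QuotientAddGroup.mk (FreeAbelianGroup.map (InvProj.map φ hφ) (FreeAbelianGroup.of p)) = _
  rw [FreeAbelianGroup.map_of_apply]; rfl

end KTheory

section NonUnitalKTheory

variable {M N : Type*} [NonUnitalRing M] [StarRing M] [Module ℂ M] [IsScalarTower ℂ M M]
  [SMulCommClass ℂ M M] [StarModule ℂ M] [NonUnitalRing N] [StarRing N] [Module ℂ N]
  [IsScalarTower ℂ N N] [SMulCommClass ℂ N N] [StarModule ℂ N]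

theorem augmentation_equivariant (α : Circle →* (M →⋆ₙₐ[ℂ] M)) (z : Circle)
    (b : Unitization ℂ M) : augmentation M (unitizeHom α z b) =
      (1 : Circle →* (ℂ →⋆ₐ[ℂ] ℂ)) z (augmentation M b) := by
  rw [unitizeHom_apply]
  change (Unitization.inl b.fst + Unitization.inr _ : Unitization ℂ M).fst = b.fst
  simp

/-- The equivariant group `K₀^𝕋(M)` of a not necessarily unital algebra: the kernel of the map
`K₀^𝕋(M~) → K₀^𝕋(ℂ)` induced by the augmentation. -/
def k0 (α : Circle →* (M →⋆ₙₐ[ℂ] M)) : AddSubgroup (K0Unital (unitizeHom α)) :=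
  (K0Unital.map (augmentation M) (augmentation_equivariant α)).ker

theorem starMap_equivariant {α : Circle →* (M →⋆ₙₐ[ℂ] M)} {β : Circle →* (N →⋆ₙₐ[ℂ] N)}
    {φ : M →⋆ₙₐ[ℂ] N} (hφ : ∀ z b, φ (α z b) = β z (φ b)) (z : Circle) (b : Unitization ℂ M) :
    Unitization.starMap φ (unitizeHom α z b) = unitizeHom β z (Unitization.starMap φ b) := by
  change (Unitization.starMap φ).comp (Unitization.starMap (α z)) b =
    (Unitization.starMap (β z)).comp (Unitization.starMap φ) b
  rw [← Unitization.starMap_comp, ← Unitization.starMap_comp]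
  congr 2
  ext x
  exact hφ z x

/-- Functoriality of `K₀^𝕋` for equivariant homomorphisms. -/
def k0Map {α : Circle →* (M →⋆ₙₐ[ℂ] M)} {β : Circle →* (N →⋆ₙₐ[ℂ] N)}
    (φ : M →⋆ₙₐ[ℂ] N) (hφ : ∀ z b, φ (α z b) = β z (φ b)) : k0 α →+ k0 β :=
  ((K0Unital.map (Unitization.starMap φ) (starMap_equivariant hφ)).comp
    (k0 α).subtype).codRestrict (k0 β) <| by
    rintro ⟨x, hx⟩
    have key : (K0Unital.map (augmentation N) (augmentation_equivariant β)).comp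
        (K0Unital.map (Unitization.starMap φ) (starMap_equivariant hφ)) =
        K0Unital.map (augmentation M) (augmentation_equivariant α) := by
      refine QuotientAddGroup.addMonoidHom_ext _ (FreeAbelianGroup.lift_ext _ _ fun p => ?_)
      change K0Unital.map (augmentation N) (augmentation_equivariant β)
        (K0Unital.map (Unitization.starMap φ) (starMap_equivariant hφ) (K0Unital.mk p)) =
        K0Unital.map (augmentation M) (augmentation_equivariant α) (K0Unital.mk p)
      rw [K0Unital.map_mk, K0Unital.map_mk, K0Unital.map_mk]
      congr 1
      simp only [InvProj.map, InvProj.mk.injEq, heq_eq_eq, true_and, Matrix.map_map]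
      congr 1
      funext b
      change (Unitization.starMap φ b).fst = b.fst
      conv_lhs => rw [← Unitization.inl_fst_add_inr_snd_eq b]
      rw [map_add, Unitization.starMap_inl, Unitization.starMap_inr]
      simp [Unitization.algebraMap_eq_inl]
    exact (DFunLike.congr_fun key x).trans hx

end NonUnitalKTheory

/-! ### The mapping cone of the inclusion of the fixed point algebra -/

section Cone

variable {A B : Type*} [NonUnitalCStarAlgebra A] [NonUnitalCStarAlgebra B]

/-- Evaluation at `t`. -/
def evalC0 (A : Type*) [NonUnitalCStarAlgebra A] (t : ℝ≥0) : C₀(ℝ≥0, A) →⋆ₙₐ[ℂ] A where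
  toFun f := f t
  map_smul' _ _ := rfl
  map_zero' := rfl
  map_add' _ _ := rfl
  map_mul' _ _ := rfl
  map_star' _ := rfl

/-- Postcomposition of functions in `C₀([0,∞), A)` with a star-homomorphism. -/
def postcompC0 (φ : A →⋆ₙₐ[ℂ] B) : C₀(ℝ≥0, A) →⋆ₙₐ[ℂ] C₀(ℝ≥0, B) where
  toFun f :=
    { toFun := fun t => φ (f t)
      continuous_toFun := (AddMonoidHomClass.continuous_of_bound φ 1 fun a => by
        simpa using NonUnitalStarAlgHom.norm_apply_le φ a).comp (map_continuous f)
      zero_at_infty' := by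
        have h : Continuous φ := AddMonoidHomClass.continuous_of_bound φ 1 fun a => by
          simpa using NonUnitalStarAlgHom.norm_apply_le φ a
        have := (h.tendsto 0).comp (zero_at_infty f)
        rwa [map_zero] at this }
  map_smul' c f := by ext t; exact map_smul φ c (f t)
  map_zero' := by ext t; exact map_zero φ
  map_add' f g := by ext t; exact map_add φ _ _
  map_mul' f g := by ext t; exact map_mul φ _ _
  map_star' f := by ext t; exact map_star φ _

/-- The mapping cone `M(F, A) = {f ∈ C₀([0,∞), A) | f(0) ∈ F}`, `F` the fixed point algebra. -/
def mappingCone (σ : CircleAction A) : NonUnitalStarSubalgebra ℂ C₀(ℝ≥0, A) :=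
  (fixedAlgebra σ).comap (evalC0 A 0)

theorem mem_mappingCone {σ : CircleAction A} {f : C₀(ℝ≥0, A)} :
    f ∈ mappingCone σ ↔ ∀ z, σ.hom z (f 0) = f 0 := Iff.rfl

/-- The mapping cone as a type. -/
def Cone (σ : CircleAction A) : Type _ := mappingCone σ

namespace Cone

instance (σ : CircleAction A) : NonUnitalRing (Cone σ) :=
  inferInstanceAs (NonUnitalRing (mappingCone σ))

instance (σ : CircleAction A) : StarRing (Cone σ) :=
  inferInstanceAs (StarRing (mappingCone σ))

instance (σ : CircleAction A) : Module ℂ (Cone σ) :=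
  inferInstanceAs (Module ℂ (mappingCone σ))

instance (σ : CircleAction A) : IsScalarTower ℂ (Cone σ) (Cone σ) :=
  inferInstanceAs (IsScalarTower ℂ (mappingCone σ) (mappingCone σ))

instance (σ : CircleAction A) : SMulCommClass ℂ (Cone σ) (Cone σ) :=
  inferInstanceAs (SMulCommClass ℂ (mappingCone σ) (mappingCone σ))

instance (σ : CircleAction A) : StarModule ℂ (Cone σ) :=
  inferInstanceAs (StarModule ℂ (mappingCone σ))

/-- An element of the mapping cone from a function. -/
def mk {σ : CircleAction A} (f : C₀(ℝ≥0, A)) (hf : ∀ z, σ.hom z (f 0) = f 0) : Cone σ :=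
  (⟨f, hf⟩ : mappingCone σ)

/-- The inclusion of the mapping cone into `C₀([0,∞), A)`. -/
def incl (σ : CircleAction A) : Cone σ →⋆ₙₐ[ℂ] C₀(ℝ≥0, A) :=
  (NonUnitalStarSubalgebraClass.subtype (mappingCone σ) : mappingCone σ →⋆ₙₐ[ℂ] C₀(ℝ≥0, A))

theorem incl_mk {σ : CircleAction A} (f : C₀(ℝ≥0, A)) (hf) : incl σ (mk f hf) = f := rfl

theorem incl_fixed {σ : CircleAction A} (f : Cone σ) (z : Circle) :
    σ.hom z (incl σ f 0) = incl σ f 0 := mem_mappingCone.1 (Subtype.prop (p := (· ∈ mappingCone σ)) f) z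

theorem incl_injective (σ : CircleAction A) : Function.Injective (incl σ) :=
  Subtype.val_injective

theorem ext {σ : CircleAction A} {f g : Cone σ} (h : ∀ t, incl σ f t = incl σ g t) : f = g :=
  incl_injective σ (DFunLike.ext _ _ h)

end Cone

/-- The homomorphism of mapping cones induced by an equivariant homomorphism. -/
def coneMap {σ : CircleAction A} {τ : CircleAction B} (φ : A →⋆ₙₐ[ℂ] B)
    (hφ : ∀ z a, φ (σ.hom z a) = τ.hom z (φ a)) : Cone σ →⋆ₙₐ[ℂ] Cone τ where
  toFun f := Cone.mk (postcompC0 φ (Cone.incl σ f)) fun z => by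
    change τ.hom z (φ (Cone.incl σ f 0)) = φ (Cone.incl σ f 0)
    rw [← hφ, Cone.incl_fixed f z]
  map_smul' c f := Cone.ext fun t => by
    exact map_smul φ c (Cone.incl σ f t)
  map_zero' := Cone.ext fun t => map_zero φ
  map_add' f g := Cone.ext fun t => map_add φ (Cone.incl σ f t) (Cone.incl σ g t)
  map_mul' f g := Cone.ext fun t => map_mul φ (Cone.incl σ f t) (Cone.incl σ g t)
  map_star' f := Cone.ext fun t => map_star φ (Cone.incl σ f t)

theorem incl_coneMap {σ : CircleAction A} {τ : CircleAction B} (φ : A →⋆ₙₐ[ℂ] B)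
    (hφ : ∀ z a, φ (σ.hom z a) = τ.hom z (φ a)) (f : Cone σ) (t : ℝ≥0) :
    Cone.incl τ (coneMap φ hφ f) t = φ (Cone.incl σ f t) := rfl

theorem hom_comm (σ : CircleAction A) (z w : Circle) (a : A) :
    σ.hom w (σ.hom z a) = σ.hom z (σ.hom w a) := by
  have : σ.hom w * σ.hom z = σ.hom z * σ.hom w := by rw [← map_mul, ← map_mul, mul_comm]
  exact DFunLike.congr_fun this a

/-- The (pointwise) circle action on the mapping cone. -/
def coneAction (σ : CircleAction A) : Circle →* (Cone σ →⋆ₙₐ[ℂ] Cone σ) where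
  toFun z := coneMap (σ.hom z) (fun w a => hom_comm σ w z a)
  map_one' := by
    refine NonUnitalStarAlgHom.ext fun f => Cone.ext fun t => ?_
    rw [incl_coneMap, map_one]; rfl
  map_mul' z w := by
    refine NonUnitalStarAlgHom.ext fun f => Cone.ext fun t => ?_
    rw [incl_coneMap, map_mul]; rfl

/-- `K₀^𝕋(M(F, A))`. -/
abbrev K0Cone (σ : CircleAction A) := k0 (coneAction σ)

theorem inr_equivariant (σ : CircleAction A) (z : Circle) (a : A) :
    Unitization.inrNonUnitalStarAlgHom ℂ A (σ.hom z a) =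
      σ.unitize.hom z (Unitization.inrNonUnitalStarAlgHom ℂ A a) :=
  (Unitization.starMap_inr (σ.hom z) a).symm

/-- The map `K₀^𝕋(M(F, A)) → K₀^𝕋(M(F~, A~))` induced by the inclusion. -/
def coneInclusion (σ : CircleAction A) : K0Cone σ →+ K0Cone σ.unitize :=
  k0Map (coneMap (Unitization.inrNonUnitalStarAlgHom ℂ A) (inr_equivariant σ))
    (fun z f => Cone.ext fun t => inr_equivariant σ z (Cone.incl σ f t))

end Cone

/-! ### Invariant partial isometries and their classes -/

section PartialIsometries

variable {A : Type*} [NonUnitalCStarAlgebra A] (σ : CircleAction A)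

/-- The matrix has entries in `F~`, i.e. is fixed by `σ ⊗ id`. -/
def OverFixed {ι κ : Type} (x : Matrix ι κ (Unitization ℂ A)) : Prop :=
  ∀ z, x.map (unitizeHom σ.hom z) = x

/-- `v` is a partial isometry. -/
def IsPartialIsometry {B : Type*} [Ring B] [StarRing B] {ι : Type} [Fintype ι]
    (v : Matrix ι ι B) : Prop :=
  v * vᴴ * v = v

/-- The set `V^𝕋(F, A)`: `σ ⊗ Ad U`-invariant partial isometries `v` in `A~ ⊗ B(ℂ^ι)`, for some
finite dimensional unitary representation `U`, with `v v*` and `v* v` over `F~`. -/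
structure InvPartialIsometry where
  ι : Type
  [fintype : Fintype ι]
  [decEq : DecidableEq ι]
  rep : CircleRep ι
  elt : Matrix ι ι (Unitization ℂ A)
  isPartialIsometry : IsPartialIsometry elt
  invariant : IsInvariant (unitizeHom σ.hom) rep rep elt
  range_fixed : OverFixed σ (elt * eltᴴ)
  source_fixed : OverFixed σ (eltᴴ * elt)

attribute [instance] InvPartialIsometry.fintype InvPartialIsometry.decEq

theorem tendsto_two_div : Filter.Tendsto (fun t : ℝ≥0 => 2 / (1 + (t : ℝ)))
    (Filter.cocompact ℝ≥0) (nhds 0) := by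
  refine Filter.Tendsto.mono_left ?_ cocompact_le_atTop
  refine Filter.Tendsto.div_atTop tendsto_const_nhds ?_
  exact Filter.tendsto_atTop_add_const_left _ _ (NNReal.tendsto_coe_atTop.2 Filter.tendsto_id)

/-- The function `t ↦ 1 / (1 + t²)` in `C₀([0,∞))`. -/
def g₀ : C₀(ℝ≥0, ℂ) where
  toFun t := ((1 / (1 + (t : ℝ) ^ 2) : ℝ) : ℂ)
  continuous_toFun := by
    refine Complex.continuous_ofReal.comp (Continuous.div continuous_const (by fun_prop) ?_)
    intro t; positivity
  zero_at_infty' := by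
    rw [← Complex.ofReal_zero]
    refine (Complex.continuous_ofReal.tendsto 0).comp (squeeze_zero (fun t => by positivity) ?_
      tendsto_two_div)
    intro t
    have ht : (0 : ℝ) ≤ t := t.2
    rw [div_le_div_iff₀ (by positivity) (by positivity)]
    nlinarith [sq_nonneg ((t : ℝ) - 1), sq_nonneg (t : ℝ)]

/-- The function `t ↦ t / (1 + t²)` in `C₀([0,∞))`. -/
def g₁ : C₀(ℝ≥0, ℂ) where
  toFun t := (((t : ℝ) / (1 + (t : ℝ) ^ 2) : ℝ) : ℂ)
  continuous_toFun := by
    refine Complex.continuous_ofReal.comp (Continuous.div (by fun_prop) (by fun_prop) ?_)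
    intro t; positivity
  zero_at_infty' := by
    rw [← Complex.ofReal_zero]
    refine (Complex.continuous_ofReal.tendsto 0).comp (squeeze_zero (fun t => by positivity) ?_
      tendsto_two_div)
    intro t
    have ht : (0 : ℝ) ≤ t := t.2
    rw [div_le_div_iff₀ (by positivity) (by positivity)]
    nlinarith [sq_nonneg ((t : ℝ) - 1), sq_nonneg (t : ℝ)]

/-- The function `t ↦ g(t) b`. -/
def tensorC0 {B : Type*} [NonUnitalCStarAlgebra B] (g : C₀(ℝ≥0, ℂ)) (b : B) : C₀(ℝ≥0, B) where
  toFun t := g t • b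
  continuous_toFun := (map_continuous g).smul continuous_const
  zero_at_infty' := by
    have := (zero_at_infty g).smul (tendsto_const_nhds (x := b))
    rwa [zero_smul] at this

/-- The unitization of the mapping cone `M(F~, A~)`. -/
abbrev ConeUnit := Unitization ℂ (Cone σ.unitize)

/-- The matrix of functions `t ↦ t (1 + t²)⁻¹ x` over `M(F~, A~)`. -/
def oddPart {ι κ : Type} (x : Matrix ι κ (Unitization ℂ A)) : Matrix ι κ (ConeUnit σ) :=
  Matrix.of fun i j => Unitization.inr (Cone.mk (tensorC0 g₁ (x i j)) fun z => by
    change σ.unitize.hom z (g₁ 0 • x i j) = g₁ 0 • x i j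
    simp [g₁])

/-- The matrix of functions `t ↦ (1 + t²)⁻¹ x` over `M(F~, A~)`, where `x` is over `F~`. -/
def evenPart {ι κ : Type} (x : Matrix ι κ (Unitization ℂ A)) (hx : OverFixed σ x) :
    Matrix ι κ (ConeUnit σ) :=
  Matrix.of fun i j => Unitization.inr (Cone.mk (tensorC0 g₀ (x i j)) fun z => by
    change σ.unitize.hom z (g₀ 0 • x i j) = g₀ 0 • x i j
    rw [map_smul]
    exact congrArg (g₀ 0 • ·) (congrFun (congrFun (hx z) i) j))

/-- The matrix-valued function
`p_v(t) = [[1 - v v* + t² (1 + t²)⁻¹ v v*, -i t (1 + t²)⁻¹ v], [i t (1 + t²)⁻¹ v*, (1 + t²)⁻¹ v* v]]`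
as a matrix over the unitization of `M(F~, A~)`; note `1 - t² (1 + t²)⁻¹ = (1 + t²)⁻¹`. -/
def putnamMatrix (v : InvPartialIsometry σ) : Matrix (v.ι ⊕ v.ι) (v.ι ⊕ v.ι) (ConeUnit σ) :=
  Matrix.fromBlocks
    (1 - evenPart σ (v.elt * v.eltᴴ) v.range_fixed) (-Complex.I • oddPart σ v.elt)
    (Complex.I • oddPart σ v.eltᴴ) (evenPart σ (v.eltᴴ * v.elt) v.source_fixed)

/-- Evaluation at `t ∈ [0,∞)` on the unitization of the mapping cone. -/
def coneEval (t : ℝ≥0) : ConeUnit σ →⋆ₐ[ℂ] Unitization ℂ A :=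
  Unitization.starLift ((evalC0 (Unitization ℂ A) t).comp (Cone.incl σ.unitize))

theorem coneEval_apply (t : ℝ≥0) (x : ConeUnit σ) :
    coneEval σ t x = algebraMap ℂ _ x.fst + Cone.incl σ.unitize x.snd t := rfl

theorem coneEval_inr (t : ℝ≥0) (f : Cone σ.unitize) :
    coneEval σ t (Unitization.inr f) = Cone.incl σ.unitize f t := by
  rw [coneEval_apply, Unitization.fst_inr, Unitization.snd_inr, map_zero, zero_add]

theorem coneUnit_ext {x y : ConeUnit σ} (h : x.fst = y.fst)
    (h' : ∀ t, coneEval σ t x = coneEval σ t y) : x = y := by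
  refine Unitization.ext h (Cone.ext fun t => ?_)
  have := h' t
  rw [coneEval_apply, coneEval_apply, h] at this
  exact add_left_cancel this

theorem coneMatrix_ext {ι κ : Type} {x y : Matrix ι κ (ConeUnit σ)}
    (h : x.map (augmentation _) = y.map (augmentation _))
    (h' : ∀ t, x.map (coneEval σ t) = y.map (coneEval σ t)) : x = y :=
  Matrix.ext fun i j => coneUnit_ext σ (congrFun (congrFun h i) j)
    fun t => congrFun (congrFun (h' t) i) j

theorem map_smul_matrix {B C : Type*} [Ring B] [StarRing B] [Algebra ℂ B] [Ring C] [StarRing C]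
    [Algebra ℂ C] {ι κ : Type} (φ : B →⋆ₐ[ℂ] C) (c : ℂ) (x : Matrix ι κ B) :
    (c • x).map φ = c • x.map φ := by
  ext i j; simp

theorem oddPart_eval {ι κ : Type} (x : Matrix ι κ (Unitization ℂ A)) (t : ℝ≥0) :
    (oddPart σ x).map (coneEval σ t) = g₁ t • x :=
  Matrix.ext fun _ _ => coneEval_inr σ t _

theorem evenPart_eval {ι κ : Type} (x : Matrix ι κ (Unitization ℂ A)) (hx) (t : ℝ≥0) :
    (evenPart σ x hx).map (coneEval σ t) = g₀ t • x :=
  Matrix.ext fun _ _ => coneEval_inr σ t _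

theorem oddPart_aug {ι κ : Type} (x : Matrix ι κ (Unitization ℂ A)) :
    (oddPart σ x).map (augmentation _) = 0 := rfl

theorem evenPart_aug {ι κ : Type} (x : Matrix ι κ (Unitization ℂ A)) (hx) :
    (evenPart σ x hx).map (augmentation _) = 0 := rfl

theorem map_one_sub {B C : Type*} [Ring B] [StarRing B] [Algebra ℂ B] [Ring C] [StarRing C]
    [Algebra ℂ C] {ι : Type} [DecidableEq ι] (φ : B →⋆ₐ[ℂ] C) (x : Matrix ι ι B) :
    (1 - x).map φ = 1 - x.map φ := by
  ext i j; simp [Matrix.one_apply, apply_ite φ]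

/-- The value of `p_v` at `t`. -/
theorem putnamMatrix_eval (v : InvPartialIsometry σ) (t : ℝ≥0) :
    (putnamMatrix σ v).map (coneEval σ t) = Matrix.fromBlocks
      (1 - g₀ t • (v.elt * v.eltᴴ)) (-(Complex.I * g₁ t) • v.elt)
      ((Complex.I * g₁ t) • v.eltᴴ) (g₀ t • (v.eltᴴ * v.elt)) := by
  rw [putnamMatrix, Matrix.fromBlocks_map, map_one_sub, map_smul_matrix, map_smul_matrix,
    oddPart_eval, oddPart_eval, evenPart_eval, evenPart_eval, smul_smul, smul_smul, neg_mul]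

/-- The value of `p_v` at infinity. -/
theorem putnamMatrix_aug (v : InvPartialIsometry σ) :
    (putnamMatrix σ v).map (augmentation _) = Matrix.fromBlocks 1 0 0 0 := by
  rw [putnamMatrix, Matrix.fromBlocks_map, map_one_sub, map_smul_matrix, map_smul_matrix,
    oddPart_aug, oddPart_aug, evenPart_aug, evenPart_aug, smul_zero, smul_zero, sub_zero]

theorem g_rel (t : ℝ≥0) : g₁ t * g₁ t = g₀ t - g₀ t * g₀ t := by
  have h : (1 + (t : ℝ) ^ 2) ≠ 0 := by positivity
  change (((t : ℝ) / (1 + (t : ℝ) ^ 2) : ℝ) : ℂ) * (((t : ℝ) / (1 + (t : ℝ) ^ 2) : ℝ) : ℂ) =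
    ((1 / (1 + (t : ℝ) ^ 2) : ℝ) : ℂ) - ((1 / (1 + (t : ℝ) ^ 2) : ℝ) : ℂ) *
      ((1 / (1 + (t : ℝ) ^ 2) : ℝ) : ℂ)
  rw [← Complex.ofReal_mul, ← Complex.ofReal_mul, ← Complex.ofReal_sub]
  congr 1
  field_simp
  ring

theorem star_g₀ (t : ℝ≥0) : star (g₀ t) = g₀ t := Complex.conj_ofReal _

theorem star_g₁ (t : ℝ≥0) : star (g₁ t) = g₁ t := Complex.conj_ofReal _

theorem block_idem {B : Type*} [Ring B] [StarRing B] [Algebra ℂ B] {ι : Type} [Fintype ι]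
    [DecidableEq ι] {v : Matrix ι ι B} (hv : v * vᴴ * v = v) (hv' : vᴴ * v * vᴴ = vᴴ) {a b : ℂ}
    (h : b * b = a - a * a) :
    IsIdempotentElem (Matrix.fromBlocks (1 - a • (v * vᴴ)) (-(Complex.I * b) • v)
      ((Complex.I * b) • vᴴ) (a • (vᴴ * v))) := by
  have e1 : v * vᴴ * (v * vᴴ) = v * vᴴ := by rw [← mul_assoc, hv]
  have e2 : vᴴ * v * (vᴴ * v) = vᴴ * v := by rw [← mul_assoc, hv']
  have e3 : v * (vᴴ * v) = v := by rw [← mul_assoc, hv]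
  have e4 : vᴴ * (v * vᴴ) = vᴴ := by rw [← mul_assoc, hv']
  have hI : (Complex.I * b) * (Complex.I * b) = -(a - a * a) := by
    rw [← h]; linear_combination (b * b) * Complex.I_mul_I
  generalize Complex.I * b = d at hI
  rw [IsIdempotentElem, Matrix.fromBlocks_multiply]
  congr 1
  · simp only [sub_mul, mul_sub, Matrix.smul_mul, Matrix.mul_smul, one_mul, mul_one, smul_smul,
      e1, neg_mul, mul_neg, hI]
    module
  · simp only [sub_mul, Matrix.smul_mul, Matrix.mul_smul, one_mul, smul_smul, hv, e3]
    module
  · simp only [mul_sub, Matrix.smul_mul, Matrix.mul_smul, mul_one, smul_smul, hv', e4]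
    module
  · simp only [Matrix.smul_mul, Matrix.mul_smul, smul_smul, e2, neg_mul, hI]
    module

theorem InvPartialIsometry.star_mul_mul {σ : CircleAction A} (v : InvPartialIsometry σ) :
    v.eltᴴ * v.elt * v.eltᴴ = v.eltᴴ := by
  have := congrArg Matrix.conjTranspose v.isPartialIsometry
  rwa [Matrix.conjTranspose_mul, Matrix.conjTranspose_mul, Matrix.conjTranspose_conjTranspose,
    ← mul_assoc] at this

theorem coneEval_equivariant (t : ℝ≥0) (z : Circle) (x : ConeUnit σ) :
    coneEval σ t (unitizeHom (coneAction σ.unitize) z x) =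
      unitizeHom σ.hom z (coneEval σ t x) := by
  rw [unitizeHom_apply, coneEval_apply, coneEval_apply, map_add, AlgHomClass.commutes,
    Unitization.fst_add, Unitization.snd_add, Unitization.fst_inl, Unitization.snd_inl,
    Unitization.fst_inr, Unitization.snd_inr, add_zero, zero_add]
  rfl

theorem invariant_of_eval {ι κ : Type} [Fintype ι] [DecidableEq ι] [Fintype κ] [DecidableEq κ]
    {U : CircleRep ι} {V : CircleRep κ} {x : Matrix ι κ (ConeUnit σ)}
    (h : IsInvariant 1 U V (x.map (augmentation _)))
    (h' : ∀ t, IsInvariant (unitizeHom σ.hom) U V (x.map (coneEval σ t))) :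
    IsInvariant (unitizeHom (coneAction σ.unitize)) U V x := by
  intro z
  refine coneMatrix_ext σ ?_ fun t => ?_
  · conv_rhs => rw [← h z]
    rw [Matrix.map_mul, Matrix.map_mul, map_conjTranspose', map_scalarMatrix, map_scalarMatrix]
    congr 2
    exact Matrix.ext fun i j => augmentation_equivariant (coneAction σ.unitize) z (x i j)
  · conv_rhs => rw [← h' t z]
    rw [Matrix.map_mul, Matrix.map_mul, map_conjTranspose', map_scalarMatrix, map_scalarMatrix]
    congr 2
    exact Matrix.ext fun i j => coneEval_equivariant σ t z (x i j)

section InvariantAlgebra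

variable {B : Type*} [Ring B] [StarRing B] [Algebra ℂ B] [StarModule ℂ B]
  {ι κ μ : Type} [Fintype ι] [DecidableEq ι] [Fintype κ] [DecidableEq κ] [Fintype μ]
  [DecidableEq μ] {α : Circle →* (B →⋆ₐ[ℂ] B)} {U : CircleRep ι} {V : CircleRep κ}
  {W : CircleRep μ}

theorem scalarMatrix_star_mul (U : CircleRep ι) (z : Circle) :
    (scalarMatrix B (U.mat z))ᴴ * scalarMatrix B (U.mat z) = 1 := by
  have h : (U.mat z)ᴴ * U.mat z = 1 := Matrix.mem_unitaryGroup_iff'.1 (U.hom z).2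
  have e : (scalarMatrix B (U.mat z))ᴴ = scalarMatrix B (U.mat z)ᴴ := by
    ext i j; simp [scalarMatrix, ← algebraMap_star_comm]
  rw [e, scalarMatrix, scalarMatrix, ← Matrix.map_mul, h]
  ext i j; simp [Matrix.one_apply, apply_ite (algebraMap ℂ B)]

theorem scalarMatrix_mul_star (U : CircleRep ι) (z : Circle) :
    scalarMatrix B (U.mat z) * (scalarMatrix B (U.mat z))ᴴ = 1 := by
  have e : (scalarMatrix B (U.mat z))ᴴ = scalarMatrix B (U.mat z)ᴴ := by
    ext i j; simp [scalarMatrix, ← algebraMap_star_comm]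
  rw [e, scalarMatrix, scalarMatrix, ← Matrix.map_mul, U.mat_mul_star]
  ext i j; simp [Matrix.one_apply, apply_ite (algebraMap ℂ B)]

theorem IsInvariant.mul {x : Matrix ι κ B} {y : Matrix κ μ B} (hx : IsInvariant α U V x)
    (hy : IsInvariant α V W y) : IsInvariant α U W (x * y) := by
  intro z
  conv_rhs => rw [← hx z, ← hy z]
  rw [Matrix.map_mul]
  simp only [Matrix.mul_assoc]
  rw [← Matrix.mul_assoc (scalarMatrix B (V.mat z))ᴴ, scalarMatrix_star_mul, Matrix.one_mul]

theorem IsInvariant.star {x : Matrix ι κ B} (hx : IsInvariant α U V x) :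
    IsInvariant α V U xᴴ := by
  intro z
  conv_rhs => rw [← hx z]
  simp only [Matrix.conjTranspose_mul, Matrix.conjTranspose_conjTranspose, map_conjTranspose',
    Matrix.mul_assoc]

theorem IsInvariant.smul {x : Matrix ι κ B} (hx : IsInvariant α U V x) (c : ℂ) :
    IsInvariant α U V (c • x) := by
  intro z
  conv_rhs => rw [← hx z]
  rw [map_smul_matrix, Matrix.mul_smul, Matrix.smul_mul]

theorem IsInvariant.one_sub {x : Matrix ι ι B} (hx : IsInvariant α U U x) :
    IsInvariant α U U (1 - x) := by
  intro z
  conv_rhs => rw [← hx z]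
  rw [map_one_sub, Matrix.mul_sub, Matrix.sub_mul, Matrix.mul_one, scalarMatrix_mul_star]

theorem isInvariant_one (α : Circle →* (B →⋆ₐ[ℂ] B)) (U : CircleRep ι) :
    IsInvariant α U U (1 : Matrix ι ι B) := by
  simpa using (isInvariant_zero α U U).one_sub

end InvariantAlgebra

/-- The invariant projection `p_v` over the unitization of `M(F~, A~)`; the circle acts on
`ℂ^ι ⊕ ℂ^ι` by `U ⊕ U`. -/
def putnamProj (v : InvPartialIsometry σ) :
    InvProj (unitizeHom (coneAction σ.unitize)) where
  ι := v.ι ⊕ v.ι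
  rep := v.rep.sum v.rep
  proj := putnamMatrix σ v
  isStarProjection := by
    refine ⟨?_, ?_⟩
    · rw [IsIdempotentElem]
      refine coneMatrix_ext σ ?_ fun t => ?_
      · rw [Matrix.map_mul, putnamMatrix_aug, Matrix.fromBlocks_multiply]; simp
      · rw [Matrix.map_mul, putnamMatrix_eval]
        exact block_idem v.isPartialIsometry v.star_mul_mul (g_rel t)
    · rw [IsSelfAdjoint, Matrix.star_eq_conjTranspose]
      refine coneMatrix_ext σ ?_ fun t => ?_
      · rw [map_conjTranspose', putnamMatrix_aug, Matrix.fromBlocks_conjTranspose]; simp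
      · rw [map_conjTranspose', putnamMatrix_eval, Matrix.fromBlocks_conjTranspose]
        simp only [Matrix.conjTranspose_sub, Matrix.conjTranspose_one, Matrix.conjTranspose_smul,
          Matrix.conjTranspose_mul, Matrix.conjTranspose_conjTranspose, star_mul', star_neg,
          star_g₀, star_g₁, Complex.star_def, Complex.conj_I, neg_mul, neg_neg]
  invariant := by
    refine invariant_of_eval σ ?_ fun t => ?_
    · rw [putnamMatrix_aug]
      exact IsInvariant.fromBlocks (isInvariant_one _ _) (isInvariant_zero _ _ _)
        (isInvariant_zero _ _ _) (isInvariant_zero _ _ _)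
    · rw [putnamMatrix_eval]
      have h := v.invariant
      exact IsInvariant.fromBlocks ((h.mul h.star).smul _).one_sub (h.smul _) (h.star.smul _)
        ((h.star.mul h).smul _)

/-- The constant projection `[[1, 0], [0, 0]]` on `ℂ^ι ⊕ ℂ^ι` with the representation `U ⊕ U`. -/
def cornerProj (v : InvPartialIsometry σ) :
    InvProj (unitizeHom (coneAction σ.unitize)) where
  ι := v.ι ⊕ v.ι
  rep := v.rep.sum v.rep
  proj := Matrix.fromBlocks 1 0 0 0
  isStarProjection := by
    refine ⟨?_, ?_⟩
    · rw [IsIdempotentElem, Matrix.fromBlocks_multiply]; simp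
    · rw [IsSelfAdjoint, Matrix.star_eq_conjTranspose, Matrix.fromBlocks_conjTranspose]; simp
  invariant := IsInvariant.fromBlocks (isInvariant_one _ _) (isInvariant_zero _ _ _)
    (isInvariant_zero _ _ _) (isInvariant_zero _ _ _)

/-- The class `[p_v] - [[[1, 0], [0, 0]]]` in `K₀^𝕋(M(F~, A~))`. -/
def putnamClass (v : InvPartialIsometry σ) : K0Cone σ.unitize :=
  ⟨K0Unital.mk (putnamProj σ v) - K0Unital.mk (cornerProj σ v), by
    change K0Unital.map _ _ (_ - _) = 0
    rw [map_sub, K0Unital.map_mk, K0Unital.map_mk, sub_eq_zero]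
    congr 1
    simp only [InvProj.map, putnamProj, cornerProj, InvProj.mk.injEq, heq_eq_eq, true_and]
    rw [putnamMatrix_aug, Matrix.fromBlocks_map]
    simp⟩

/-- `v` is a partial isometry in `Mat_n(A~)` with `(σ_z ⊗ id)(v) = z^k v`. -/
structure IsHomogeneousPI {n : ℕ} (k : ℤ) (v : Matrix (Fin n) (Fin n) (Unitization ℂ A)) :
    Prop where
  isPartialIsometry : IsPartialIsometry v
  homogeneous : ∀ z : Circle, v.map (unitizeHom σ.hom z) = ((z ^ k : Circle) : ℂ) • v

theorem circle_mul_star (z : Circle) : (z : ℂ) * star (z : ℂ) = 1 := by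
  rw [Complex.star_def, Complex.mul_conj, Circle.normSq_coe, Complex.ofReal_one]

theorem IsHomogeneousPI.star_homogeneous {σ : CircleAction A} {n : ℕ} {k : ℤ}
    {v : Matrix (Fin n) (Fin n) (Unitization ℂ A)} (h : IsHomogeneousPI σ k v) (z : Circle) :
    vᴴ.map (unitizeHom σ.hom z) = star ((z ^ k : Circle) : ℂ) • vᴴ := by
  rw [map_conjTranspose', h.homogeneous z, Matrix.conjTranspose_smul]

theorem overFixed_fromBlocks {ι κ : Type} {x : Matrix ι ι (Unitization ℂ A)}
    {y : Matrix κ κ (Unitization ℂ A)} (hx : OverFixed σ x) (hy : OverFixed σ y) :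
    OverFixed σ (Matrix.fromBlocks x 0 0 y) := fun z => by
  rw [Matrix.fromBlocks_map, hx z, hy z, Matrix.map_zero _ (map_zero _),
    Matrix.map_zero _ (map_zero _)]

theorem overFixed_zero {ι κ : Type} : OverFixed σ (0 : Matrix ι κ (Unitization ℂ A)) :=
  fun z => Matrix.map_zero _ (map_zero _)

/-- For a homogeneous partial isometry `v` of degree `k`, the invariant partial isometry
`w_v = [[0, v], [0, 0]]` in `A~ ⊗ B(ℂ^n ⊕ ℂ^n[k])`, with `ℂ^n` the trivial representation. -/
def twistedCorner {n : ℕ} (k : ℤ) (v : Matrix (Fin n) (Fin n) (Unitization ℂ A))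
    (h : IsHomogeneousPI σ k v) : InvPartialIsometry σ where
  ι := Fin n ⊕ Fin n
  rep := (CircleRep.trivial (Fin n)).sum ((CircleRep.trivial (Fin n)).twist k)
  elt := Matrix.fromBlocks 0 v 0 0
  isPartialIsometry := by
    have := h.isPartialIsometry
    rw [IsPartialIsometry] at this ⊢
    simp [Matrix.fromBlocks_multiply, Matrix.fromBlocks_conjTranspose, this]
  invariant := by
    refine IsInvariant.fromBlocks (isInvariant_zero _ _ _) (fun z => ?_) (isInvariant_zero _ _ _)
      (isInvariant_zero _ _ _)
    have e1 : scalarMatrix (Unitization ℂ A) ((CircleRep.trivial (Fin n)).mat z) = 1 := by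
      ext i j : 1
      simp [scalarMatrix, CircleRep.trivial, CircleRep.ofMat, CircleRep.mat, Matrix.one_apply,
        apply_ite (algebraMap ℂ (Unitization ℂ A))]
    have e2 : scalarMatrix (Unitization ℂ A) (((CircleRep.trivial (Fin n)).twist k).mat z) =
        ((z ^ k : Circle) : ℂ) • 1 := by
      rw [← e1]
      ext i j : 1
      exact (map_mul (algebraMap ℂ (Unitization ℂ A)) _ _).trans (Algebra.smul_def _ _).symm
    rw [e1, e2, h.homogeneous z, Matrix.one_mul, Matrix.conjTranspose_smul,
      Matrix.conjTranspose_one, Matrix.mul_smul, Matrix.smul_mul, Matrix.mul_one, smul_smul,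
      mul_comm, circle_mul_star, one_smul]
  range_fixed := by
    rw [Matrix.fromBlocks_conjTranspose, Matrix.fromBlocks_multiply]
    simp only [Matrix.conjTranspose_zero, Matrix.zero_mul, Matrix.mul_zero, add_zero, zero_add]
    refine overFixed_fromBlocks σ (fun z => ?_) (overFixed_zero σ)
    rw [Matrix.map_mul, h.homogeneous z, h.star_homogeneous z, Matrix.mul_smul, Matrix.smul_mul,
      smul_smul, mul_comm, circle_mul_star, one_smul]
  source_fixed := by
    rw [Matrix.fromBlocks_conjTranspose, Matrix.fromBlocks_multiply]
    simp only [Matrix.conjTranspose_zero, Matrix.zero_mul, Matrix.mul_zero, add_zero, zero_add]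
    refine overFixed_fromBlocks σ (overFixed_zero σ) fun z => ?_
    rw [Matrix.map_mul, h.homogeneous z, h.star_homogeneous z, Matrix.mul_smul, Matrix.smul_mul,
      smul_smul, circle_mul_star, one_smul]

/-! ### Modular partial isometries and the modular `K₁`-group -/

/-- The spectral component `x_k = (2π)⁻¹ ∫₀^{2π} e^{-ikt} σ_t(x) dt`. -/
def spectralComponent (k : ℤ) (x : Unitization ℂ A) : Unitization ℂ A :=
  (2 * Real.pi)⁻¹ • ∫ t in (0 : ℝ)..(2 * Real.pi),
    (Circle.exp (-(k * t)) : ℂ) • unitizeHom σ.hom (Circle.exp t) x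

/-- The spectral component of a matrix, with respect to `σ ⊗ id`. -/
def matrixComponent {ι κ : Type} (k : ℤ) (x : Matrix ι κ (Unitization ℂ A)) :
    Matrix ι κ (Unitization ℂ A) :=
  x.map (spectralComponent σ k)

/-- `v` is a modular partial isometry: `v σ_z(v*)` and `v* σ_z(v)` are over `F~` for all `z`. -/
structure IsModular {ι : Type} [Fintype ι] (v : Matrix ι ι (Unitization ℂ A)) : Prop where
  isPartialIsometry : IsPartialIsometry v
  left : ∀ z, OverFixed σ (v * vᴴ.map (unitizeHom σ.hom z))
  right : ∀ z, OverFixed σ (vᴴ * v.map (unitizeHom σ.hom z))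

/-- A modular partial isometry over `A`, i.e. in `Mat_n(A~)` for some `n`. -/
structure ModularPI where
  n : ℕ
  elt : Matrix (Fin n) (Fin n) (Unitization ℂ A)
  isModular : IsModular σ elt

/-- The block diagonal matrix `v ⊕ w`. -/
def diagSum {B : Type*} [Zero B] {n m : ℕ} (v : Matrix (Fin n) (Fin n) B)
    (w : Matrix (Fin m) (Fin m) B) : Matrix (Fin (n + m)) (Fin (n + m)) B :=
  (Matrix.fromBlocks v 0 0 w).submatrix finSumFinEquiv.symm finSumFinEquiv.symm

variable {σ} in
theorem IsModular.fromBlocks {ι κ : Type} [Fintype ι] [Fintype κ]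
    {v : Matrix ι ι (Unitization ℂ A)} {w : Matrix κ κ (Unitization ℂ A)} (hv : IsModular σ v)
    (hw : IsModular σ w) : IsModular σ (Matrix.fromBlocks v 0 0 w) where
  isPartialIsometry := by
    have h1 := hv.isPartialIsometry
    have h2 := hw.isPartialIsometry
    rw [IsPartialIsometry] at *
    simp [Matrix.fromBlocks_multiply, Matrix.fromBlocks_conjTranspose, h1, h2]
  left z := by
    rw [Matrix.fromBlocks_conjTranspose, Matrix.fromBlocks_map, Matrix.fromBlocks_multiply]
    simp only [Matrix.conjTranspose_zero, Matrix.map_zero _ (map_zero (unitizeHom σ.hom z)),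
      Matrix.zero_mul, Matrix.mul_zero, add_zero, zero_add]
    exact overFixed_fromBlocks σ (hv.left z) (hw.left z)
  right z := by
    rw [Matrix.fromBlocks_conjTranspose, Matrix.fromBlocks_map, Matrix.fromBlocks_multiply]
    simp only [Matrix.conjTranspose_zero, Matrix.map_zero _ (map_zero (unitizeHom σ.hom z)),
      Matrix.zero_mul, Matrix.mul_zero, add_zero, zero_add]
    exact overFixed_fromBlocks σ (hv.right z) (hw.right z)

variable {σ} in
theorem IsModular.submatrix {ι κ : Type} [Fintype ι] [Fintype κ]
    {v : Matrix ι ι (Unitization ℂ A)} (hv : IsModular σ v) (e : κ ≃ ι) :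
    IsModular σ (v.submatrix e e) where
  isPartialIsometry := by
    rw [IsPartialIsometry, Matrix.conjTranspose_submatrix, Matrix.submatrix_mul_equiv,
      Matrix.submatrix_mul_equiv, hv.isPartialIsometry]
  left z w := by
    rw [Matrix.conjTranspose_submatrix, ← Matrix.submatrix_map, Matrix.submatrix_mul_equiv,
      ← Matrix.submatrix_map, hv.left z w]
  right z w := by
    rw [Matrix.conjTranspose_submatrix, ← Matrix.submatrix_map, Matrix.submatrix_mul_equiv,
      ← Matrix.submatrix_map, hv.right z w]

/-- The direct sum of modular partial isometries. -/
def ModularPI.sum {σ : CircleAction A} (v w : ModularPI σ) : ModularPI σ where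
  n := v.n + w.n
  elt := diagSum v.elt w.elt
  isModular := (v.isModular.fromBlocks w.isModular).submatrix _

/-- The relations of the modular `K₁`-group: `[v] = 0` for `v` over `F`, `[v ⊕ w] = [v] + [w]`,
and `[v₀] = [v₁]` for a continuous path `v_t`, `t ∈ [0,1]`, of modular partial isometries. -/
def k1Relations : Set (FreeAbelianGroup (ModularPI σ)) :=
  {x | ∃ v : ModularPI σ, OverFixed σ v.elt ∧ x = FreeAbelianGroup.of v} ∪
  {x | ∃ v w : ModularPI σ, x =
    FreeAbelianGroup.of v + FreeAbelianGroup.of w - FreeAbelianGroup.of (v.sum w)} ∪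
  {x | ∃ (n : ℕ) (v : unitInterval → Matrix (Fin n) (Fin n) (Unitization ℂ A))
      (hv : ∀ t, IsModular σ (v t)), Continuous v ∧
      x = FreeAbelianGroup.of (⟨n, v 0, hv 0⟩ : ModularPI σ) -
        FreeAbelianGroup.of (⟨n, v 1, hv 1⟩ : ModularPI σ)}

/-- The modular `K₁`-group `K₁(A, σ)`. -/
def ModularK1 : Type _ :=
  FreeAbelianGroup (ModularPI σ) ⧸ AddSubgroup.closure (k1Relations σ)

instance : AddCommGroup (ModularK1 σ) :=
  inferInstanceAs (AddCommGroup (FreeAbelianGroup (ModularPI σ) ⧸ _))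

/-- The class `[v]` of a modular partial isometry in `K₁(A, σ)`. -/
def ModularK1.mk {σ : CircleAction A} (v : ModularPI σ) : ModularK1 σ :=
  QuotientAddGroup.mk (FreeAbelianGroup.of v)

/-- `c` is the class `≪v≫ ∈ K₀^𝕋(M(F, A))` of a homogeneous partial isometry `v` of degree `k`:
the image of `c` under the inclusion `M(F, A) → M(F~, A~)` is the class
`[p_w] - [[[1, 0], [0, 0]]]` of the invariant partial isometry `w = [[0, v], [0, 0]]`. -/
def IsTwistedClass {σ : CircleAction A} {n : ℕ} {k : ℤ}
    {v : Matrix (Fin n) (Fin n) (Unitization ℂ A)} (h : IsHomogeneousPI σ k v)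
    (c : K0Cone σ) : Prop :=
  coneInclusion σ c = putnamClass σ (twistedCorner σ k v h)

end PartialIsometries

end

end ModularK

/-! Injectivity of `coneInclusion`. Taking scalar parts pointwise is an equivariant retraction e of
M(F~, A~) onto M(ℂ, ℂ) with kernel M(F, A). Hence the unitization of M(F, A) is the inverse image of
the scalars under the unitized e; `ScalarPullback` records this situation. Suppose a projection p
over the small algebra becomes equivalent to an identity over the large one, through an isometry x.
With w the scalar matrix of x at infinity, e(x)* w is unitary, so x e(x)* w implements the same
equivalence. Its retraction is scalar, so it lives over the small algebra
(`ScalarPullback.equiv_one_of_map`). Every kernel class reduces to this case after adding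
identities.

Existence of the classes. If w is over F~, a rotation with sine (1 + t²)^{-1/2} is an invariant
unitary carrying diag(1, 0) to p_w (`rotationMatrix_corner`), so the class of w vanishes. For
general w the same rotation, built from the scalar part of w, shows that e(p_w) is conjugate to a
scalar projection by a unitary fixed by e. Undoing that conjugation moves p_w into the unitization
of M(F, A) (`exists_coneInclusion_eq_putnamClass`).

Spectral components. Modularity gives σ_w(v*) σ_z(v) = v* σ_{z/w}(v). Averaging against z^{-k} shows
that q_k = v* v_k is fixed, equals v_k* v_k and is a projection with v_k = v q_k; so v_k is a
partial isometry. Moreover v* σ_z(v) q_k = z^k q_k. At z = e^{iπ/k} the factor is -1, while v*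
σ_z(v) tends to v* v, which acts as 1 on q_k; hence q_k = 0 for all but finitely many k.

The homomorphism. If v is over F~, so is each v_k, and its class is 0. Direct sums only permute
basis vectors. Along a path of modular v the component v_k moves continuously, hence so does p_w,
and close invariant projections are equivalent through an invariant partial isometry
(`equiv_of_continuous`). These relations are checked in M(F~, A~) and transported back by
injectivity of `coneInclusion`. Uniqueness of T holds because the classes [v] generate and each
≪v_k≫ is determined by its image. -/

namespace ModularK

noncomputable section

/-! ### Stable equivalence and the standard picture of equivariant K₀. -/

section KTheoryLemmas

variable {B : Type*} [Ring B] [StarRing B] [Algebra ℂ B] [StarModule ℂ B]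
  {α : Circle →* (B →⋆ₐ[ℂ] B)}

theorem InvProj.proj_mul_self (p : InvProj α) : p.proj * p.proj = p.proj :=
  p.isStarProjection.isIdempotentElem.eq

theorem InvProj.proj_conjTranspose (p : InvProj α) : p.projᴴ = p.proj := by
  have := p.isStarProjection.isSelfAdjoint
  rwa [IsSelfAdjoint, Matrix.star_eq_conjTranspose] at this

theorem InvProj.Equiv.refl (p : InvProj α) : p.Equiv p :=
  ⟨p.proj, p.invariant, by rw [p.proj_conjTranspose, p.proj_mul_self],
    by rw [p.proj_conjTranspose, p.proj_mul_self]⟩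

theorem InvProj.Equiv.symm {p q : InvProj α} (h : p.Equiv q) : q.Equiv p := by
  obtain ⟨x, hx, h1, h2⟩ := h
  exact ⟨xᴴ, hx.star, by rw [Matrix.conjTranspose_conjTranspose, h2],
    by rw [Matrix.conjTranspose_conjTranspose, h1]⟩

theorem InvProj.Equiv.trans {p q r : InvProj α} (h : p.Equiv q) (h' : q.Equiv r) :
    p.Equiv r := by
  obtain ⟨x, hx, h1, h2⟩ := h
  obtain ⟨y, hy, h3, h4⟩ := h'
  refine ⟨x * y, hx.mul hy, ?_, ?_⟩
  · calc x * y * (x * y)ᴴ = x * (y * yᴴ) * xᴴ := by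
          simp only [Matrix.conjTranspose_mul, Matrix.mul_assoc]
      _ = (x * xᴴ) * (x * xᴴ) := by rw [h3, ← h2]; simp only [Matrix.mul_assoc]
      _ = p.proj := by rw [h1, p.proj_mul_self]
  · calc (x * y)ᴴ * (x * y) = yᴴ * (xᴴ * x) * y := by
          simp only [Matrix.conjTranspose_mul, Matrix.mul_assoc]
      _ = (yᴴ * y) * (yᴴ * y) := by rw [h2, ← h3]; simp only [Matrix.mul_assoc]
      _ = r.proj := by rw [h4, r.proj_mul_self]

theorem IsInvariant.fromBlocks' {ι ι' κ κ' : Type} [Fintype ι] [DecidableEq ι] [Fintype κ]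
    [DecidableEq κ] [Fintype ι'] [DecidableEq ι'] [Fintype κ'] [DecidableEq κ']
    {U : CircleRep ι} {U' : CircleRep ι'} {V : CircleRep κ} {V' : CircleRep κ'}
    {a : Matrix ι κ B} {b : Matrix ι κ' B} {c : Matrix ι' κ B} {d : Matrix ι' κ' B}
    (ha : IsInvariant α U V a) (hb : IsInvariant α U V' b) (hc : IsInvariant α U' V c)
    (hd : IsInvariant α U' V' d) :
    IsInvariant α (U.sum U') (V.sum V') (Matrix.fromBlocks a b c d) := by
  intro z
  have e : (U.sum U').mat z = Matrix.fromBlocks (U.mat z) 0 0 (U'.mat z) := rfl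
  have e' : (V.sum V').mat z = Matrix.fromBlocks (V.mat z) 0 0 (V'.mat z) := rfl
  rw [e, e', scalarMatrix_fromBlocks, scalarMatrix_fromBlocks, Matrix.fromBlocks_map,
    Matrix.fromBlocks_conjTranspose, scalarMatrix_zero, scalarMatrix_zero, scalarMatrix_zero,
    scalarMatrix_zero, Matrix.fromBlocks_multiply, Matrix.fromBlocks_multiply]
  simp only [Matrix.conjTranspose_zero, Matrix.zero_mul, Matrix.mul_zero, add_zero, zero_add]
  rw [ha z, hb z, hc z, hd z]

theorem InvProj.Equiv.sum {p p' q q' : InvProj α} (h : p.Equiv p') (h' : q.Equiv q') :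
    (p.sum q).Equiv (p'.sum q') := by
  obtain ⟨x, hx, h1, h2⟩ := h
  obtain ⟨y, hy, h3, h4⟩ := h'
  have e1 : Matrix.fromBlocks x 0 0 y * (Matrix.fromBlocks x 0 0 y)ᴴ =
      Matrix.fromBlocks p.proj 0 0 q.proj := by
    rw [Matrix.fromBlocks_conjTranspose, Matrix.fromBlocks_multiply]
    simp only [Matrix.conjTranspose_zero, Matrix.zero_mul, Matrix.mul_zero, add_zero, zero_add,
      h1, h3]
  have e2 : (Matrix.fromBlocks x 0 0 y)ᴴ * Matrix.fromBlocks x 0 0 y =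
      Matrix.fromBlocks p'.proj 0 0 q'.proj := by
    rw [Matrix.fromBlocks_conjTranspose, Matrix.fromBlocks_multiply]
    simp only [Matrix.conjTranspose_zero, Matrix.zero_mul, Matrix.mul_zero, add_zero, zero_add,
      h2, h4]
  exact ⟨Matrix.fromBlocks x 0 0 y, hx.fromBlocks' (isInvariant_zero _ _ _)
    (isInvariant_zero _ _ _) hy, e1, e2⟩

/-- Projections that differ by a relabelling of the basis are equivalent. -/
theorem InvProj.Equiv.of_reindex {p q : InvProj α} (e : q.ι ≃ p.ι)
    (hrep : ∀ z, q.rep.mat z = (p.rep.mat z).submatrix e e)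
    (hproj : q.proj = p.proj.submatrix e e) : p.Equiv q := by
  refine ⟨p.proj.submatrix id e, fun z => ?_, ?_, ?_⟩
  · conv_rhs => rw [← p.invariant z]
    have h : scalarMatrix B ((p.rep.mat z).submatrix e e) =
      (scalarMatrix B (p.rep.mat z)).submatrix e e := rfl
    rw [hrep, h, ← Matrix.submatrix_map, Matrix.conjTranspose_submatrix,
      ← Matrix.submatrix_mul_equiv _ _ id e e,
      ← Matrix.submatrix_mul_equiv _ _ id (_root_.Equiv.refl _) e]
    rfl
  · rw [Matrix.conjTranspose_submatrix, Matrix.submatrix_mul_equiv, p.proj_conjTranspose,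
      p.proj_mul_self, Matrix.submatrix_id_id]
  · rw [Matrix.conjTranspose_submatrix, p.proj_conjTranspose, hproj]
    conv_rhs => rw [← p.proj_mul_self]
    exact Matrix.submatrix_mul_equiv p.proj p.proj e (_root_.Equiv.refl _) e

theorem CircleRep.sum_mat {ι κ : Type} [Fintype ι] [DecidableEq ι] [Fintype κ] [DecidableEq κ]
    (U : CircleRep ι) (V : CircleRep κ) (z : Circle) :
    (U.sum V).mat z = Matrix.fromBlocks (U.mat z) 0 0 (V.mat z) := rfl

theorem CircleRep.trivial_mat {ι : Type} [Fintype ι] [DecidableEq ι] (z : Circle) :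
    (CircleRep.trivial ι).mat z = 1 := rfl

theorem InvProj.sum_comm_equiv (p q : InvProj α) : (p.sum q).Equiv (q.sum p) := by
  refine .of_reindex (p := p.sum q) (q := q.sum p) (Equiv.sumComm q.ι p.ι) (fun z => ?_) ?_
  · change (q.rep.sum p.rep).mat z = ((p.rep.sum q.rep).mat z).submatrix _ _
    rw [CircleRep.sum_mat, CircleRep.sum_mat]
    ext (i | i) (j | j) <;> rfl
  · ext (i | i) (j | j) <;> rfl

theorem InvProj.sum_assoc_equiv (p q r : InvProj α) :
    ((p.sum q).sum r).Equiv (p.sum (q.sum r)) := by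
  refine .of_reindex (p := (p.sum q).sum r) (q := p.sum (q.sum r))
    (Equiv.sumAssoc p.ι q.ι r.ι).symm (fun z => ?_) ?_
  · change (p.rep.sum (q.rep.sum r.rep)).mat z =
      (((p.rep.sum q.rep).sum r.rep).mat z).submatrix _ _
    simp only [CircleRep.sum_mat]
    ext (i | i | i) (j | j | j) <;> rfl
  · ext (i | i | i) (j | j | j) <;> rfl

variable (α) in
/-- The identity of `B ⊗ B(ℂ^ι)` as an invariant projection. -/
def InvProj.one {ι : Type} [Fintype ι] [DecidableEq ι] (U : CircleRep ι) : InvProj α where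
  ι := ι
  rep := U
  proj := 1
  isStarProjection := .one _
  invariant := isInvariant_one α U

/-- The complementary projection. -/
def InvProj.compl (p : InvProj α) : InvProj α where
  ι := p.ι
  rep := p.rep
  proj := 1 - p.proj
  isStarProjection := p.isStarProjection.one_sub
  invariant := p.invariant.one_sub

theorem InvProj.sum_empty_equiv (p : InvProj α) :
    ((InvProj.one α (CircleRep.trivial Empty)).sum p).Equiv p := by
  refine .of_reindex (p := (InvProj.one α (CircleRep.trivial Empty)).sum p) (q := p)
    (Equiv.emptySum Empty p.ι).symm (fun z => ?_) ?_
  · change _ = (((CircleRep.trivial Empty).sum p.rep).mat z).submatrix _ _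
    rw [CircleRep.sum_mat]
    ext i j; rfl
  · ext i j; rfl

/-- The column with blocks p and 1 - p is an isometry with range p ⊕ (1 - p). This is what allows
arbitrary stabilising or subtracted projections to be replaced by identities. -/
theorem InvProj.sum_compl_equiv (p : InvProj α) :
    (p.sum p.compl).Equiv (InvProj.one α p.rep) := by
  have h1 := p.proj_mul_self
  have h2 := p.proj_conjTranspose
  have h3 : (1 - p.proj) * (1 - p.proj) = 1 - p.proj := p.compl.proj_mul_self
  have h4 : (1 - p.proj)ᴴ = 1 - p.proj := p.compl.proj_conjTranspose
  have h5 : p.proj * (1 - p.proj) = 0 := by rw [mul_sub, mul_one, h1, sub_self]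
  have h6 : (1 - p.proj) * p.proj = 0 := by rw [sub_mul, one_mul, h1, sub_self]
  have hinv : IsInvariant α (p.rep.sum p.rep) p.rep (Matrix.fromRows p.proj (1 - p.proj)) := by
    intro z
    have e : (Matrix.fromRows p.proj (1 - p.proj)).map (α z) =
      Matrix.fromRows (p.proj.map (α z)) ((1 - p.proj).map (α z)) := by
      ext (i | i) j <;> rfl
    rw [CircleRep.sum_mat, scalarMatrix_fromBlocks, scalarMatrix_zero, e,
      Matrix.fromBlocks_mul_fromRows, Matrix.fromRows_mul]
    simp only [Matrix.zero_mul, add_zero, zero_add]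
    rw [p.invariant z, p.invariant.one_sub z]
  have e1 : Matrix.fromRows p.proj (1 - p.proj) * (Matrix.fromRows p.proj (1 - p.proj))ᴴ =
      Matrix.fromBlocks p.proj 0 0 (1 - p.proj) := by
    rw [Matrix.conjTranspose_fromRows_eq_fromCols_conjTranspose, Matrix.fromRows_mul_fromCols,
      h2, h4, h1, h3, h5, h6]
  have e2 : (Matrix.fromRows p.proj (1 - p.proj))ᴴ * Matrix.fromRows p.proj (1 - p.proj) = 1 := by
    rw [Matrix.conjTranspose_fromRows_eq_fromCols_conjTranspose, Matrix.fromCols_mul_fromRows,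
      h2, h4, h1, h3, add_sub_cancel]
  exact ⟨_, hinv, e1, e2⟩

variable (α) in
/-- Equivariant Murray-von Neumann equivalence as a setoid. -/
def InvProj.setoid : Setoid (InvProj α) where
  r := InvProj.Equiv
  iseqv := ⟨.refl, .symm, .trans⟩

variable (α) in
/-- The semigroup of equivalence classes of invariant projections. -/
def ProjClass : Type _ := Quotient (InvProj.setoid α)

/-- The equivalence class of an invariant projection. -/
def ProjClass.mk (p : InvProj α) : ProjClass α := Quotient.mk (InvProj.setoid α) p

theorem ProjClass.mk_eq_mk {p q : InvProj α} :
    ProjClass.mk p = ProjClass.mk q ↔ p.Equiv q :=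
  Quotient.eq (r := InvProj.setoid α)

/-- The neutral element is the identity of the zero-dimensional representation, indexed by `Empty`.
-/
instance : AddCommMonoid (ProjClass α) where
  add := Quotient.map₂ InvProj.sum fun _ _ h _ _ h' => InvProj.Equiv.sum h h'
  zero := ProjClass.mk (InvProj.one α (CircleRep.trivial Empty))
  add_comm := by
    rintro ⟨p⟩ ⟨q⟩
    exact ProjClass.mk_eq_mk.2 (p.sum_comm_equiv q)
  add_assoc := by
    rintro ⟨p⟩ ⟨q⟩ ⟨r⟩
    exact ProjClass.mk_eq_mk.2 (p.sum_assoc_equiv q r)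
  zero_add := by
    rintro ⟨p⟩
    exact ProjClass.mk_eq_mk.2 p.sum_empty_equiv
  add_zero := by
    rintro ⟨p⟩
    exact ProjClass.mk_eq_mk.2 ((InvProj.sum_comm_equiv _ _).trans p.sum_empty_equiv)
  nsmul := @nsmulRec _ ⟨ProjClass.mk (InvProj.one α (CircleRep.trivial Empty))⟩
    ⟨Quotient.map₂ InvProj.sum fun _ _ h _ _ h' => InvProj.Equiv.sum h h'⟩
  nsmul_zero := fun _ => rfl
  nsmul_succ := fun _ _ => rfl

theorem ProjClass.mk_add_mk (p q : InvProj α) :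
    ProjClass.mk p + ProjClass.mk q = ProjClass.mk (p.sum q) := rfl

theorem K0Unital.mk_eq_of_equiv {p q : InvProj α} (h : p.Equiv q) :
    K0Unital.mk p = K0Unital.mk q := by
  refine (QuotientAddGroup.eq_iff_sub_mem).2 (AddSubgroup.subset_closure (Or.inl ⟨p, q, h, rfl⟩))

theorem K0Unital.mk_sum (p q : InvProj α) :
    K0Unital.mk (p.sum q) = K0Unital.mk p + K0Unital.mk q := by
  rw [← sub_eq_zero, ← sub_sub]
  exact (QuotientAddGroup.eq_zero_iff _).2
    (AddSubgroup.subset_closure (Or.inr ⟨p, q, rfl⟩))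

variable (α) in
/-- The comparison of `K₀` with the Grothendieck group of the semigroup of classes. -/
def K0Unital.toGrothendieck :
    K0Unital α →+ Algebra.GrothendieckAddGroup (ProjClass α) :=
  QuotientAddGroup.lift _ (FreeAbelianGroup.lift fun p =>
    Algebra.GrothendieckAddGroup.of (ProjClass.mk p)) <| by
    rw [AddSubgroup.closure_le]
    rintro x (⟨p, q, h, rfl⟩ | ⟨p, q, rfl⟩)
    · change FreeAbelianGroup.lift _ _ = 0
      rw [map_sub, FreeAbelianGroup.lift_apply_of, FreeAbelianGroup.lift_apply_of,
        ProjClass.mk_eq_mk.2 h, sub_self]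
    · change FreeAbelianGroup.lift _ _ = 0
      rw [map_sub, map_sub, FreeAbelianGroup.lift_apply_of, FreeAbelianGroup.lift_apply_of,
        FreeAbelianGroup.lift_apply_of, ← ProjClass.mk_add_mk, map_add]
      abel

theorem K0Unital.toGrothendieck_mk (p : InvProj α) :
    K0Unital.toGrothendieck α (K0Unital.mk p) =
      Algebra.GrothendieckAddGroup.of (ProjClass.mk p) :=
  FreeAbelianGroup.lift_apply_of _ _

/-- Projections with the same class in `K₀` are stably equivalent. -/
theorem K0Unital.exists_sum_equiv_of_mk_eq {p q : InvProj α}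
    (h : K0Unital.mk p = K0Unital.mk q) : ∃ r : InvProj α, (p.sum r).Equiv (q.sum r) := by
  have h1 := congrArg (K0Unital.toGrothendieck α) h
  rw [toGrothendieck_mk, toGrothendieck_mk] at h1
  -- Two elements of a monoid agree in its Grothendieck group exactly when they agree after adding a
  -- common element.
  obtain ⟨⟨c, _⟩, hc⟩ := (AddLocalization.addMonoidOf ⊤).exists_of_eq h1
  induction c using Quotient.inductionOn with
  | h r =>
    refine ⟨r, ProjClass.mk_eq_mk.1 ?_⟩
    rw [← ProjClass.mk_add_mk, ← ProjClass.mk_add_mk, add_comm, add_comm (ProjClass.mk q)]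
    exact hc

/-- Projections with the same class in `K₀` become equivalent after adding an identity. -/
theorem K0Unital.exists_sum_one_equiv_of_mk_eq {p q : InvProj α}
    (h : K0Unital.mk p = K0Unital.mk q) :
    ∃ r : InvProj α, (p.sum (.one α r.rep)).Equiv (q.sum (.one α r.rep)) := by
  obtain ⟨r, hr⟩ := exists_sum_equiv_of_mk_eq h
  refine ⟨r, ProjClass.mk_eq_mk.1 ?_⟩
  have h2 := ProjClass.mk_eq_mk.2 hr
  rw [← ProjClass.mk_add_mk, ← ProjClass.mk_add_mk] at h2 ⊢
  rw [← ProjClass.mk_eq_mk.2 r.sum_compl_equiv, ← ProjClass.mk_add_mk, ← add_assoc, h2, add_assoc]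

/-- Every element of `K₀` is the difference of a class and the class of an identity. -/
theorem K0Unital.exists_eq_mk_sub_mk_one (x : K0Unital α) :
    ∃ p q : InvProj α, x = K0Unital.mk p - K0Unital.mk (.one α q.rep) := by
  have key : ∀ y : FreeAbelianGroup (InvProj α), ∃ p q : InvProj α,
      (QuotientAddGroup.mk y : K0Unital α) = K0Unital.mk p - K0Unital.mk q := by
    intro y
    induction y using FreeAbelianGroup.induction_on with
    | zero =>
      exact ⟨.one α (.trivial Empty), .one α (.trivial Empty), (sub_self _).symm⟩
    | of p =>
      refine ⟨p.sum (.one α (.trivial Empty)), .one α (.trivial Empty), ?_⟩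
      rw [mk_sum, add_sub_cancel_right]; rfl
    | neg p _ =>
      refine ⟨.one α (.trivial Empty), p.sum (.one α (.trivial Empty)), ?_⟩
      rw [mk_sum, sub_add_cancel_right]; rfl
    | add a b ha hb =>
      obtain ⟨p, q, h⟩ := ha
      obtain ⟨p', q', h'⟩ := hb
      refine ⟨p.sum p', q.sum q', ?_⟩
      rw [mk_sum, mk_sum, add_sub_add_comm, ← h, ← h']; rfl
  obtain ⟨y, rfl⟩ := QuotientAddGroup.mk_surjective x
  obtain ⟨p, q, h⟩ := key y
  -- [p] - [q] = ([p] + [1 - q]) - [1].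
  refine ⟨p.sum q.compl, q, ?_⟩
  rw [h, mk_sum, ← mk_eq_of_equiv q.sum_compl_equiv, mk_sum]
  abel

end KTheoryLemmas

/-! ### Injectivity on K₀ for the inverse image of the scalars under a retraction. -/

section SplitInjective

variable {B C : Type*} [Ring B] [StarRing B] [Algebra ℂ B] [StarModule ℂ B]
  [Ring C] [StarRing C] [Algebra ℂ C] [StarModule ℂ C]
  {α : Circle →* (B →⋆ₐ[ℂ] B)} {β : Circle →* (C →⋆ₐ[ℂ] C)}
  {ι κ μ : Type} [Fintype ι] [DecidableEq ι] [Fintype κ] [DecidableEq κ] [Fintype μ]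
  [DecidableEq μ]

theorem scalarMatrix_mul (M : Matrix ι κ ℂ) (N : Matrix κ μ ℂ) :
    scalarMatrix B (M * N) = scalarMatrix B M * scalarMatrix B N :=
  Matrix.map_mul

theorem scalarMatrix_conjTranspose (M : Matrix ι κ ℂ) :
    scalarMatrix B Mᴴ = (scalarMatrix B M)ᴴ := by
  ext i j; simp [scalarMatrix, ← algebraMap_star_comm]

theorem scalarMatrix_one : scalarMatrix B (1 : Matrix ι ι ℂ) = 1 :=
  Matrix.map_one _ (map_zero _) (map_one _)

theorem map_one_matrix (φ : B →⋆ₐ[ℂ] C) : (1 : Matrix ι ι B).map φ = 1 :=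
  Matrix.map_one _ (map_zero _) (map_one _)

/-- Invariance over ℂ with trivial action means that M intertwines V and U, a condition that
survives in every unital algebra since the action fixes scalars. -/
theorem isInvariant_scalarMatrix {U : CircleRep ι} {V : CircleRep κ} {M : Matrix ι κ ℂ}
    (h : IsInvariant (1 : Circle →* (ℂ →⋆ₐ[ℂ] ℂ)) U V M) :
    IsInvariant α U V (scalarMatrix B M) := by
  intro z
  have h1 : U.mat z * M * (V.mat z)ᴴ = M := by
    have := h z
    have e : ∀ {ι κ : Type} (N : Matrix ι κ ℂ), scalarMatrix ℂ N = N := fun N => by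
      ext i j; rfl
    have e' : M.map ((1 : Circle →* (ℂ →⋆ₐ[ℂ] ℂ)) z) = M := by ext i j; rfl
    rwa [e, e, e'] at this
  rw [map_scalarMatrix, ← scalarMatrix_conjTranspose, ← scalarMatrix_mul, ← scalarMatrix_mul, h1]

theorem InvProj.map_one {φ : B →⋆ₐ[ℂ] C} {hφ : ∀ z b, φ (α z b) = β z (φ b)}
    (U : CircleRep ι) : (InvProj.one α U).map φ hφ = .one β U := by
  simp only [InvProj.map, InvProj.one, InvProj.mk.injEq, heq_eq_eq, true_and]
  exact map_one_matrix φ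

theorem InvProj.map_sum {φ : B →⋆ₐ[ℂ] C} {hφ : ∀ z b, φ (α z b) = β z (φ b)}
    (p q : InvProj α) : (p.sum q).map φ hφ = (p.map φ hφ).sum (q.map φ hφ) := by
  simp only [InvProj.map, InvProj.sum, Matrix.fromBlocks_map, InvProj.mk.injEq, true_and,
    Matrix.map_zero _ (_root_.map_zero φ)]
  exact ⟨HEq.rfl, HEq.rfl, HEq.rfl, HEq.rfl⟩

theorem InvProj.one_sum_one (U : CircleRep ι) (V : CircleRep κ) :
    (InvProj.one α U).sum (.one α V) = .one α (U.sum V) := by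
  simp only [InvProj.sum, InvProj.one, InvProj.mk.injEq, true_and]
  exact ⟨HEq.rfl, HEq.rfl, HEq.rfl, heq_of_eq Matrix.fromBlocks_one⟩

/-- The composite is a separate homomorphism χ, required to agree with ψ ∘ φ only pointwise. -/
theorem K0Unital.map_map {D : Type*} [Ring D] [StarRing D] [Algebra ℂ D] [StarModule ℂ D]
    {γ : Circle →* (D →⋆ₐ[ℂ] D)} {φ : B →⋆ₐ[ℂ] C} (hφ : ∀ z b, φ (α z b) = β z (φ b))
    {ψ : C →⋆ₐ[ℂ] D} (hψ : ∀ z b, ψ (β z b) = γ z (ψ b)) {χ : B →⋆ₐ[ℂ] D}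
    (hχ : ∀ z b, χ (α z b) = γ z (χ b)) (h : ∀ b, ψ (φ b) = χ b) (x : K0Unital α) :
    K0Unital.map ψ hψ (K0Unital.map φ hφ x) = K0Unital.map χ hχ x := by
  obtain ⟨p, q, rfl⟩ := K0Unital.exists_eq_mk_sub_mk_one x
  have key : ∀ p : InvProj α, (p.map φ hφ).map ψ hψ = p.map χ hχ := by
    intro p
    simp only [InvProj.map, InvProj.mk.injEq, heq_eq_eq, true_and, Matrix.map_map]
    exact congrArg p.proj.map (funext h)
  simp only [map_sub, K0Unital.map_mk, key]

/-- An invariant matrix with entries in the range of an injective equivariant homomorphism is the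
image of an invariant matrix. -/
theorem exists_invariant_preimage {φ : B →⋆ₐ[ℂ] C} (hφ : ∀ z b, φ (α z b) = β z (φ b))
    (hinj : Function.Injective φ) {U : CircleRep ι} {V : CircleRep κ} {y : Matrix ι κ C}
    (hy : IsInvariant β U V y) (h : ∀ i j, y i j ∈ Set.range φ) :
    ∃ x : Matrix ι κ B, IsInvariant α U V x ∧ x.map φ = y := by
  choose f hf using h
  have e : (Matrix.of f).map φ = y := by ext i j; exact hf i j
  refine ⟨Matrix.of f, fun z => ?_, e⟩
  apply Matrix.map_injective hinj
  change Matrix.map _ φ = Matrix.map _ φ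
  rw [Matrix.map_mul, Matrix.map_mul, map_conjTranspose', map_scalarMatrix, map_scalarMatrix, e]
  conv_rhs => rw [← hy z]
  congr 2
  rw [← e]
  ext i j
  exact hφ z _

/-- An equivariant inclusion `φ : B → C` of augmented algebras together with a retraction `e` of
`C` onto a subalgebra such that `φ(B)` is the inverse image of the scalars under `e`. -/
structure ScalarPullback (α : Circle →* (B →⋆ₐ[ℂ] B)) (β : Circle →* (C →⋆ₐ[ℂ] C)) where
  incl : B →⋆ₐ[ℂ] C
  retr : C →⋆ₐ[ℂ] C
  aug : B →⋆ₐ[ℂ] ℂ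
  aug' : C →⋆ₐ[ℂ] ℂ
  incl_equivariant : ∀ z b, incl (α z b) = β z (incl b)
  retr_equivariant : ∀ z c, retr (β z c) = β z (retr c)
  aug'_equivariant : ∀ z c, aug' (β z c) = (1 : Circle →* (ℂ →⋆ₐ[ℂ] ℂ)) z (aug' c)
  incl_injective : Function.Injective incl
  retr_retr : ∀ c, retr (retr c) = retr c
  retr_incl : ∀ b, retr (incl b) = algebraMap ℂ C (aug b)
  aug'_incl : ∀ b, aug' (incl b) = aug b
  mem_range : ∀ c l, retr c = algebraMap ℂ C l → c ∈ Set.range incl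

namespace ScalarPullback

variable (S : ScalarPullback α β)

theorem mem_range_of_map {y : Matrix ι κ C} {M : Matrix ι κ ℂ}
    (h : y.map S.retr = scalarMatrix C M) (i : ι) (j : κ) : y i j ∈ Set.range S.incl :=
  S.mem_range _ (M i j) (congrFun (congrFun h i) j)

/-- Write e for `S.retr`. Both e(x) and the scalar matrix w of x are isometries with range the
scalar projection P of p. So e(x)* w is unitary, and y = x e(x)* w satisfies y y* = x x* and y* y =
1. Since e(y) = e(x) e(x)* w = P w is scalar, y comes from B. -/
theorem equiv_one_of_map {p : InvProj α} {U : CircleRep ι}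
    (h : (p.map S.incl S.incl_equivariant).Equiv (.one β U)) : p.Equiv (.one α U) := by
  obtain ⟨x, hx, h1, h2⟩ := h
  change Matrix p.ι ι C at x
  change IsInvariant β p.rep U x at hx
  change x * xᴴ = p.proj.map S.incl at h1
  change xᴴ * x = 1 at h2
  set P : Matrix p.ι p.ι C := scalarMatrix C (p.proj.map S.aug) with hP
  set w : Matrix p.ι ι C := scalarMatrix C (x.map S.aug') with hw
  set ex := x.map S.retr with hex
  have e1 : ex * exᴴ = P := by
    rw [hex, ← map_conjTranspose', ← Matrix.map_mul, h1]
    ext i j; exact S.retr_incl _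
  have e2 : exᴴ * ex = 1 := by
    rw [hex, ← map_conjTranspose', ← Matrix.map_mul, h2, map_one_matrix]
  have w1 : w * wᴴ = P := by
    rw [hw, ← scalarMatrix_conjTranspose, ← map_conjTranspose', ← scalarMatrix_mul,
      ← Matrix.map_mul, h1]
    congr 1
    ext i j; exact S.aug'_incl _
  have w2 : wᴴ * w = 1 := by
    rw [hw, ← scalarMatrix_conjTranspose, ← map_conjTranspose', ← scalarMatrix_mul,
      ← Matrix.map_mul, h2, map_one_matrix, scalarMatrix_one]
  have y1 : (x * exᴴ * w) * (x * exᴴ * w)ᴴ = p.proj.map S.incl := by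
    calc (x * exᴴ * w) * (x * exᴴ * w)ᴴ = x * exᴴ * (w * wᴴ) * ex * xᴴ := by
          simp only [Matrix.conjTranspose_mul, Matrix.conjTranspose_conjTranspose, Matrix.mul_assoc]
      _ = x * ((exᴴ * ex) * (exᴴ * ex)) * xᴴ := by rw [w1, ← e1]; simp only [Matrix.mul_assoc]
      _ = _ := by rw [e2, Matrix.mul_one, Matrix.mul_one, h1]
  have y2 : (x * exᴴ * w)ᴴ * (x * exᴴ * w) = 1 := by
    calc (x * exᴴ * w)ᴴ * (x * exᴴ * w) = wᴴ * (ex * (xᴴ * x) * exᴴ) * w := by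
          simp only [Matrix.conjTranspose_mul, Matrix.conjTranspose_conjTranspose, Matrix.mul_assoc]
      _ = (wᴴ * w) * (wᴴ * w) := by
          rw [h2, Matrix.mul_one, e1, ← w1]; simp only [Matrix.mul_assoc]
      _ = 1 := by rw [w2, Matrix.mul_one]
  have yinv : IsInvariant β p.rep U (x * exᴴ * w) :=
    (hx.mul (hx.map S.retr_equivariant).star).mul
      (isInvariant_scalarMatrix (hx.map S.aug'_equivariant))
  have yretr : (x * exᴴ * w).map S.retr =
      scalarMatrix C (p.proj.map S.aug * x.map S.aug') := by
    have : ex.map S.retr = ex := by ext i j; exact S.retr_retr _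
    rw [Matrix.map_mul, Matrix.map_mul, map_conjTranspose', this, hw, map_scalarMatrix, ← hex, e1,
      scalarMatrix_mul]
  obtain ⟨y, hy, ey⟩ := exists_invariant_preimage S.incl_equivariant S.incl_injective yinv
    (S.mem_range_of_map yretr)
  have f1 : y * yᴴ = p.proj := by
    apply Matrix.map_injective S.incl_injective
    change Matrix.map _ S.incl = Matrix.map _ S.incl
    rw [Matrix.map_mul, map_conjTranspose', ey, y1]
  have f2 : yᴴ * y = 1 := by
    apply Matrix.map_injective S.incl_injective
    change Matrix.map _ S.incl = Matrix.map _ S.incl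
    rw [Matrix.map_mul, map_conjTranspose', ey, y2, map_one_matrix]
  exact ⟨y, hy, f1, f2⟩

/-- The inclusion is injective on `K₀`. -/
theorem map_injective : Function.Injective (K0Unital.map S.incl S.incl_equivariant) := by
  rw [injective_iff_map_eq_zero]
  intro x hx
  obtain ⟨p, q, rfl⟩ := K0Unital.exists_eq_mk_sub_mk_one x
  rw [map_sub, K0Unital.map_mk, K0Unital.map_mk, sub_eq_zero, InvProj.map_one] at hx
  -- Stabilising by an identity matters: the projection r over C need not come from B, but the
  -- identity on its representation space does.
  obtain ⟨r, hr⟩ := K0Unital.exists_sum_one_equiv_of_mk_eq hx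
  have h1 : ((p.sum (.one α r.rep)).map S.incl S.incl_equivariant).Equiv
      (.one β (q.rep.sum r.rep)) := by
    rw [InvProj.map_sum, InvProj.map_one]
    refine hr.trans ?_
    rw [InvProj.one_sum_one]
    exact .refl _
  have h2 := K0Unital.mk_eq_of_equiv (S.equiv_one_of_map h1)
  rw [← InvProj.one_sum_one, K0Unital.mk_sum, K0Unital.mk_sum] at h2
  rw [sub_eq_zero]
  exact add_right_cancel h2

/-- A projection over `C` whose retraction is unitarily equivalent, over the range of the
retraction, to a scalar projection comes from `B` up to equivalence. -/
theorem exists_map_equiv (p : InvProj β) {u : Matrix p.ι p.ι C} (M : Matrix p.ι p.ι ℂ)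
    (hu : IsInvariant β p.rep p.rep u) (hu1 : u * uᴴ = 1) (hu2 : uᴴ * u = 1)
    (huM : u.map S.retr = u) (h : p.proj.map S.retr = u * scalarMatrix C M * uᴴ) :
    ∃ q : InvProj α, (q.map S.incl S.incl_equivariant).Equiv p := by
  have hp := p.proj_mul_self
  have hp' := p.proj_conjTranspose
  -- The conjugate u* p u has scalar retraction, so it comes from B; it is equivalent to p through
  -- u* p.
  have hinv : IsInvariant β p.rep p.rep (uᴴ * p.proj * u) := (hu.star.mul p.invariant).mul hu
  have hretr : (uᴴ * p.proj * u).map S.retr = scalarMatrix C M := by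
    rw [Matrix.map_mul, Matrix.map_mul, map_conjTranspose', huM, h]
    calc uᴴ * (u * scalarMatrix C M * uᴴ) * u
        = (uᴴ * u) * scalarMatrix C M * (uᴴ * u) := by simp only [Matrix.mul_assoc]
      _ = _ := by rw [hu2, Matrix.one_mul, Matrix.mul_one]
  obtain ⟨y, hy, ey⟩ := exists_invariant_preimage S.incl_equivariant S.incl_injective hinv
    (S.mem_range_of_map hretr)
  have f1 : y * y = y := by
    apply Matrix.map_injective S.incl_injective
    change Matrix.map _ S.incl = Matrix.map _ S.incl
    rw [Matrix.map_mul, ey]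
    calc uᴴ * p.proj * u * (uᴴ * p.proj * u) = uᴴ * (p.proj * (u * uᴴ) * p.proj) * u := by
          simp only [Matrix.mul_assoc]
      _ = _ := by rw [hu1, Matrix.mul_one, hp]
  have f2 : yᴴ = y := by
    apply Matrix.map_injective S.incl_injective
    change Matrix.map _ S.incl = Matrix.map _ S.incl
    rw [map_conjTranspose', ey]
    simp only [Matrix.conjTranspose_mul, Matrix.conjTranspose_conjTranspose, hp', Matrix.mul_assoc]
  have g1 : (uᴴ * p.proj) * (uᴴ * p.proj)ᴴ = y.map S.incl := by
    rw [ey, Matrix.conjTranspose_mul, Matrix.conjTranspose_conjTranspose, hp']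
    calc uᴴ * p.proj * (p.proj * u) = uᴴ * (p.proj * p.proj) * u := by
          simp only [Matrix.mul_assoc]
      _ = _ := by rw [hp]
  have g2 : (uᴴ * p.proj)ᴴ * (uᴴ * p.proj) = p.proj := by
    rw [Matrix.conjTranspose_mul, Matrix.conjTranspose_conjTranspose, hp']
    calc p.proj * u * (uᴴ * p.proj) = p.proj * (u * uᴴ) * p.proj := by
          simp only [Matrix.mul_assoc]
      _ = _ := by rw [hu1, Matrix.mul_one, hp]
  exact ⟨⟨p.ι, p.rep, y, ⟨f1, f2⟩, hy⟩, uᴴ * p.proj, hu.star.mul p.invariant, g1, g2⟩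

end ScalarPullback

end SplitInjective

/-! ### The mapping cone M(F, A) as such an inverse image inside M(F~, A~). -/

section ConePullback

variable {A : Type*} [NonUnitalCStarAlgebra A] (σ : CircleAction A)

variable (A) in
/-- The projection of `A~` onto the scalars. -/
def scalarRetraction : Unitization ℂ A →⋆ₐ[ℂ] Unitization ℂ A where
  toFun x := algebraMap ℂ _ x.fst
  map_one' := by simp
  map_mul' x y := by simp
  map_zero' := by simp
  map_add' x y := by simp
  commutes' c := by rw [Unitization.algebraMap_eq_inl]; rfl
  map_star' x := by rw [Unitization.fst_star, algebraMap_star_comm]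

theorem scalarRetraction_apply (x : Unitization ℂ A) :
    scalarRetraction A x = algebraMap ℂ _ x.fst := rfl

theorem fst_algebraMap (c : ℂ) : (algebraMap ℂ (Unitization ℂ A) c).fst = c := rfl

theorem fst_unitizeHom (z : Circle) (x : Unitization ℂ A) :
    (unitizeHom σ.hom z x).fst = x.fst := by
  rw [unitizeHom_apply]; simp

theorem scalarRetraction_equivariant (z : Circle) (x : Unitization ℂ A) :
    scalarRetraction A (unitizeHom σ.hom z x) = unitizeHom σ.hom z (scalarRetraction A x) := by
  rw [scalarRetraction_apply, scalarRetraction_apply, AlgHomClass.commutes, fst_unitizeHom]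

/-- The retraction of `M(F~, A~)` onto `M(ℂ, ℂ)`. -/
def coneRetraction : Cone σ.unitize →⋆ₙₐ[ℂ] Cone σ.unitize :=
  coneMap (scalarRetraction A : Unitization ℂ A →⋆ₙₐ[ℂ] Unitization ℂ A)
    (scalarRetraction_equivariant σ)

theorem coneRetraction_equivariant (z : Circle) (f : Cone σ.unitize) :
    coneRetraction σ (coneAction σ.unitize z f) = coneAction σ.unitize z (coneRetraction σ f) :=
  Cone.ext fun t => scalarRetraction_equivariant σ z (Cone.incl σ.unitize f t)

theorem coneEval_starMap_coneRetraction (t : ℝ≥0) (x : ConeUnit σ) :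
    coneEval σ t (Unitization.starMap (coneRetraction σ) x) =
      scalarRetraction A (coneEval σ t x) := by
  conv_lhs => rw [← Unitization.inl_fst_add_inr_snd_eq x]
  rw [map_add, Unitization.starMap_inl, Unitization.starMap_inr, map_add, AlgHomClass.commutes,
    coneEval_inr, coneEval_apply, map_add, AlgHomClass.commutes]
  rfl

theorem fst_starMap {M N : Type*} [NonUnitalRing M] [StarRing M] [Module ℂ M]
    [IsScalarTower ℂ M M] [SMulCommClass ℂ M M] [StarModule ℂ M] [NonUnitalRing N] [StarRing N]
    [Module ℂ N] [IsScalarTower ℂ N N] [SMulCommClass ℂ N N] [StarModule ℂ N]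
    (φ : M →⋆ₙₐ[ℂ] N) (x : Unitization ℂ M) : (Unitization.starMap φ x).fst = x.fst := by
  conv_lhs => rw [← Unitization.inl_fst_add_inr_snd_eq x]
  rw [map_add, Unitization.starMap_inl, Unitization.starMap_inr]
  simp [Unitization.algebraMap_eq_inl]

/-- The homomorphism `M(F, A) → M(F~, A~)`. -/
def coneInr : Cone σ →⋆ₙₐ[ℂ] Cone σ.unitize :=
  coneMap (Unitization.inrNonUnitalStarAlgHom ℂ A) (inr_equivariant σ)

theorem coneEval_starMap_coneInr (t : ℝ≥0) (x : Unitization ℂ (Cone σ)) :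
    coneEval σ t (Unitization.starMap (coneInr σ) x) =
      algebraMap ℂ _ x.fst + Unitization.inr (Cone.incl σ x.snd t) := by
  conv_lhs => rw [← Unitization.inl_fst_add_inr_snd_eq x]
  rw [map_add, Unitization.starMap_inl, Unitization.starMap_inr, map_add, AlgHomClass.commutes,
    coneEval_inr]
  rfl

/-- A function of the mapping cone `M(F~, A~)` with values in `A` is in `M(F, A)`. -/
theorem exists_coneInr_eq (f : Cone σ.unitize)
    (hf : ∀ t, (Cone.incl σ.unitize f t).fst = 0) : ∃ g : Cone σ, coneInr σ g = f := by
  have h : ∀ t, ((Cone.incl σ.unitize f t).snd : Unitization ℂ A) = Cone.incl σ.unitize f t :=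
    fun t => by
      conv_rhs => rw [← Unitization.inl_fst_add_inr_snd_eq (Cone.incl σ.unitize f t), hf t]
      simp
  have iso := Unitization.isometry_inr (𝕜 := ℂ) (A := A)
  let g : C₀(ℝ≥0, A) :=
    { toFun := fun t => (Cone.incl σ.unitize f t).snd
      continuous_toFun := by
        rw [iso.isEmbedding.continuous_iff]
        exact (map_continuous (Cone.incl σ.unitize f)).congr fun t => (h t).symm
      zero_at_infty' := by
        rw [iso.isEmbedding.tendsto_nhds_iff]
        exact (zero_at_infty (Cone.incl σ.unitize f)).congr fun t => (h t).symm }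
  refine ⟨Cone.mk g fun z => ?_, Cone.ext h⟩
  apply iso.injective
  have h1 := Cone.incl_fixed f z
  change unitizeHom σ.hom z (Cone.incl σ.unitize f 0) = _ at h1
  rw [← h 0] at h1
  exact (inr_equivariant σ z _).trans h1

/-- The unitization of `M(F, A)` inside that of `M(F~, A~)`. -/
def conePullback : ScalarPullback (unitizeHom (coneAction σ))
    (unitizeHom (coneAction σ.unitize)) where
  incl := Unitization.starMap (coneInr σ)
  retr := Unitization.starMap (coneRetraction σ)
  aug := augmentation _
  aug' := augmentation _
  incl_equivariant :=
    starMap_equivariant fun z f => Cone.ext fun t => inr_equivariant σ z (Cone.incl σ f t)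
  retr_equivariant := starMap_equivariant (coneRetraction_equivariant σ)
  aug'_equivariant := augmentation_equivariant _
  incl_injective := by
    intro x y h
    have h1 : x.fst = y.fst := by
      rw [← fst_starMap (coneInr σ) x, ← fst_starMap (coneInr σ) y, h]
    refine Unitization.ext h1 (Cone.ext fun t => ?_)
    have h2 := congrArg (coneEval σ t) h
    rw [coneEval_starMap_coneInr, coneEval_starMap_coneInr, h1] at h2
    exact Unitization.inr_injective (add_left_cancel h2)
  retr_retr c := by
    refine coneUnit_ext σ ?_ fun t => ?_
    · rw [fst_starMap]
    · rw [coneEval_starMap_coneRetraction, coneEval_starMap_coneRetraction]; rfl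
  retr_incl b := by
    refine coneUnit_ext σ ?_ fun t => ?_
    · rw [fst_starMap, fst_starMap]; rfl
    · rw [coneEval_starMap_coneRetraction, coneEval_starMap_coneInr, AlgHomClass.commutes,
        scalarRetraction_apply, Unitization.fst_add, Unitization.fst_inr, add_zero]
      rfl
  aug'_incl b := fst_starMap _ b
  -- The value at infinity identifies l with the adjoined scalar of c. Evaluation at t then leaves
  -- no scalar part in the function component, which is therefore A-valued.
  mem_range c l h := by
    have h1 : c.fst = l := by
      rw [← fst_starMap (coneRetraction σ) c, h]; rfl
    obtain ⟨g, hg⟩ := exists_coneInr_eq σ c.snd fun t => by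
      have h2 := congrArg (coneEval σ t) h
      rw [coneEval_starMap_coneRetraction, AlgHomClass.commutes] at h2
      have h3 := congrArg (fun x : Unitization ℂ A => x.fst) h2
      beta_reduce at h3
      rw [coneEval_apply, scalarRetraction_apply, fst_algebraMap, fst_algebraMap,
        Unitization.fst_add, fst_algebraMap, h1] at h3
      exact add_eq_left.1 h3
    refine ⟨Unitization.inl c.fst + Unitization.inr g, ?_⟩
    rw [map_add, Unitization.starMap_inl, Unitization.starMap_inr, hg,
      Unitization.algebraMap_eq_inl, Unitization.inl_fst_add_inr_snd_eq]

theorem coneInclusion_injective : Function.Injective (coneInclusion σ) := fun _ _ h =>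
  Subtype.ext ((conePullback σ).map_injective (congrArg Subtype.val h))

/-- A class of `K₀^𝕋(M(F~, A~))` is in the image of `K₀^𝕋(M(F, A))` if it is in the image of the
unitizations. -/
theorem exists_coneInclusion_eq {c : K0Cone σ.unitize} {x : K0Unital (unitizeHom (coneAction σ))}
    (h : K0Unital.map (conePullback σ).incl (conePullback σ).incl_equivariant x = c) :
    ∃ b : K0Cone σ, coneInclusion σ b = c := by
  refine ⟨⟨x, ?_⟩, Subtype.ext h⟩
  change K0Unital.map (augmentation _) (augmentation_equivariant (coneAction σ)) x = 0
  refine (K0Unital.map_map (χ := augmentation (Cone σ)) (conePullback σ).incl_equivariant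
    (augmentation_equivariant (coneAction σ.unitize)) _ (conePullback σ).aug'_incl x).symm.trans ?_
  rw [h]
  exact c.2

end ConePullback

/-! ### Rotating the corner projection into p_v, and lifting classes to M(F, A). -/

section FixedPartialIsometries

variable {A : Type*} [NonUnitalCStarAlgebra A] (σ : CircleAction A)

/-- The function `t ↦ (1 + t²)^{-1/2}` in `C₀([0,∞))`. -/
def gSin : C₀(ℝ≥0, ℂ) where
  toFun t := ((1 / √(1 + (t : ℝ) ^ 2) : ℝ) : ℂ)
  continuous_toFun := by
    refine Complex.continuous_ofReal.comp (Continuous.div continuous_const (by fun_prop) ?_)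
    intro t; positivity
  zero_at_infty' := by
    rw [← Complex.ofReal_zero]
    refine (Complex.continuous_ofReal.tendsto 0).comp (squeeze_zero (fun t => by positivity) ?_
      tendsto_two_div)
    intro t
    have ht : (0 : ℝ) ≤ t := t.2
    rw [div_le_div_iff₀ (by positivity) (by positivity)]
    have h1 : (t : ℝ) ≤ √(1 + (t : ℝ) ^ 2) := Real.le_sqrt_of_sq_le (by linarith)
    have h2 : (1 : ℝ) ≤ √(1 + (t : ℝ) ^ 2) := Real.le_sqrt_of_sq_le (by nlinarith)
    linarith

/-- The function `t ↦ t (1 + t²)^{-1/2} - 1` in `C₀([0,∞))`. -/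
def gCos : C₀(ℝ≥0, ℂ) where
  toFun t := (((t : ℝ) / √(1 + (t : ℝ) ^ 2) - 1 : ℝ) : ℂ)
  continuous_toFun := by
    refine Complex.continuous_ofReal.comp
      ((Continuous.div (by fun_prop) (by fun_prop) ?_).sub continuous_const)
    intro t; positivity
  zero_at_infty' := by
    rw [← Complex.ofReal_zero]
    refine (Complex.continuous_ofReal.tendsto 0).comp (squeeze_zero_norm ?_ tendsto_two_div)
    intro t
    have ht : (0 : ℝ) ≤ t := t.2
    have h0 : 0 < √(1 + (t : ℝ) ^ 2) := by positivity
    have h1 : (t : ℝ) ≤ √(1 + (t : ℝ) ^ 2) := Real.le_sqrt_of_sq_le (by linarith)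
    have h2 : (1 : ℝ) ≤ √(1 + (t : ℝ) ^ 2) := Real.le_sqrt_of_sq_le (by nlinarith)
    have h3 : √(1 + (t : ℝ) ^ 2) ≤ 1 + t := Real.sqrt_le_iff.2 ⟨by linarith, by nlinarith⟩
    rw [Real.norm_eq_abs, abs_sub_comm, abs_of_nonneg (by
      rw [sub_nonneg, div_le_one h0]; exact h1), one_sub_div h0.ne',
      div_le_div_iff₀ h0 (by positivity)]
    nlinarith

theorem star_gSin (t : ℝ≥0) : star (gSin t) = gSin t := Complex.conj_ofReal _

theorem star_gCos (t : ℝ≥0) : star (gCos t) = gCos t := Complex.conj_ofReal _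

theorem gSin_mul_gSin (t : ℝ≥0) : gSin t * gSin t = g₀ t := by
  change ((1 / √(1 + (t : ℝ) ^ 2) : ℝ) : ℂ) * ((1 / √(1 + (t : ℝ) ^ 2) : ℝ) : ℂ) =
    ((1 / (1 + (t : ℝ) ^ 2) : ℝ) : ℂ)
  rw [← Complex.ofReal_mul, div_mul_div_comm, one_mul, Real.mul_self_sqrt (by positivity)]

theorem gSin_mul_gCos (t : ℝ≥0) : gSin t * (1 + gCos t) = g₁ t := by
  change ((1 / √(1 + (t : ℝ) ^ 2) : ℝ) : ℂ) * (1 + (((t : ℝ) / √(1 + (t : ℝ) ^ 2) - 1 : ℝ) : ℂ)) =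
    (((t : ℝ) / (1 + (t : ℝ) ^ 2) : ℝ) : ℂ)
  rw [← Complex.ofReal_one, ← Complex.ofReal_add, ← Complex.ofReal_mul, add_sub_cancel,
    div_mul_div_comm, one_mul, Real.mul_self_sqrt (by positivity)]

/-- The cosine is `1 + gCos`: subtracting 1 gives a function vanishing at infinity, and the
rotations built from it tend to the identity there. -/
theorem gCos_rel (t : ℝ≥0) : (1 + gCos t) * (1 + gCos t) = 1 - gSin t * gSin t := by
  rw [gSin_mul_gSin]
  change (1 + (((t : ℝ) / √(1 + (t : ℝ) ^ 2) - 1 : ℝ) : ℂ)) *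
    (1 + (((t : ℝ) / √(1 + (t : ℝ) ^ 2) - 1 : ℝ) : ℂ)) = 1 - ((1 / (1 + (t : ℝ) ^ 2) : ℝ) : ℂ)
  have h : (1 + (t : ℝ) ^ 2) ≠ 0 := by positivity
  rw [← Complex.ofReal_one, ← Complex.ofReal_add, ← Complex.ofReal_mul, add_sub_cancel,
    div_mul_div_comm, Real.mul_self_sqrt (by positivity), ← Complex.ofReal_sub]
  congr 1
  field_simp
  ring

/-- The matrix of functions `t ↦ g(t) x` over `M(F~, A~)`, where `x` is over `F~`. -/
def fixedPart {ι κ : Type} (g : C₀(ℝ≥0, ℂ)) (x : Matrix ι κ (Unitization ℂ A))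
    (hx : OverFixed σ x) : Matrix ι κ (ConeUnit σ) :=
  Matrix.of fun i j => Unitization.inr (Cone.mk (tensorC0 g (x i j)) fun z => by
    change σ.unitize.hom z (g 0 • x i j) = g 0 • x i j
    rw [map_smul]
    exact congrArg (g 0 • ·) (congrFun (congrFun (hx z) i) j))

theorem fixedPart_eval {ι κ : Type} (g : C₀(ℝ≥0, ℂ)) (x : Matrix ι κ (Unitization ℂ A)) (hx)
    (t : ℝ≥0) : (fixedPart σ g x hx).map (coneEval σ t) = g t • x :=
  Matrix.ext fun _ _ => coneEval_inr σ t _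

theorem fixedPart_aug {ι κ : Type} (g : C₀(ℝ≥0, ℂ)) (x : Matrix ι κ (Unitization ℂ A)) (hx) :
    (fixedPart σ g x hx).map (augmentation _) = 0 := rfl

variable {σ} in
theorem OverFixed.conjTranspose {ι κ : Type} {x : Matrix ι κ (Unitization ℂ A)}
    (hx : OverFixed σ x) : OverFixed σ xᴴ := fun z => by
  ext i j : 1
  exact (map_star (unitizeHom σ.hom z) _).trans
    (congrArg Star.star (congrFun (congrFun (hx z) j) i))

theorem map_one_add {B C : Type*} [Ring B] [StarRing B] [Algebra ℂ B] [Ring C] [StarRing C]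
    [Algebra ℂ C] {ι : Type} [DecidableEq ι] (φ : B →⋆ₐ[ℂ] C) (x : Matrix ι ι B) :
    (1 + x).map φ = 1 + x.map φ := by
  ext i j; simp [Matrix.one_apply, apply_ite φ]

/-- The unitary rotating the constant projection `[[1, 0], [0, 0]]` into `p_v`, for `v` over
`F~`. -/
def rotationMatrix (v : InvPartialIsometry σ) (hv : OverFixed σ v.elt) :
    Matrix (v.ι ⊕ v.ι) (v.ι ⊕ v.ι) (ConeUnit σ) :=
  Matrix.fromBlocks (1 + fixedPart σ gCos (v.elt * v.eltᴴ) v.range_fixed)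
    -- Since `gSin 0 = 1`, this entry lies in the cone only because v is over F~. The off-diagonal
    -- entries of p_v need no such condition, as `g₁ 0 = 0`.
    (Complex.I • fixedPart σ gSin v.elt hv)
    (Complex.I • fixedPart σ gSin v.eltᴴ hv.conjTranspose)
    (1 + fixedPart σ gCos (v.eltᴴ * v.elt) v.source_fixed)

variable (v : InvPartialIsometry σ) (hv : OverFixed σ v.elt)

theorem rotationMatrix_eval (t : ℝ≥0) :
    (rotationMatrix σ v hv).map (coneEval σ t) = Matrix.fromBlocks
      (1 + gCos t • (v.elt * v.eltᴴ)) ((Complex.I * gSin t) • v.elt)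
      ((Complex.I * gSin t) • v.eltᴴ) (1 + gCos t • (v.eltᴴ * v.elt)) := by
  rw [rotationMatrix, Matrix.fromBlocks_map, map_one_add, map_one_add, map_smul_matrix,
    map_smul_matrix]
  simp only [fixedPart_eval, smul_smul]

theorem rotationMatrix_aug : (rotationMatrix σ v hv).map (augmentation _) = 1 := by
  rw [rotationMatrix, Matrix.fromBlocks_map, map_one_add, map_one_add, map_smul_matrix,
    map_smul_matrix]
  simp only [fixedPart_aug, smul_zero, add_zero, Matrix.fromBlocks_one]

/-- On the range of v plus its source the first factor is a rotation with cosine 1 + a and sine b,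
and it is 1 on the complement. The second factor replaces b by -b, which for real a, b is the
adjoint; exchanging b and -b then gives the product in the other order. -/
theorem block_rotation {B : Type*} [Ring B] [StarRing B] [Algebra ℂ B] {ι : Type} [Fintype ι]
    [DecidableEq ι] {v : Matrix ι ι B} (hv : v * vᴴ * v = v) (hv' : vᴴ * v * vᴴ = vᴴ) {a b : ℂ}
    (h : (1 + a) * (1 + a) = 1 - b * b) :
    Matrix.fromBlocks (1 + a • (v * vᴴ)) ((Complex.I * b) • v)
      ((Complex.I * b) • vᴴ) (1 + a • (vᴴ * v)) *
    Matrix.fromBlocks (1 + a • (v * vᴴ)) (-(Complex.I * b) • v)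
      (-(Complex.I * b) • vᴴ) (1 + a • (vᴴ * v)) = 1 := by
  have e1 : v * vᴴ * (v * vᴴ) = v * vᴴ := by rw [← mul_assoc, hv]
  have e2 : vᴴ * v * (vᴴ * v) = vᴴ * v := by rw [← mul_assoc, hv']
  have e3 : v * (vᴴ * v) = v := by rw [← mul_assoc, hv]
  have e4 : vᴴ * (v * vᴴ) = vᴴ := by rw [← mul_assoc, hv']
  have hI : (Complex.I * b) * (Complex.I * b) = (1 + a) * (1 + a) - 1 := by
    rw [h]; linear_combination (b * b) * Complex.I_mul_I
  generalize Complex.I * b = d at hI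
  rw [Matrix.fromBlocks_multiply, ← Matrix.fromBlocks_one]
  congr 1
  · simp only [add_mul, mul_add, Matrix.smul_mul, Matrix.mul_smul, one_mul, mul_one, smul_smul,
      e1, neg_mul, hI]
    module
  · simp only [add_mul, mul_add, Matrix.smul_mul, Matrix.mul_smul, one_mul, mul_one, smul_smul,
      hv, e3]
    module
  · simp only [add_mul, mul_add, Matrix.smul_mul, Matrix.mul_smul, one_mul, mul_one, smul_smul,
      hv', e4]
    module
  · simp only [add_mul, mul_add, Matrix.smul_mul, Matrix.mul_smul, one_mul, mul_one, smul_smul,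
      e2, neg_mul, hI]
    module

theorem rotationMatrix_star_eval (t : ℝ≥0) :
    (rotationMatrix σ v hv)ᴴ.map (coneEval σ t) = Matrix.fromBlocks
      (1 + gCos t • (v.elt * v.eltᴴ)) (-(Complex.I * gSin t) • v.elt)
      (-(Complex.I * gSin t) • v.eltᴴ) (1 + gCos t • (v.eltᴴ * v.elt)) := by
  rw [map_conjTranspose', rotationMatrix_eval, Matrix.fromBlocks_conjTranspose]
  simp only [Matrix.conjTranspose_add, Matrix.conjTranspose_one, Matrix.conjTranspose_smul,
    Matrix.conjTranspose_mul, Matrix.conjTranspose_conjTranspose, star_mul', star_gSin,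
    star_gCos, Complex.star_def, Complex.conj_I, neg_mul]

theorem rotationMatrix_star_aug : (rotationMatrix σ v hv)ᴴ.map (augmentation _) = 1 := by
  rw [map_conjTranspose', rotationMatrix_aug, Matrix.conjTranspose_one]

theorem rotationMatrix_mul_star : rotationMatrix σ v hv * (rotationMatrix σ v hv)ᴴ = 1 := by
  refine coneMatrix_ext σ ?_ fun t => ?_
  · rw [Matrix.map_mul, rotationMatrix_aug, rotationMatrix_star_aug, map_one_matrix, one_mul]
  · rw [Matrix.map_mul, rotationMatrix_eval, rotationMatrix_star_eval, map_one_matrix]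
    exact block_rotation v.isPartialIsometry v.star_mul_mul (gCos_rel t)

theorem rotationMatrix_star_mul : (rotationMatrix σ v hv)ᴴ * rotationMatrix σ v hv = 1 := by
  refine coneMatrix_ext σ ?_ fun t => ?_
  · rw [Matrix.map_mul, rotationMatrix_aug, rotationMatrix_star_aug, map_one_matrix, one_mul]
  · rw [Matrix.map_mul, rotationMatrix_eval, rotationMatrix_star_eval, map_one_matrix]
    have := block_rotation v.isPartialIsometry v.star_mul_mul (a := gCos t) (b := -gSin t)
      (by rw [gCos_rel]; ring)
    rwa [mul_neg, neg_neg] at this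

theorem map_corner {B C : Type*} [Ring B] [StarRing B] [Algebra ℂ B] [Ring C] [StarRing C]
    [Algebra ℂ C] {ι : Type} [DecidableEq ι] (φ : B →⋆ₐ[ℂ] C) :
    (Matrix.fromBlocks (1 : Matrix ι ι B) 0 0 (0 : Matrix ι ι B)).map φ =
      Matrix.fromBlocks 1 0 0 0 := by
  rw [Matrix.fromBlocks_map, Matrix.map_one _ (map_zero φ) (map_one φ),
    Matrix.map_zero _ (map_zero φ)]

/-- At each t this comes down to sin² = g₀, sin · cos = g₁ and cos² = 1 - sin², together with the
partial isometry relations. -/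
theorem rotationMatrix_corner : rotationMatrix σ v hv * Matrix.fromBlocks 1 0 0 0 *
    (rotationMatrix σ v hv)ᴴ = putnamMatrix σ v := by
  refine coneMatrix_ext σ ?_ fun t => ?_
  · rw [Matrix.map_mul, Matrix.map_mul, rotationMatrix_aug, rotationMatrix_star_aug, map_corner,
      putnamMatrix_aug, one_mul, mul_one]
  · rw [Matrix.map_mul, Matrix.map_mul, rotationMatrix_eval, rotationMatrix_star_eval, map_corner,
      putnamMatrix_eval, Matrix.fromBlocks_multiply, Matrix.fromBlocks_multiply]
    have e1 : v.elt * v.eltᴴ * (v.elt * v.eltᴴ) = v.elt * v.eltᴴ := by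
      rw [← mul_assoc, v.isPartialIsometry]
    have e3 : v.elt * v.eltᴴ * v.elt = v.elt := v.isPartialIsometry
    have e4 : v.eltᴴ * (v.elt * v.eltᴴ) = v.eltᴴ := by rw [← mul_assoc, v.star_mul_mul]
    have r1 := gSin_mul_gSin t
    have r2 := gSin_mul_gCos t
    have r3 := gCos_rel t
    have hI := Complex.I_mul_I
    congr 1
    · simp only [add_mul, mul_add, Matrix.smul_mul, Matrix.mul_smul, one_mul, mul_one, smul_smul,
        e1, mul_zero, zero_mul, add_zero, ← r1]
      have : 1 + gCos t • (v.elt * v.eltᴴ) + (gCos t • (v.elt * v.eltᴴ) +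
          (gCos t * gCos t) • (v.elt * v.eltᴴ)) =
          1 + ((1 + gCos t) * (1 + gCos t) - 1) • (v.elt * v.eltᴴ) := by module
      rw [this, r3]
      module
    · simp only [add_mul, mul_add, Matrix.smul_mul, Matrix.mul_smul, one_mul, mul_one, smul_smul,
        e3, mul_zero, zero_mul, add_zero, ← r2]
      module
    · simp only [mul_add, Matrix.smul_mul, Matrix.mul_smul, mul_one, smul_smul,
        e4, mul_zero, zero_mul, add_zero, ← r2]
      module
    · simp only [mul_add, Matrix.smul_mul, Matrix.mul_smul, mul_one, smul_smul,
        mul_zero, zero_mul, add_zero, ← r1]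
      have : (-(Complex.I * gSin t) * (Complex.I * gSin t)) = gSin t * gSin t := by
        linear_combination -(gSin t * gSin t) * hI
      rw [this]

theorem IsInvariant.one_add {B : Type*} [Ring B] [StarRing B] [Algebra ℂ B] [StarModule ℂ B]
    {α : Circle →* (B →⋆ₐ[ℂ] B)} {ι : Type} [Fintype ι] [DecidableEq ι] {U : CircleRep ι}
    {x : Matrix ι ι B} (hx : IsInvariant α U U x) : IsInvariant α U U (1 + x) := by
  have := (hx.smul (-1)).one_sub
  rwa [neg_smul, one_smul, sub_neg_eq_add] at this

theorem isInvariant_rotationMatrix : IsInvariant (unitizeHom (coneAction σ.unitize))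
    (v.rep.sum v.rep) (v.rep.sum v.rep) (rotationMatrix σ v hv) := by
  have h := v.invariant
  refine invariant_of_eval σ ?_ fun t => ?_
  · rw [rotationMatrix_aug]
    exact isInvariant_one _ _
  · rw [rotationMatrix_eval]
    exact IsInvariant.fromBlocks ((h.mul h.star).smul _).one_add (h.smul _) (h.star.smul _)
      ((h.star.mul h).smul _).one_add

/-- The class of an invariant partial isometry over `F~` vanishes. -/
theorem putnamClass_eq_zero (hv : OverFixed σ v.elt) : putnamClass σ v = 0 := by
  refine Subtype.ext (sub_eq_zero.2 (K0Unital.mk_eq_of_equiv ?_))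
  have hc := (cornerProj σ v).proj_mul_self
  have hc' := (cornerProj σ v).proj_conjTranspose
  set u := rotationMatrix σ v hv
  set c : Matrix (v.ι ⊕ v.ι) (v.ι ⊕ v.ι) (ConeUnit σ) := Matrix.fromBlocks 1 0 0 0
  change c * c = c at hc
  change cᴴ = c at hc'
  have h1 : u * c * (u * c)ᴴ = putnamMatrix σ v := by
    rw [Matrix.conjTranspose_mul, hc', ← rotationMatrix_corner σ v hv]
    calc u * c * (c * uᴴ) = u * (c * c) * uᴴ := by simp only [Matrix.mul_assoc]
      _ = _ := by rw [hc]
  have h2 : (u * c)ᴴ * (u * c) = c := by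
    rw [Matrix.conjTranspose_mul, hc']
    calc c * uᴴ * (u * c) = c * (uᴴ * u) * c := by simp only [Matrix.mul_assoc]
      _ = _ := by rw [rotationMatrix_star_mul, mul_one, hc]
  exact ⟨u * c, (isInvariant_rotationMatrix σ v hv).mul (cornerProj σ v).invariant, h1, h2⟩

/-- The scalar part of an invariant partial isometry. -/
@[reducible]
def InvPartialIsometry.scalarPart (v : InvPartialIsometry σ) : InvPartialIsometry σ where
  ι := v.ι
  rep := v.rep
  elt := v.elt.map (scalarRetraction A)
  isPartialIsometry := by
    rw [IsPartialIsometry, ← map_conjTranspose', ← Matrix.map_mul, ← Matrix.map_mul,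
      v.isPartialIsometry]
  invariant := v.invariant.map (scalarRetraction_equivariant σ)
  range_fixed z := by
    rw [← map_conjTranspose', ← Matrix.map_mul]
    ext i j : 1
    exact AlgHomClass.commutes (unitizeHom σ.hom z) _
  source_fixed z := by
    rw [← map_conjTranspose', ← Matrix.map_mul]
    ext i j : 1
    exact AlgHomClass.commutes (unitizeHom σ.hom z) _

theorem overFixed_scalarPart : OverFixed σ v.scalarPart.elt := fun z => by
  ext i j : 1
  exact AlgHomClass.commutes (unitizeHom σ.hom z) _

theorem map_eval_retraction {ι κ : Type} (x : Matrix ι κ (ConeUnit σ)) (t : ℝ≥0) :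
    (x.map (conePullback σ).retr).map (coneEval σ t) =
      (x.map (coneEval σ t)).map (scalarRetraction A) :=
  Matrix.ext fun i j => coneEval_starMap_coneRetraction σ t (x i j)

theorem map_aug_retraction {ι κ : Type} (x : Matrix ι κ (ConeUnit σ)) :
    (x.map (conePullback σ).retr).map (augmentation _) = x.map (augmentation _) :=
  Matrix.ext fun i j => fst_starMap (coneRetraction σ) (x i j)

/-- The entries of p_v are polynomials in v and v* with scalar functions as coefficients, so a
unital star-homomorphism applied pointwise to them only changes v. -/
theorem putnamMatrix_retraction :
    (putnamMatrix σ v).map (conePullback σ).retr = putnamMatrix σ v.scalarPart := by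
  refine coneMatrix_ext σ ?_ fun t => ?_
  · rw [map_aug_retraction, putnamMatrix_aug]
    exact (putnamMatrix_aug σ v.scalarPart).symm
  · rw [map_eval_retraction, putnamMatrix_eval, Matrix.fromBlocks_map, map_one_sub]
    refine Eq.trans ?_ (putnamMatrix_eval σ v.scalarPart t).symm
    simp only [map_smul_matrix, Matrix.map_mul, map_conjTranspose']

theorem rotationMatrix_retraction (h : OverFixed σ v.scalarPart.elt) :
    (rotationMatrix σ v.scalarPart h).map (conePullback σ).retr =
      rotationMatrix σ v.scalarPart h := by
  have e : v.scalarPart.elt.map (scalarRetraction A) = v.scalarPart.elt := rfl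
  refine coneMatrix_ext σ ?_ fun t => ?_
  · rw [map_aug_retraction]
  · rw [map_eval_retraction, rotationMatrix_eval, Matrix.fromBlocks_map,
      map_one_add, map_one_add]
    simp only [map_smul_matrix, Matrix.map_mul, map_conjTranspose', e]

/-- The class of an invariant partial isometry comes from `M(F, A)`. -/
theorem exists_coneInclusion_eq_putnamClass :
    ∃ c : K0Cone σ, coneInclusion σ c = putnamClass σ v := by
  have hs : scalarMatrix (ConeUnit σ) (Matrix.fromBlocks (1 : Matrix v.ι v.ι ℂ) 0 0 0 :
      Matrix (v.ι ⊕ v.ι) (v.ι ⊕ v.ι) ℂ) = Matrix.fromBlocks 1 0 0 0 := by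
    rw [scalarMatrix_fromBlocks]
    simp only [scalarMatrix_zero, scalarMatrix_one]
  -- The scalar part of v is over F~, so its rotation is available, and it is fixed by the
  -- retraction. This is the hypothesis of `ScalarPullback.exists_map_equiv`.
  have key : (putnamMatrix σ v).map (conePullback σ).retr =
      rotationMatrix σ v.scalarPart (overFixed_scalarPart σ v) *
        scalarMatrix (ConeUnit σ) (Matrix.fromBlocks (1 : Matrix v.ι v.ι ℂ) 0 0 0 :
          Matrix (v.ι ⊕ v.ι) (v.ι ⊕ v.ι) ℂ) *
        (rotationMatrix σ v.scalarPart (overFixed_scalarPart σ v))ᴴ := by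
    rw [hs, putnamMatrix_retraction]
    exact (rotationMatrix_corner σ v.scalarPart _).symm
  obtain ⟨q, hq⟩ := (conePullback σ).exists_map_equiv (putnamProj σ v)
    (Matrix.fromBlocks 1 0 0 0)
    (isInvariant_rotationMatrix σ v.scalarPart (overFixed_scalarPart σ v))
    (rotationMatrix_mul_star σ v.scalarPart (overFixed_scalarPart σ v))
    (rotationMatrix_star_mul σ v.scalarPart (overFixed_scalarPart σ v))
    (rotationMatrix_retraction σ v (overFixed_scalarPart σ v)) key
  let c : InvProj (unitizeHom (coneAction σ)) :=
    { ι := v.ι ⊕ v.ι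
      rep := v.rep.sum v.rep
      proj := Matrix.fromBlocks 1 0 0 0
      isStarProjection := by
        refine ⟨?_, ?_⟩
        · rw [IsIdempotentElem, Matrix.fromBlocks_multiply]; simp
        · rw [IsSelfAdjoint, Matrix.star_eq_conjTranspose, Matrix.fromBlocks_conjTranspose]; simp
      invariant := IsInvariant.fromBlocks (isInvariant_one _ _) (isInvariant_zero _ _ _)
        (isInvariant_zero _ _ _) (isInvariant_zero _ _ _) }
  have hc : c.map (conePullback σ).incl (conePullback σ).incl_equivariant = cornerProj σ v := by
    simp only [c, InvProj.map, cornerProj, InvProj.mk.injEq, heq_eq_eq, true_and]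
    exact map_corner _
  refine exists_coneInclusion_eq σ (x := K0Unital.mk q - K0Unital.mk c) ?_
  rw [map_sub, K0Unital.map_mk, K0Unital.map_mk, hc, K0Unital.mk_eq_of_equiv hq]
  rfl

end FixedPartialIsometries

/-! ### Close invariant projections over a C*-algebra are equivariantly equivalent. -/

section CloseProjections

/-- Close projections in a C*-algebra are equivalent, by a partial isometry that is fixed by every
endomorphism fixing the two projections. -/
theorem exists_partialIsometry_of_norm_sub_lt {D : Type*} [CStarAlgebra D] {p q : D}
    (hp : IsStarProjection p) (hq : IsStarProjection q) (h : ‖p - q‖ < 1 / 2) :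
    ∃ x : D, x * star x = p ∧ star x * x = q ∧
      ∀ β : D →⋆ₐ[ℂ] D, β p = p → β q = q → β x = x := by
  rcases subsingleton_or_nontrivial D with hD | hD
  · exact ⟨p, Subsingleton.elim _ _, Subsingleton.elim _ _, fun β _ _ => Subsingleton.elim _ _⟩
  let _ := CStarAlgebra.spectralOrder D
  have _ := CStarAlgebra.spectralOrderedRing D
  have hp1 := hp.isIdempotentElem.eq
  have hq1 := hq.isIdempotentElem.eq
  have hp2 : star p = p := hp.isSelfAdjoint
  have hq2 : star q = q := hq.isSelfAdjoint
  have hpn : ‖p‖ ≤ 1 := hp.norm_le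
  have hqn : ‖q‖ ≤ 1 := hq.norm_le
  -- z intertwines the projections, p z = p q = z q, and is close to 1. The partial isometry sought
  -- is the unitary z |z|⁻¹ cut down by q.
  set z : D := p * q + (1 - p) * (1 - q) with hz
  have hpz : p * z = p * q := by
    rw [hz, mul_add, ← mul_assoc, ← mul_assoc, hp1, mul_sub p 1 p, mul_one, hp1, sub_self,
      zero_mul, add_zero]
  have hzq : z * q = p * q := by
    rw [hz, add_mul, mul_assoc, mul_assoc, hq1, sub_mul 1 q, one_mul, hq1, sub_self, mul_zero,
      add_zero]
  -- The identity 1 - z = p (p - q) - (p - q) q bounds the norm by 2 ‖p - q‖, which is where the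
  -- constant 1/2 comes from.
  have hnorm : ‖1 - z‖ < 1 := by
    have e : 1 - z = p * (p - q) - (p - q) * q := by
      rw [hz]
      simp only [mul_sub, sub_mul, mul_one, one_mul, hp1, hq1]
      abel
    rw [e]
    calc ‖p * (p - q) - (p - q) * q‖ ≤ ‖p‖ * ‖p - q‖ + ‖p - q‖ * ‖q‖ :=
          (norm_sub_le _ _).trans (add_le_add (norm_mul_le _ _) (norm_mul_le _ _))
      _ ≤ 1 * ‖p - q‖ + ‖p - q‖ * 1 := by gcongr
      _ < 1 := by linarith
  have hzu : IsUnit z := by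
    have := (Units.oneSub (1 - z) hnorm).isUnit
    simpa using this
  set c : D := star z * z with hc
  have hcu : IsUnit c := hzu.star.mul hzu
  have hc0 : 0 ≤ c := star_mul_self_nonneg z
  have hss : CFC.sqrt c * CFC.sqrt c = c := CFC.sqrt_mul_sqrt_self c hc0
  have hs0 : 0 ≤ CFC.sqrt c := CFC.sqrt_nonneg c
  have hs : star (CFC.sqrt c) = CFC.sqrt c := hs0.isSelfAdjoint
  have hsu : IsUnit (CFC.sqrt c) := (CFC.isUnit_sqrt_iff c hc0).2 hcu
  -- z* z commutes with q, hence so do its square root and the inverse s⁻¹ = |z|⁻¹; so z s⁻¹ still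
  -- intertwines p and q.
  have hqc : Commute c q := by
    have h1 : star z * p = q * p := by
      have := congrArg star hpz
      rwa [star_mul, star_mul, hp2, hq2] at this
    have h2 : q * star z = q * p := by
      have := congrArg star hzq
      rwa [star_mul, star_mul, hp2, hq2] at this
    change c * q = q * c
    rw [hc, mul_assoc, hzq, ← mul_assoc, ← mul_assoc, h2, h1, mul_assoc, mul_assoc, hpz]
  have hqs : Commute (CFC.sqrt c) q := by
    rw [CFC.sqrt_eq_cfc]
    exact hqc.cfc_nnreal _
  obtain ⟨s, hs'⟩ := hsu
  rw [← hs'] at hss hs hqs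
  have hr : star (↑s⁻¹ : D) = ↑s⁻¹ := by
    have : star s = s := Units.ext hs
    rw [← Units.coe_star_inv, this]
  have hqr : Commute (↑s⁻¹ : D) q := hqs.units_inv_left
  have hw1 : (↑s⁻¹ : D) * c * ↑s⁻¹ = 1 := by
    rw [← hss, ← mul_assoc, Units.inv_mul, one_mul, Units.mul_inv]
  have hw2 : z * ↑s⁻¹ * ↑s⁻¹ * star z = 1 := by
    obtain ⟨y, hy⟩ := hzu
    have h1 : (↑s⁻¹ : D) * ↑s⁻¹ * (star z * z) = 1 := by
      rw [← hc, ← hss, mul_assoc, ← mul_assoc (↑s⁻¹ : D) (↑s : D), Units.inv_mul, one_mul,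
        Units.inv_mul]
    have h2 : z * ((↑s⁻¹ : D) * ↑s⁻¹ * star z) * z = z := by
      rw [mul_assoc, mul_assoc, mul_assoc] at *
      rw [h1, mul_one]
    have h3 : z * ((↑s⁻¹ : D) * ↑s⁻¹ * star z) = 1 := by
      rw [← hy] at h2 ⊢
      exact y.isUnit.mul_right_cancel (h2.trans (one_mul _).symm)
    rw [← h3]
    simp only [mul_assoc]
  refine ⟨z * ↑s⁻¹ * q, ?_, ?_, fun β hβp hβq => ?_⟩
  · have h4 : z * ↑s⁻¹ * q = p * (z * ↑s⁻¹) := by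
      rw [mul_assoc, hqr.eq, ← mul_assoc, ← mul_assoc, hzq, hpz]
    have h5 : star (z * ↑s⁻¹ * q) = ↑s⁻¹ * star z * p := by
      rw [h4]
      simp only [star_mul, hr, hp2]
    rw [h5, h4]
    calc p * (z * ↑s⁻¹) * (↑s⁻¹ * star z * p) = p * (z * ↑s⁻¹ * ↑s⁻¹ * star z) * p := by
          simp only [mul_assoc]
      _ = p := by rw [hw2, mul_one, hp1]
  · rw [star_mul, star_mul, hr, hq2]
    calc q * (↑s⁻¹ * star z) * (z * ↑s⁻¹ * q) = q * (↑s⁻¹ * (star z * z) * ↑s⁻¹) * q := by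
          simp only [mul_assoc]
      _ = q := by rw [← hc, hw1, mul_one, hq1]
  · have hβz : β z = z := by
      rw [hz, map_add, map_mul, map_mul, map_sub, map_sub, map_one, hβp, hβq]
    -- β(s) is positive with square β(c) = c, so it is s by uniqueness of positive square roots.
    have hβs : β ↑s = ↑s := by
      have h6 : β ↑s * β ↑s = c := by
        rw [← map_mul, hss, hc, map_mul, map_star, hβz]
      have h7 : 0 ≤ β ↑s := by rw [hs']; exact map_nonneg β hs0
      exact (CFC.sqrt_unique h6 h7).symm.trans hs'.symm
    have hβr : β ↑s⁻¹ = ↑s⁻¹ := by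
      have h8 : (↑s : D) * β ↑s⁻¹ = 1 := by
        conv_lhs => rw [← hβs]
        rw [← map_mul, Units.mul_inv, map_one]
      exact (Units.inv_eq_of_mul_eq_one_right h8).symm
    rw [map_mul, map_mul, hβz, hβr, hβq]

variable {B : Type*} [CStarAlgebra B] {α : Circle →* (B →⋆ₐ[ℂ] B)} {ι : Type} [Fintype ι]
  [DecidableEq ι]

/-- The action `α ⊗ Ad U` on matrices over a C*-algebra. -/
def matrixAction (α : Circle →* (B →⋆ₐ[ℂ] B)) (U : CircleRep ι) (z : Circle) :
    CStarMatrix ι ι B →⋆ₐ[ℂ] CStarMatrix ι ι B where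
  toFun x := CStarMatrix.ofMatrix
    (scalarMatrix B (U.mat z) * (CStarMatrix.ofMatrix.symm x).map (α z) *
      (scalarMatrix B (U.mat z))ᴴ)
  map_one' := by
    change scalarMatrix B (U.mat z) * (1 : Matrix ι ι B).map (α z) *
      (scalarMatrix B (U.mat z))ᴴ = 1
    rw [map_one_matrix, Matrix.mul_one, scalarMatrix_mul_star]
  map_mul' x y := by
    change scalarMatrix B (U.mat z) *
      ((CStarMatrix.ofMatrix.symm x) * (CStarMatrix.ofMatrix.symm y)).map (α z) *
      (scalarMatrix B (U.mat z))ᴴ = (scalarMatrix B (U.mat z) *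
        (CStarMatrix.ofMatrix.symm x).map (α z) * (scalarMatrix B (U.mat z))ᴴ) *
      (scalarMatrix B (U.mat z) *
        (CStarMatrix.ofMatrix.symm y).map (α z) * (scalarMatrix B (U.mat z))ᴴ)
    rw [Matrix.map_mul]
    simp only [Matrix.mul_assoc]
    rw [← Matrix.mul_assoc (scalarMatrix B (U.mat z))ᴴ, scalarMatrix_star_mul, Matrix.one_mul]
  map_zero' := by
    change scalarMatrix B (U.mat z) * (0 : Matrix ι ι B).map (α z) *
      (scalarMatrix B (U.mat z))ᴴ = 0
    rw [Matrix.map_zero _ (map_zero _), Matrix.mul_zero, Matrix.zero_mul]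
  map_add' x y := by
    change scalarMatrix B (U.mat z) *
      ((CStarMatrix.ofMatrix.symm x) + (CStarMatrix.ofMatrix.symm y)).map (α z) *
      (scalarMatrix B (U.mat z))ᴴ = (scalarMatrix B (U.mat z) *
        (CStarMatrix.ofMatrix.symm x).map (α z) * (scalarMatrix B (U.mat z))ᴴ) +
      (scalarMatrix B (U.mat z) *
        (CStarMatrix.ofMatrix.symm y).map (α z) * (scalarMatrix B (U.mat z))ᴴ)
    rw [Matrix.map_add _ (map_add _), Matrix.mul_add, Matrix.add_mul]
  commutes' c := by
    change scalarMatrix B (U.mat z) * (algebraMap ℂ (Matrix ι ι B) c).map (α z) *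
      (scalarMatrix B (U.mat z))ᴴ = algebraMap ℂ (Matrix ι ι B) c
    rw [Algebra.algebraMap_eq_smul_one, map_smul_matrix, map_one_matrix, Matrix.mul_smul,
      Matrix.smul_mul, Matrix.mul_one, scalarMatrix_mul_star]
  map_star' x := by
    change scalarMatrix B (U.mat z) * (CStarMatrix.ofMatrix.symm x)ᴴ.map (α z) *
      (scalarMatrix B (U.mat z))ᴴ = (scalarMatrix B (U.mat z) *
        (CStarMatrix.ofMatrix.symm x).map (α z) * (scalarMatrix B (U.mat z))ᴴ)ᴴ
    simp only [Matrix.conjTranspose_mul, Matrix.conjTranspose_conjTranspose, map_conjTranspose',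
      Matrix.mul_assoc]

/-- The classes of a continuous family of invariant projections over a C*-algebra agree. -/
theorem equiv_of_continuous {X : Type*} [TopologicalSpace X] [PreconnectedSpace X]
    (U : CircleRep ι) (P : X → Matrix ι ι B) (hP : Continuous P)
    (h1 : ∀ s, IsStarProjection (P s)) (h2 : ∀ s, IsInvariant α U U (P s)) (s t : X) :
    InvProj.Equiv (α := α) ⟨ι, U, P s, h1 s, h2 s⟩ ⟨ι, U, P t, h1 t, h2 t⟩ := by
  let _ := CStarAlgebra.spectralOrder B
  have _ := CStarAlgebra.spectralOrderedRing B
  let p : X → InvProj α := fun s => ⟨ι, U, P s, h1 s, h2 s⟩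
  -- The equivalence class is locally constant, hence constant on the preconnected space X.
  have hloc : IsLocallyConstant fun s => ProjClass.mk (p s) := by
    rw [IsLocallyConstant.iff_eventually_eq]
    intro s
    let Q : X → CStarMatrix ι ι B := fun s => CStarMatrix.ofMatrix (P s)
    have hQ : Continuous Q := hP
    have hev : ∀ᶠ t in nhds s, ‖Q t - Q s‖ < 1 / 2 := by
      have h3 : Filter.Tendsto (fun t => ‖Q t - Q s‖) (nhds s) (nhds 0) :=
        tendsto_iff_norm_sub_tendsto_zero.1 (hQ.tendsto s)
      exact h3.eventually_lt_const (by norm_num)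
    filter_upwards [hev] with t ht
    have hproj : ∀ t, IsStarProjection (Q t) := fun t =>
      ⟨(h1 t).isIdempotentElem, (h1 t).isSelfAdjoint⟩
    obtain ⟨x, hx1, hx2, hx3⟩ := exists_partialIsometry_of_norm_sub_lt (hproj t) (hproj s) ht
    -- Invariance of P t and P s says that α ⊗ Ad U fixes both; x is fixed by every endomorphism
    -- with that property, hence invariant.
    exact ProjClass.mk_eq_mk.2 ⟨CStarMatrix.ofMatrix.symm x,
      fun z => hx3 (matrixAction α U z) (h2 t z) (h2 s z), hx1, hx2⟩
  exact ProjClass.mk_eq_mk.1 (hloc.apply_eq_of_preconnectedSpace s t)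

end CloseProjections

/-! ### Homotopy invariance of the class of p_v. -/

section Homotopy

variable {A : Type*} [NonUnitalCStarAlgebra A] (σ : CircleAction A)

/-- Closedness makes the cone and its unitization C*-algebras, as the argument with close
projections requires. -/
theorem isClosed_mappingCone : IsClosed (mappingCone σ : Set C₀(ℝ≥0, A)) := by
  have h : (mappingCone σ : Set C₀(ℝ≥0, A)) = ⋂ z, {f | σ.hom z (f 0) = f 0} := by
    ext f; simp [mem_mappingCone]
  rw [h]
  refine isClosed_iInter fun z => ?_
  have h0 : Continuous fun f : C₀(ℝ≥0, A) => f 0 := by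
    refine LipschitzWith.continuous (K := 1) (LipschitzWith.of_dist_le_mul fun f g => ?_)
    rw [NNReal.coe_one, one_mul, ← ZeroAtInftyContinuousMap.dist_toBCF_eq_dist]
    exact BoundedContinuousFunction.dist_coe_le_dist (f := f.toBCF) (g := g.toBCF) 0
  have h1 : Continuous (σ.hom z) := AddMonoidHomClass.continuous_of_bound (σ.hom z) 1 fun a => by
    simpa using NonUnitalStarAlgHom.norm_apply_le (σ.hom z) a
  exact isClosed_eq (h1.comp h0) h0

instance : NonUnitalCStarAlgebra (Cone σ) :=
  NonUnitalStarSubalgebra.nonUnitalCStarAlgebra (mappingCone σ)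
    (h_closed := isClosed_mappingCone σ)

theorem continuous_tensorC0 {B : Type*} [NonUnitalCStarAlgebra B] (g : C₀(ℝ≥0, ℂ)) :
    Continuous (tensorC0 (B := B) g) := by
  refine LipschitzWith.continuous (K := ‖g‖₊) (LipschitzWith.of_dist_le_mul fun a b => ?_)
  rw [← ZeroAtInftyContinuousMap.dist_toBCF_eq_dist,
    BoundedContinuousFunction.dist_le (by positivity)]
  intro t
  change dist (g t • a) (g t • b) ≤ _
  rw [dist_smul₀]
  gcongr
  exact BoundedContinuousFunction.norm_coe_le_norm g.toBCF t

theorem continuous_inr_mk {X : Type*} [TopologicalSpace X] {g : C₀(ℝ≥0, ℂ)}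
    {x : X → Unitization ℂ A} (hx : Continuous x)
    (h : ∀ s z, σ.unitize.hom z (tensorC0 g (x s) 0) = tensorC0 g (x s) 0) :
    Continuous fun s => (Unitization.inr (Cone.mk (tensorC0 g (x s)) (h s)) : ConeUnit σ) := by
  refine (Unitization.isometry_inr (𝕜 := ℂ) (A := Cone σ.unitize)).continuous.comp ?_
  exact Continuous.subtype_mk ((continuous_tensorC0 g).comp hx) _

theorem continuous_fromBlocks_one_sub {B X ι : Type*} [CStarAlgebra B] [TopologicalSpace X]
    [DecidableEq ι] {a b c d : X → Matrix ι ι B} (ha : Continuous a) (hb : Continuous b)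
    (hc : Continuous c) (hd : Continuous d) (x y : ℂ) :
    Continuous fun s => Matrix.fromBlocks (1 - a s) (x • b s) (y • c s) (d s) :=
  Continuous.matrix_fromBlocks (continuous_const.sub ha) (hb.const_smul x) (hc.const_smul y) hd

/-- The blocks of p_v are fixed functions times v, v*, v v* and v* v, so p_v depends continuously on
v in the norm of the cone. The representation is held constant, so the corner projection does not
move. -/
theorem putnamClass_eq_of_continuous {X : Type*} [TopologicalSpace X] [PreconnectedSpace X]
    {ι : Type} [Fintype ι] [DecidableEq ι] (U : CircleRep ι)
    (v : X → Matrix ι ι (Unitization ℂ A)) (hv : Continuous v)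
    (h1 : ∀ s, IsPartialIsometry (v s))
    (h2 : ∀ s, IsInvariant (unitizeHom σ.hom) U U (v s))
    (h3 : ∀ s, OverFixed σ (v s * (v s)ᴴ)) (h4 : ∀ s, OverFixed σ ((v s)ᴴ * v s)) (s t : X) :
    putnamClass σ ⟨ι, U, v s, h1 s, h2 s, h3 s, h4 s⟩ =
      putnamClass σ ⟨ι, U, v t, h1 t, h2 t, h3 t, h4 t⟩ := by
  let w : X → InvPartialIsometry σ := fun s => ⟨ι, U, v s, h1 s, h2 s, h3 s, h4 s⟩
  let P : X → Matrix (ι ⊕ ι) (ι ⊕ ι) (ConeUnit σ) := fun s => putnamMatrix σ (w s)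
  have hv' : Continuous fun s => (v s)ᴴ := hv.matrix_conjTranspose
  have hP : Continuous P := by
    have o1 : Continuous fun s => oddPart σ (v s) := continuous_matrix fun i j =>
      continuous_inr_mk σ (hv.matrix_elem i j) _
    have o2 : Continuous fun s => oddPart σ (v s)ᴴ := continuous_matrix fun i j =>
      continuous_inr_mk σ (hv'.matrix_elem i j) _
    have e1 : Continuous fun s => evenPart σ (v s * (v s)ᴴ) (h3 s) := continuous_matrix fun i j =>
      continuous_inr_mk σ ((hv.matrix_mul hv').matrix_elem i j) _
    have e2 : Continuous fun s => evenPart σ ((v s)ᴴ * v s) (h4 s) := continuous_matrix fun i j =>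
      continuous_inr_mk σ ((hv'.matrix_mul hv).matrix_elem i j) _
    exact continuous_fromBlocks_one_sub e1 o1 o2 e2 (-Complex.I) Complex.I
  have key := equiv_of_continuous (α := unitizeHom (coneAction σ.unitize)) (U.sum U) P hP
    (fun s => (putnamProj σ (w s)).isStarProjection) (fun s => (putnamProj σ (w s)).invariant) s t
  refine Subtype.ext ?_
  change K0Unital.mk (putnamProj σ (w s)) - K0Unital.mk (cornerProj σ (w s)) =
    K0Unital.mk (putnamProj σ (w t)) - K0Unital.mk (cornerProj σ (w t))
  exact congrArg (· - K0Unital.mk (cornerProj σ (w s))) (K0Unital.mk_eq_of_equiv key)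

end Homotopy

/-! ### Spectral components of modular partial isometries. -/

section Spectral

variable {A : Type*} [NonUnitalCStarAlgebra A] (σ : CircleAction A)

theorem continuous_unitizeHom_apply (x : Unitization ℂ A) :
    Continuous fun z : Circle => unitizeHom σ.hom z x := σ.unitize.cont x

theorem unitizeHom_mul_apply (z w : Circle) (x : Unitization ℂ A) :
    unitizeHom σ.hom (z * w) x = unitizeHom σ.hom z (unitizeHom σ.hom w x) := by
  rw [map_mul]; rfl

theorem unitizeHom_one_apply (x : Unitization ℂ A) : unitizeHom σ.hom 1 x = x := by
  rw [map_one]; rfl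

theorem norm_unitizeHom_le (z : Circle) (x : Unitization ℂ A) :
    ‖unitizeHom σ.hom z x‖ ≤ ‖x‖ :=
  NonUnitalStarAlgHom.norm_apply_le (unitizeHom σ.hom z) x

/-- The function whose mean is the spectral component. -/
def spectralIntegrand (k : ℤ) (x : Unitization ℂ A) (t : ℝ) : Unitization ℂ A :=
  (Circle.exp (-(k * t)) : ℂ) • unitizeHom σ.hom (Circle.exp t) x

theorem continuous_circle_exp_neg_mul (k : ℤ) :
    Continuous fun t : ℝ => (Circle.exp (-(k * t)) : ℂ) :=
  continuous_subtype_val.comp (Circle.exp.continuous.comp (by fun_prop))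

theorem continuous_spectralIntegrand (k : ℤ) (x : Unitization ℂ A) :
    Continuous (spectralIntegrand σ k x) :=
  (continuous_circle_exp_neg_mul k).smul
    ((continuous_unitizeHom_apply σ x).comp Circle.exp.continuous)

theorem spectralComponent_eq (k : ℤ) (x : Unitization ℂ A) : spectralComponent σ k x =
    (2 * Real.pi)⁻¹ • ∫ t in (0 : ℝ)..(2 * Real.pi), spectralIntegrand σ k x t := rfl

theorem circle_exp_int_mul (k : ℤ) (t : ℝ) : Circle.exp (k * t) = Circle.exp t ^ k := by
  rw [← Circle.exp_zsmul, zsmul_eq_mul]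

theorem spectralIntegrand_eq (k : ℤ) (x : Unitization ℂ A) (t : ℝ) :
    spectralIntegrand σ k x t =
      ((Circle.exp t ^ (-k) : Circle) : ℂ) • unitizeHom σ.hom (Circle.exp t) x := by
  rw [spectralIntegrand, ← circle_exp_int_mul, Int.cast_neg, neg_mul]

theorem spectralIntegrand_periodic (k : ℤ) (x : Unitization ℂ A) :
    Function.Periodic (spectralIntegrand σ k x) (2 * Real.pi) := fun t => by
  rw [spectralIntegrand_eq, spectralIntegrand_eq, Circle.exp_add_two_pi]

/-- Translating the integration variable produces the factor z^k, and periodicity restores the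
interval. -/
theorem spectralComponent_unitizeHom (k : ℤ) (z : Circle) (x : Unitization ℂ A) :
    spectralComponent σ k (unitizeHom σ.hom z x) =
      ((z ^ k : Circle) : ℂ) • spectralComponent σ k x := by
  obtain ⟨s, rfl⟩ := Circle.exp_surjective z
  have h : ∀ t, spectralIntegrand σ k (unitizeHom σ.hom (Circle.exp s) x) t =
      ((Circle.exp s ^ k : Circle) : ℂ) • spectralIntegrand σ k x (t + s) := by
    intro t
    rw [spectralIntegrand_eq, spectralIntegrand_eq, ← unitizeHom_mul_apply, ← Circle.exp_add,
      smul_smul, ← Circle.coe_mul, Circle.exp_add, mul_zpow, mul_left_comm, ← zpow_add,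
      add_neg_cancel, zpow_zero, mul_one]
  rw [spectralComponent_eq, spectralComponent_eq, smul_comm]
  simp only [h]
  rw [intervalIntegral.integral_smul, intervalIntegral.integral_comp_add_right
    (fun t => spectralIntegrand σ k x t), zero_add, add_comm,
    (spectralIntegrand_periodic σ k x).intervalIntegral_add_eq s 0, zero_add]

theorem unitizeHom_spectralComponent (k : ℤ) (z : Circle) (x : Unitization ℂ A) :
    unitizeHom σ.hom z (spectralComponent σ k x) =
      spectralComponent σ k (unitizeHom σ.hom z x) := by
  let L : Unitization ℂ A →L[ℂ] Unitization ℂ A :=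
    LinearMap.mkContinuous (unitizeHom σ.hom z).toAlgHom.toLinearMap 1 fun x => by
      rw [one_mul]; exact norm_unitizeHom_le σ z x
  have h := L.intervalIntegral_comp_comm
    ((continuous_spectralIntegrand σ k x).intervalIntegrable (μ := MeasureTheory.volume)
      0 (2 * Real.pi))
  have h' : ∀ t, L (spectralIntegrand σ k x t) =
      spectralIntegrand σ k (unitizeHom σ.hom z x) t := by
    intro t
    rw [spectralIntegrand, spectralIntegrand, map_smul]
    exact congrArg (_ • ·) (hom_comm σ.unitize (Circle.exp t) z x)
  rw [spectralComponent_eq, spectralComponent_eq]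
  simp only [← h', h]
  exact (L.restrictScalars ℝ).map_smul _ _

theorem norm_spectralComponent_le (k : ℤ) (x : Unitization ℂ A) :
    ‖spectralComponent σ k x‖ ≤ ‖x‖ := by
  have h : ‖∫ t in (0 : ℝ)..(2 * Real.pi), spectralIntegrand σ k x t‖ ≤
      ‖x‖ * |2 * Real.pi - 0| := by
    refine intervalIntegral.norm_integral_le_of_norm_le_const fun t _ => ?_
    rw [spectralIntegrand, norm_smul, Circle.norm_coe, one_mul]
    exact norm_unitizeHom_le σ _ x
  rw [spectralComponent_eq, norm_smul]
  have hpi : (0 : ℝ) < 2 * Real.pi := by positivity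
  rw [sub_zero, abs_of_pos hpi] at h
  rw [Real.norm_eq_abs, abs_of_pos (inv_pos.2 hpi), inv_mul_le_iff₀ hpi]
  linarith

theorem spectralComponent_sub (k : ℤ) (x y : Unitization ℂ A) :
    spectralComponent σ k (x - y) = spectralComponent σ k x - spectralComponent σ k y := by
  simp only [spectralComponent_eq]
  rw [← smul_sub, ← intervalIntegral.integral_sub
    ((continuous_spectralIntegrand σ k x).intervalIntegrable _ _)
    ((continuous_spectralIntegrand σ k y).intervalIntegrable _ _)]
  simp only [spectralIntegrand, map_sub, smul_sub]

theorem spectralComponent_zero (k : ℤ) : spectralComponent σ k (0 : Unitization ℂ A) = 0 := by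
  simpa using spectralComponent_sub σ k 0 0

theorem continuous_spectralComponent (k : ℤ) : Continuous (spectralComponent σ k) :=
  LipschitzWith.continuous (K := 1) <| LipschitzWith.of_dist_le_mul fun x y => by
    rw [dist_eq_norm, dist_eq_norm, ← spectralComponent_sub, NNReal.coe_one, one_mul]
    exact norm_spectralComponent_le σ k _

variable {ι κ μ : Type} [Fintype κ]

theorem mul_matrixComponent_apply (k : ℤ) (a : Matrix ι κ (Unitization ℂ A))
    (x : Matrix κ μ (Unitization ℂ A)) (i : ι) (j : μ) :
    (a * matrixComponent σ k x) i j = (2 * Real.pi)⁻¹ • ∫ t in (0 : ℝ)..(2 * Real.pi),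
      (Circle.exp (-(k * t)) : ℂ) • (a * x.map (unitizeHom σ.hom (Circle.exp t))) i j := by
  have h : ∀ l, a i l * spectralComponent σ k (x l j) = (2 * Real.pi)⁻¹ •
      ∫ t in (0 : ℝ)..(2 * Real.pi), a i l * spectralIntegrand σ k (x l j) t := by
    intro l
    rw [spectralComponent_eq, mul_smul_comm]
    congr 1
    exact ((ContinuousLinearMap.mul ℂ _ (a i l)).intervalIntegral_comp_comm
      ((continuous_spectralIntegrand σ k (x l j)).intervalIntegrable 0 (2 * Real.pi))).symm
  have hs := intervalIntegral.integral_finsetSum (μ := MeasureTheory.volume) (a := 0)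
    (b := 2 * Real.pi) (s := Finset.univ) (f := fun l t => a i l * spectralIntegrand σ k (x l j) t)
    fun l _ => (continuous_const.mul
      (continuous_spectralIntegrand σ k (x l j))).intervalIntegrable _ _
  simp only [Matrix.mul_apply, matrixComponent, Matrix.map_apply]
  rw [Finset.sum_congr rfl fun l _ => h l, ← Finset.smul_sum, ← hs]
  simp only [Finset.smul_sum, spectralIntegrand, mul_smul_comm]

/-- Averaging against z^{-k} turns an identity in σ_z(x), σ_z(y) into one between components. This
and the next lemma replace direct handling of integrals below. -/
theorem mul_matrixComponent_congr {κ' : Type} [Fintype κ'] {k : ℤ}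
    {a : Matrix ι κ (Unitization ℂ A)} {x : Matrix κ μ (Unitization ℂ A)}
    {b : Matrix ι κ' (Unitization ℂ A)} {y : Matrix κ' μ (Unitization ℂ A)}
    (h : ∀ z, a * x.map (unitizeHom σ.hom z) = b * y.map (unitizeHom σ.hom z)) :
    a * matrixComponent σ k x = b * matrixComponent σ k y := by
  ext i j : 1
  rw [mul_matrixComponent_apply, mul_matrixComponent_apply]
  simp only [h]

/-- The integrand z^{-k} z^k c is constant, so its mean is c. -/
theorem mul_matrixComponent_of_homogeneous {k : ℤ} {a : Matrix ι κ (Unitization ℂ A)}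
    {x : Matrix κ μ (Unitization ℂ A)} {c : Matrix ι μ (Unitization ℂ A)}
    (h : ∀ z : Circle, a * x.map (unitizeHom σ.hom z) = ((z ^ k : Circle) : ℂ) • c) :
    a * matrixComponent σ k x = c := by
  ext i j : 1
  have e : ∀ t : ℝ, (Circle.exp (-(k * t)) : ℂ) • ((Circle.exp t ^ k : Circle) : ℂ) • c i j =
      c i j := fun t => by
    rw [← circle_exp_int_mul, smul_smul, ← Circle.coe_mul, ← Circle.exp_add, neg_add_cancel,
      Circle.exp_zero, Circle.coe_one, one_smul]
  rw [mul_matrixComponent_apply]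
  simp only [h, Matrix.smul_apply, e]
  rw [intervalIntegral.integral_const, sub_zero, smul_smul, inv_mul_cancel₀ (by positivity),
    one_smul]

theorem matrixComponent_homogeneous (k : ℤ) (x : Matrix ι μ (Unitization ℂ A)) (z : Circle) :
    (matrixComponent σ k x).map (unitizeHom σ.hom z) =
      ((z ^ k : Circle) : ℂ) • matrixComponent σ k x := by
  ext i j : 1
  exact (unitizeHom_spectralComponent σ k z _).trans (spectralComponent_unitizeHom σ k z _)

theorem matrixComponent_map_unitizeHom (k : ℤ) (x : Matrix ι μ (Unitization ℂ A)) (z : Circle) :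
    matrixComponent σ k (x.map (unitizeHom σ.hom z)) =
      ((z ^ k : Circle) : ℂ) • matrixComponent σ k x := by
  ext i j : 1
  exact spectralComponent_unitizeHom σ k z _

variable {σ} in
theorem OverFixed.matrixComponent {x : Matrix ι μ (Unitization ℂ A)} (hx : OverFixed σ x)
    (k : ℤ) : OverFixed σ (matrixComponent σ k x) := fun z => by
  rw [matrixComponent_homogeneous, ← matrixComponent_map_unitizeHom, hx z]

theorem map_unitizeHom_map (z w : Circle) (x : Matrix ι μ (Unitization ℂ A)) :
    (x.map (unitizeHom σ.hom w)).map (unitizeHom σ.hom z) =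
      x.map (unitizeHom σ.hom (z * w)) := by
  ext i j : 1
  exact (unitizeHom_mul_apply σ z w _).symm

namespace IsModular

variable {σ} [DecidableEq κ] {v : Matrix κ κ (Unitization ℂ A)} (hv : IsModular σ v)
include hv

theorem range_fixed : OverFixed σ (v * vᴴ) := by
  have h := hv.left 1
  have e : vᴴ.map (unitizeHom σ.hom 1) = vᴴ := by
    ext i j : 1
    exact unitizeHom_one_apply σ _
  rwa [e] at h

theorem range_mul_map (z : Circle) :
    v * vᴴ * v.map (unitizeHom σ.hom z) = v.map (unitizeHom σ.hom z) := by
  conv_lhs => rw [← hv.range_fixed z]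
  rw [← Matrix.map_mul, hv.isPartialIsometry]

theorem range_mul_component (k : ℤ) :
    v * vᴴ * matrixComponent σ k v = matrixComponent σ k v := by
  have := mul_matrixComponent_congr σ (k := k) (a := v * vᴴ) (x := v) (b := 1) (y := v)
    fun z => by rw [hv.range_mul_map, Matrix.one_mul]
  rwa [Matrix.one_mul] at this

/-- Applying σ_w to the fixed element v* σ_{z/w}(v) gives σ_w(v*) σ_z(v) = v* σ_z(σ_{1/w}(v)).
Averaging over z picks out the k-th component of σ_{1/w}(v), which is w^{-k} v_k. -/
theorem map_star_mul_component (k : ℤ) (w : Circle) :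
    vᴴ.map (unitizeHom σ.hom w) * matrixComponent σ k v =
      ((w ^ (-k) : Circle) : ℂ) • (vᴴ * matrixComponent σ k v) := by
  have := mul_matrixComponent_congr σ (k := k) (a := vᴴ.map (unitizeHom σ.hom w)) (x := v)
    (b := vᴴ) (y := v.map (unitizeHom σ.hom w⁻¹)) fun z => by
      have h := hv.right (z * w⁻¹) w
      rwa [Matrix.map_mul, map_unitizeHom_map, mul_left_comm, mul_inv_cancel, mul_one,
        ← map_unitizeHom_map] at h
  rw [this, matrixComponent_map_unitizeHom, Matrix.mul_smul, inv_zpow, zpow_neg]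

/-- The phase z^k from σ_z(v_k) cancels the phase z^{-k} from σ_z(v*) v_k. -/
theorem star_mul_component_fixed (k : ℤ) : OverFixed σ (vᴴ * matrixComponent σ k v) := by
  intro z
  rw [Matrix.map_mul, matrixComponent_homogeneous, Matrix.mul_smul, hv.map_star_mul_component,
    smul_smul, ← Circle.coe_mul, ← zpow_add, add_neg_cancel, zpow_zero, Circle.coe_one, one_smul]

/-- The adjoint of `map_star_mul_component` reads v_k* σ_z(v) = z^k (v* v_k)*. Averaging gives v_k*
v_k = (v* v_k)*, and the left side is self-adjoint. -/
theorem component_star_mul_component (k : ℤ) :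
    (matrixComponent σ k v)ᴴ * matrixComponent σ k v = vᴴ * matrixComponent σ k v := by
  have h : (matrixComponent σ k v)ᴴ * matrixComponent σ k v =
      (vᴴ * matrixComponent σ k v)ᴴ := by
    refine mul_matrixComponent_of_homogeneous σ fun z => ?_
    have h1 := congrArg Matrix.conjTranspose (hv.map_star_mul_component k z)
    rw [Matrix.conjTranspose_mul, map_conjTranspose', Matrix.conjTranspose_conjTranspose,
      Matrix.conjTranspose_smul] at h1
    rw [h1, zpow_neg, Circle.coe_inv_eq_conj, Complex.star_def, Complex.conj_conj]
  have h2 := congrArg Matrix.conjTranspose h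
  rw [Matrix.conjTranspose_mul, Matrix.conjTranspose_conjTranspose,
    Matrix.conjTranspose_conjTranspose] at h2
  exact h2

theorem component_eq_mul (k : ℤ) :
    v * (vᴴ * matrixComponent σ k v) = matrixComponent σ k v := by
  rw [← Matrix.mul_assoc, hv.range_mul_component]

/-- The spectral components of a modular partial isometry are homogeneous partial isometries. -/
theorem component (k : ℤ) : IsPartialIsometry (matrixComponent σ k v) := by
  set q := vᴴ * matrixComponent σ k v with hq
  have h1 : (matrixComponent σ k v)ᴴ * matrixComponent σ k v = q :=
    hv.component_star_mul_component k
  have h2 : v * q = matrixComponent σ k v := hv.component_eq_mul k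
  have h3 : qᴴ = q := by
    rw [← h1, Matrix.conjTranspose_mul, Matrix.conjTranspose_conjTranspose]
  -- q is self-adjoint, so q q = q* q = v_k* (v q) = v_k* v_k = q. Thus v_k = v q with q = v_k* v_k
  -- a projection.
  have h4 : q * q = q := by
    calc q * q = qᴴ * q := by rw [h3]
      _ = (matrixComponent σ k v)ᴴ * v * q := by
          conv_lhs => enter [1]; rw [hq]
          rw [Matrix.conjTranspose_mul, Matrix.conjTranspose_conjTranspose]
      _ = q := by rw [Matrix.mul_assoc, h2, h1]
  rw [IsPartialIsometry, Matrix.mul_assoc, h1]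
  conv_lhs => rw [← h2]
  rw [Matrix.mul_assoc, h4, h2]

/-- Since q = v* v_k is fixed, σ_z(v) q = σ_z(v q) = σ_z(v_k) = z^k v_k. So z^k is an eigenvalue of
v* σ_z(v) on q. -/
theorem mul_star_mul_component (k : ℤ) (z : Circle) :
    vᴴ * v.map (unitizeHom σ.hom z) * (vᴴ * matrixComponent σ k v) =
      ((z ^ k : Circle) : ℂ) • (vᴴ * matrixComponent σ k v) := by
  conv_lhs => rw [← hv.star_mul_component_fixed k z]
  rw [Matrix.mul_assoc, ← Matrix.map_mul, hv.component_eq_mul, matrixComponent_homogeneous,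
    Matrix.mul_smul]

theorem source_mul_component (k : ℤ) :
    vᴴ * v * (vᴴ * matrixComponent σ k v) = vᴴ * matrixComponent σ k v := by
  rw [Matrix.mul_assoc, hv.component_eq_mul]

attribute [local instance] Matrix.linftyOpNormedRing Matrix.linftyOpNormedAlgebra in
/-- A modular partial isometry has only finitely many nonzero spectral components. -/
theorem finite_components : {k : ℤ | matrixComponent σ k v ≠ 0}.Finite := by
  have hcont : Continuous fun z : Circle => vᴴ * v.map (unitizeHom σ.hom z) :=
    continuous_const.matrix_mul (continuous_matrix fun i j =>
      continuous_unitizeHom_apply σ (v i j))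
  have h1 : vᴴ * v.map (unitizeHom σ.hom 1) = vᴴ * v := by
    congr 1
    ext i j : 1
    exact unitizeHom_one_apply σ _
  -- The points e^{iπ/k} tend to 1 although their k-th powers are -1. Where v* σ_z(v) is within
  -- distance 1 of v* v, this forces 2 ‖q‖ ≤ ‖q‖, so q = 0 and v_k = v q = 0.
  have hlim : Filter.Tendsto (fun k : ℤ => Circle.exp (Real.pi / k)) Filter.cofinite
      (nhds 1) := by
    rw [← Circle.exp_zero]
    refine (Circle.exp.continuous.tendsto 0).comp ?_
    rw [← mul_zero Real.pi]
    refine Filter.Tendsto.const_mul _ ?_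
    exact Filter.tendsto_inv₀_cobounded.comp (by
      rw [Metric.cobounded_eq_cocompact]
      exact Int.tendsto_coe_cofinite)
  have hnorm : ∀ᶠ k : ℤ in Filter.cofinite,
      ‖vᴴ * v.map (unitizeHom σ.hom (Circle.exp (Real.pi / k))) - vᴴ * v‖ < 1 := by
    have h2 := (hcont.tendsto 1).comp hlim
    rw [h1] at h2
    exact (tendsto_iff_norm_sub_tendsto_zero.1 h2).eventually_lt_const one_pos
  have h0 : ∀ᶠ k : ℤ in Filter.cofinite, k ≠ 0 := (Set.finite_singleton 0).compl_mem_cofinite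
  refine Filter.eventually_cofinite.1 ?_
  filter_upwards [hnorm, h0] with k hk hk0
  set q := vᴴ * matrixComponent σ k v with hq
  have e1 : ((Circle.exp (Real.pi / k) ^ k : Circle) : ℂ) = -1 := by
    rw [← circle_exp_int_mul, mul_div_cancel₀ _ (Int.cast_ne_zero.2 hk0), Circle.coe_exp,
      Complex.exp_pi_mul_I]
  have e2 : (vᴴ * v.map (unitizeHom σ.hom (Circle.exp (Real.pi / k))) - vᴴ * v) * q =
      -q - q := by
    rw [Matrix.sub_mul, hq, hv.mul_star_mul_component, hv.source_mul_component, e1, neg_smul,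
      one_smul]
  have e3 : ‖-q - q‖ ≤ 1 * ‖q‖ := by
    rw [← e2]
    exact (norm_mul_le _ _).trans (by gcongr)
  have e4 : ‖-q - q‖ = 2 * ‖q‖ := by
    have h5 : -q - q = (-2 : ℂ) • q := by module
    rw [h5, norm_smul]
    simp
  have e5 : q = 0 := by
    rw [← norm_le_zero_iff]; linarith
  rw [← hv.component_eq_mul, ← hq, e5, Matrix.mul_zero]

end IsModular

variable {σ} in
theorem IsModular.isHomogeneousPI {n : ℕ} {v : Matrix (Fin n) (Fin n) (Unitization ℂ A)}
    (hv : IsModular σ v) (k : ℤ) : IsHomogeneousPI σ k (matrixComponent σ k v) :=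
  ⟨hv.component k, matrixComponent_homogeneous σ k v⟩

end Spectral

/-! ### Additivity of the classes under direct sums. -/

section Additivity

variable {A : Type*} [NonUnitalCStarAlgebra A] {σ : CircleAction A}

/-- Relabelling the basis does not change the class of an invariant partial isometry. -/
theorem putnamClass_eq_of_reindex {v w : InvPartialIsometry σ} (e : w.ι ≃ v.ι)
    (hrep : ∀ z, w.rep.mat z = (v.rep.mat z).submatrix e e)
    (helt : w.elt = v.elt.submatrix e e) : putnamClass σ v = putnamClass σ w := by
  have hr : ∀ z, (w.rep.sum w.rep).mat z =
      ((v.rep.sum v.rep).mat z).submatrix (Equiv.sumCongr e e) (Equiv.sumCongr e e) := by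
    intro z
    rw [CircleRep.sum_mat, CircleRep.sum_mat, hrep]
    ext (i | i) (j | j) <;> rfl
  have helt' : w.eltᴴ = v.eltᴴ.submatrix e e := by rw [helt, Matrix.conjTranspose_submatrix]
  have h1 : putnamMatrix σ w =
      (putnamMatrix σ v).submatrix (Equiv.sumCongr e e) (Equiv.sumCongr e e) := by
    refine coneMatrix_ext σ ?_ fun t => ?_
    · rw [← Matrix.submatrix_map, putnamMatrix_aug, putnamMatrix_aug]
      ext (i | i) (j | j) : 1 <;> simp [Matrix.one_apply]
    · rw [← Matrix.submatrix_map, putnamMatrix_eval, putnamMatrix_eval, helt', helt,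
        Matrix.submatrix_mul_equiv, Matrix.submatrix_mul_equiv]
      ext (i | i) (j | j) : 1 <;> simp [Matrix.one_apply]
  have h2 : (Matrix.fromBlocks 1 0 0 0 : Matrix (w.ι ⊕ w.ι) (w.ι ⊕ w.ι) (ConeUnit σ)) =
      (Matrix.fromBlocks 1 0 0 0 : Matrix (v.ι ⊕ v.ι) (v.ι ⊕ v.ι) (ConeUnit σ)).submatrix
        (Equiv.sumCongr e e) (Equiv.sumCongr e e) := by
    ext (i | i) (j | j) : 1 <;> simp [Matrix.one_apply]
  refine Subtype.ext ?_
  change K0Unital.mk (putnamProj σ v) - K0Unital.mk (cornerProj σ v) =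
    K0Unital.mk (putnamProj σ w) - K0Unital.mk (cornerProj σ w)
  rw [K0Unital.mk_eq_of_equiv (InvProj.Equiv.of_reindex (p := putnamProj σ v)
    (q := putnamProj σ w) (Equiv.sumCongr e e) hr h1),
    K0Unital.mk_eq_of_equiv (InvProj.Equiv.of_reindex (p := cornerProj σ v)
    (q := cornerProj σ w) (Equiv.sumCongr e e) hr h2)]

theorem fromBlocks_mul_star {B : Type*} [Ring B] [StarRing B] {ι κ : Type} [Fintype ι] [Fintype κ]
    (v : Matrix ι ι B) (w : Matrix κ κ B) :
    Matrix.fromBlocks v 0 0 w * (Matrix.fromBlocks v 0 0 w)ᴴ =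
      Matrix.fromBlocks (v * vᴴ) 0 0 (w * wᴴ) := by
  simp [Matrix.fromBlocks_conjTranspose, Matrix.fromBlocks_multiply]

theorem fromBlocks_star_mul {B : Type*} [Ring B] [StarRing B] {ι κ : Type} [Fintype ι] [Fintype κ]
    (v : Matrix ι ι B) (w : Matrix κ κ B) :
    (Matrix.fromBlocks v 0 0 w)ᴴ * Matrix.fromBlocks v 0 0 w =
      Matrix.fromBlocks (vᴴ * v) 0 0 (wᴴ * w) := by
  simp [Matrix.fromBlocks_conjTranspose, Matrix.fromBlocks_multiply]

/-- The direct sum of invariant partial isometries. -/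
@[reducible]
def InvPartialIsometry.sum (v w : InvPartialIsometry σ) : InvPartialIsometry σ where
  ι := v.ι ⊕ w.ι
  rep := v.rep.sum w.rep
  elt := Matrix.fromBlocks v.elt 0 0 w.elt
  isPartialIsometry := by
    have h1 := v.isPartialIsometry
    have h2 := w.isPartialIsometry
    rw [IsPartialIsometry] at *
    rw [fromBlocks_mul_star, Matrix.fromBlocks_multiply]
    simp [h1, h2]
  invariant := v.invariant.fromBlocks (isInvariant_zero _ _ _) (isInvariant_zero _ _ _) w.invariant
  range_fixed := by
    rw [fromBlocks_mul_star]
    exact overFixed_fromBlocks σ v.range_fixed w.range_fixed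
  source_fixed := by
    rw [fromBlocks_star_mul]
    exact overFixed_fromBlocks σ v.source_fixed w.source_fixed

/-- p_{v ⊕ w} and p_v ⊕ p_w differ by exchanging the two middle summands of the underlying space,
and likewise for the corners. -/
theorem putnamClass_sum (v w : InvPartialIsometry σ) :
    putnamClass σ (v.sum w) = putnamClass σ v + putnamClass σ w := by
  let e := Equiv.sumSumSumComm v.ι v.ι w.ι w.ι
  have hr : ∀ z, ((v.rep.sum v.rep).sum (w.rep.sum w.rep)).mat z =
      (((v.rep.sum w.rep).sum (v.rep.sum w.rep)).mat z).submatrix e e := by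
    intro z
    simp only [CircleRep.sum_mat]
    ext ((i | i) | (i | i)) ((j | j) | (j | j)) <;> rfl
  have h1 : Matrix.fromBlocks (putnamMatrix σ v) 0 0 (putnamMatrix σ w) =
      (putnamMatrix σ (v.sum w)).submatrix e e := by
    refine coneMatrix_ext σ ?_ fun t => ?_
    · rw [← Matrix.submatrix_map, putnamMatrix_aug, Matrix.fromBlocks_map, putnamMatrix_aug,
        putnamMatrix_aug]
      ext ((i | i) | (i | i)) ((j | j) | (j | j)) : 1 <;> simp [e, Matrix.one_apply]
    · rw [← Matrix.submatrix_map, putnamMatrix_eval, Matrix.fromBlocks_map, putnamMatrix_eval,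
        putnamMatrix_eval, fromBlocks_mul_star, fromBlocks_star_mul,
        Matrix.fromBlocks_conjTranspose]
      ext ((i | i) | (i | i)) ((j | j) | (j | j)) : 1 <;> simp [e, Matrix.one_apply]
  have h2 : Matrix.fromBlocks
      (Matrix.fromBlocks 1 0 0 0 : Matrix (v.ι ⊕ v.ι) (v.ι ⊕ v.ι) (ConeUnit σ)) 0 0
      (Matrix.fromBlocks 1 0 0 0 : Matrix (w.ι ⊕ w.ι) (w.ι ⊕ w.ι) (ConeUnit σ)) =
      (Matrix.fromBlocks 1 0 0 0 : Matrix ((v.ι ⊕ w.ι) ⊕ (v.ι ⊕ w.ι)) ((v.ι ⊕ w.ι) ⊕ (v.ι ⊕ w.ι))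
        (ConeUnit σ)).submatrix e e := by
    ext ((i | i) | (i | i)) ((j | j) | (j | j)) : 1 <;> simp [e, Matrix.one_apply]
  refine Subtype.ext ?_
  change K0Unital.mk (putnamProj σ (v.sum w)) - K0Unital.mk (cornerProj σ (v.sum w)) =
    (K0Unital.mk (putnamProj σ v) - K0Unital.mk (cornerProj σ v)) +
    (K0Unital.mk (putnamProj σ w) - K0Unital.mk (cornerProj σ w))
  rw [K0Unital.mk_eq_of_equiv (InvProj.Equiv.of_reindex (p := putnamProj σ (v.sum w))
    (q := (putnamProj σ v).sum (putnamProj σ w)) e hr h1),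
    K0Unital.mk_eq_of_equiv (InvProj.Equiv.of_reindex (p := cornerProj σ (v.sum w))
    (q := (cornerProj σ v).sum (cornerProj σ w)) e hr h2), K0Unital.mk_sum, K0Unital.mk_sum]
  abel

variable (σ) in
theorem matrixComponent_diagSum {n m : ℕ} (k : ℤ) (v : Matrix (Fin n) (Fin n) (Unitization ℂ A))
    (w : Matrix (Fin m) (Fin m) (Unitization ℂ A)) :
    matrixComponent σ k (diagSum v w) =
      diagSum (matrixComponent σ k v) (matrixComponent σ k w) := by
  rw [matrixComponent, diagSum, ← Matrix.submatrix_map, Matrix.fromBlocks_map]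
  congr 2 <;> exact Matrix.map_zero _ (spectralComponent_zero σ k)

/-- The equation for u is a hypothesis because in the application u is a component of v ⊕ w, which
is block diagonal by `matrixComponent_diagSum` and not by definition. -/
theorem putnamClass_twistedCorner_diagSum {n m : ℕ} {k : ℤ}
    {v : Matrix (Fin n) (Fin n) (Unitization ℂ A)} {w : Matrix (Fin m) (Fin m) (Unitization ℂ A)}
    {u : Matrix (Fin (n + m)) (Fin (n + m)) (Unitization ℂ A)} (huvw : u = diagSum v w)
    (hv : IsHomogeneousPI σ k v) (hw : IsHomogeneousPI σ k w) (hu : IsHomogeneousPI σ k u) :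
    putnamClass σ (twistedCorner σ k u hu) =
      putnamClass σ (twistedCorner σ k v hv) + putnamClass σ (twistedCorner σ k w hw) := by
  rw [← putnamClass_sum]
  let e : (Fin n ⊕ Fin n) ⊕ (Fin m ⊕ Fin m) ≃ Fin (n + m) ⊕ Fin (n + m) :=
    (Equiv.sumSumSumComm _ _ _ _).trans (Equiv.sumCongr finSumFinEquiv finSumFinEquiv)
  have htw : ∀ (l : ℕ) (z : Circle), ((CircleRep.trivial (Fin l)).twist k).mat z =
    ((z ^ k : Circle) : ℂ) • (1 : Matrix (Fin l) (Fin l) ℂ) := fun _ _ => rfl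
  refine putnamClass_eq_of_reindex (v := twistedCorner σ k u hu)
    (w := (twistedCorner σ k v hv).sum (twistedCorner σ k w hw)) e (fun z => ?_) ?_
  · change ((((CircleRep.trivial (Fin n)).sum ((CircleRep.trivial (Fin n)).twist k))).sum
      ((CircleRep.trivial (Fin m)).sum ((CircleRep.trivial (Fin m)).twist k))).mat z =
      (((CircleRep.trivial (Fin (n + m))).sum
        ((CircleRep.trivial (Fin (n + m))).twist k)).mat z).submatrix e e
    have h0 : ∀ (i : Fin n) (j : Fin m), Fin.castAdd m i ≠ Fin.natAdd n j := fun i j => by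
      rw [Ne, Fin.ext_iff, Fin.val_castAdd, Fin.val_natAdd]
      omega
    simp only [CircleRep.sum_mat, CircleRep.trivial_mat, htw]
    ext ((i | i) | (i | i)) ((j | j) | (j | j)) : 1 <;>
      simp [e, Matrix.one_apply, h0, (h0 _ _).symm]
  · change Matrix.fromBlocks (Matrix.fromBlocks 0 v 0 0) 0 0 (Matrix.fromBlocks 0 w 0 0) =
      (Matrix.fromBlocks 0 u 0 0).submatrix e e
    rw [huvw, diagSum]
    ext ((i | i) | (i | i)) ((j | j) | (j | j)) : 1 <;> simp [e]

end Additivity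

/-! ### The classes ≪v_k≫ and the homomorphism on K₁(A, σ). -/

section TwistedClasses

variable {A : Type*} [NonUnitalCStarAlgebra A] {σ : CircleAction A}

theorem exists_isTwistedClass {n : ℕ} {k : ℤ} {v : Matrix (Fin n) (Fin n) (Unitization ℂ A)}
    (h : IsHomogeneousPI σ k v) : ∃ c : K0Cone σ, IsTwistedClass h c :=
  exists_coneInclusion_eq_putnamClass σ (twistedCorner σ k v h)

theorem IsTwistedClass.unique {n : ℕ} {k : ℤ} {v : Matrix (Fin n) (Fin n) (Unitization ℂ A)}
    {h : IsHomogeneousPI σ k v} {c d : K0Cone σ} (hc : IsTwistedClass h c)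
    (hd : IsTwistedClass h d) : c = d :=
  coneInclusion_injective σ (Eq.trans hc (Eq.symm hd))

/-- The class of the `k`-th spectral component of a modular partial isometry. -/
def ModularPI.componentClass (v : ModularPI σ) (k : ℤ) : K0Cone σ :=
  (exists_isTwistedClass (v.isModular.isHomogeneousPI k)).choose

theorem ModularPI.isTwistedClass_componentClass (v : ModularPI σ) (k : ℤ) :
    IsTwistedClass (v.isModular.isHomogeneousPI k) (v.componentClass k) :=
  (exists_isTwistedClass (v.isModular.isHomogeneousPI k)).choose_spec

/-- Used both for the relation [v] = 0 and, with v_k = 0, for the finiteness of the support. -/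
theorem ModularPI.componentClass_eq_zero {v : ModularPI σ} {k : ℤ}
    (h : OverFixed σ (matrixComponent σ k v.elt)) : v.componentClass k = 0 := by
  apply coneInclusion_injective σ
  rw [map_zero]
  refine (v.isTwistedClass_componentClass k).trans (putnamClass_eq_zero σ _ fun z => ?_)
  change (Matrix.fromBlocks 0 (matrixComponent σ k v.elt) 0 0).map (unitizeHom σ.hom z) =
    Matrix.fromBlocks 0 (matrixComponent σ k v.elt) 0 0
  rw [Matrix.fromBlocks_map, h z, Matrix.map_zero _ (map_zero _)]

theorem ModularPI.componentClass_support_subset (v : ModularPI σ) :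
    Function.support v.componentClass ⊆ {k | matrixComponent σ k v.elt ≠ 0} := by
  intro k hk h
  refine hk (componentClass_eq_zero ?_)
  rw [h]
  exact overFixed_zero σ

/-- The sum of the classes of the spectral components of a modular partial isometry. -/
def ModularPI.totalClass (v : ModularPI σ) : K0Cone σ := ∑ᶠ k, v.componentClass k

theorem ModularPI.totalClass_eq_sum (v : ModularPI σ)
    (hfin : {k : ℤ | matrixComponent σ k v.elt ≠ 0}.Finite) :
    v.totalClass = ∑ k ∈ hfin.toFinset, v.componentClass k :=
  finsum_eq_sum_of_support_subset _ (by
    rw [Set.Finite.coe_toFinset]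
    exact v.componentClass_support_subset)

theorem ModularPI.totalClass_eq_zero {v : ModularPI σ} (h : OverFixed σ v.elt) :
    v.totalClass = 0 := by
  rw [totalClass]
  simp only [componentClass_eq_zero (h.matrixComponent _), finsum_zero]

theorem ModularPI.componentClass_sum (v w : ModularPI σ) (k : ℤ) :
    (v.sum w).componentClass k = v.componentClass k + w.componentClass k := by
  apply coneInclusion_injective σ
  rw [map_add, v.isTwistedClass_componentClass k, w.isTwistedClass_componentClass k]
  exact ((v.sum w).isTwistedClass_componentClass k).trans
    (putnamClass_twistedCorner_diagSum (matrixComponent_diagSum σ k _ _) _ _ _)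

theorem ModularPI.totalClass_sum (v w : ModularPI σ) :
    (v.sum w).totalClass = v.totalClass + w.totalClass := by
  -- `finsum` is 0 on infinite supports, so additivity depends on both supports being finite.
  rw [totalClass, totalClass, totalClass, ← finsum_add_distrib
    (v.isModular.finite_components.subset v.componentClass_support_subset)
    (w.isModular.finite_components.subset w.componentClass_support_subset)]
  exact finsum_congr (componentClass_sum v w)

/-- The map v ↦ v_k is entrywise contractive, so the k-th components form a continuous path of
partial isometries invariant for one fixed representation. -/
theorem ModularPI.componentClass_eq_of_continuous {n : ℕ}
    {v : unitInterval → Matrix (Fin n) (Fin n) (Unitization ℂ A)} (hv : ∀ t, IsModular σ (v t))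
    (hc : Continuous v) (k : ℤ) (s t : unitInterval) :
    (⟨n, v s, hv s⟩ : ModularPI σ).componentClass k =
      (⟨n, v t, hv t⟩ : ModularPI σ).componentClass k := by
  apply coneInclusion_injective σ
  rw [isTwistedClass_componentClass ⟨n, v s, hv s⟩ k, isTwistedClass_componentClass ⟨n, v t, hv t⟩ k]
  have h : ∀ t, IsHomogeneousPI σ k (matrixComponent σ k (v t)) := fun t => (hv t).isHomogeneousPI k
  have hcont : Continuous fun t => matrixComponent σ k (v t) :=
    hc.matrix_map (continuous_spectralComponent σ k)
  exact putnamClass_eq_of_continuous σ (twistedCorner σ k _ (h s)).rep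
    (fun t => Matrix.fromBlocks 0 (matrixComponent σ k (v t)) 0 0)
    (continuous_const.matrix_fromBlocks hcont continuous_const continuous_const)
    (fun t => (twistedCorner σ k _ (h t)).isPartialIsometry)
    (fun t => (twistedCorner σ k _ (h t)).invariant)
    (fun t => (twistedCorner σ k _ (h t)).range_fixed)
    (fun t => (twistedCorner σ k _ (h t)).source_fixed) s t

variable (σ) in
/-- The homomorphism `K₁(A, σ) → K₀^𝕋(M(F, A))`. -/
def ModularK1.toK0Cone : ModularK1 σ →+ K0Cone σ :=
  QuotientAddGroup.lift _ (FreeAbelianGroup.lift ModularPI.totalClass) <| by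
    rw [AddSubgroup.closure_le]
    rintro x ((⟨v, hv, rfl⟩ | ⟨v, w, rfl⟩) | ⟨n, v, hv, hc, rfl⟩)
    · change FreeAbelianGroup.lift _ _ = 0
      rw [FreeAbelianGroup.lift_apply_of, ModularPI.totalClass_eq_zero hv]
    · change FreeAbelianGroup.lift _ _ = 0
      rw [map_sub, map_add, FreeAbelianGroup.lift_apply_of, FreeAbelianGroup.lift_apply_of,
        FreeAbelianGroup.lift_apply_of, ModularPI.totalClass_sum, sub_self]
    · change FreeAbelianGroup.lift _ _ = 0
      rw [map_sub, FreeAbelianGroup.lift_apply_of, FreeAbelianGroup.lift_apply_of, sub_eq_zero]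
      -- The sums agree term by term, so no bound on the degrees uniform along the path is needed.
      exact finsum_congr fun k => ModularPI.componentClass_eq_of_continuous hv hc k 0 1

theorem ModularK1.toK0Cone_mk (v : ModularPI σ) :
    ModularK1.toK0Cone σ (ModularK1.mk v) = v.totalClass :=
  FreeAbelianGroup.lift_apply_of _ _

theorem ModularK1.hom_ext {G : Type*} [AddCommGroup G] {S T : ModularK1 σ →+ G}
    (h : ∀ v, S (ModularK1.mk v) = T (ModularK1.mk v)) : S = T :=
  QuotientAddGroup.addMonoidHom_ext _ (FreeAbelianGroup.lift_ext _ _ h)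

end TwistedClasses

end

end ModularK

/-! ### The proposition. -/

theorem mainTheorem9 {A : Type*} [NonUnitalCStarAlgebra A] (σ : ModularK.CircleAction A) :
    Function.Injective (ModularK.coneInclusion σ) ∧
    ∃! T : ModularK.ModularK1 σ →+ ModularK.K0Cone σ,
      ∀ v : ModularK.ModularPI σ,
        ∃ (hpi : ∀ k : ℤ,
            ModularK.IsHomogeneousPI σ k (ModularK.matrixComponent σ k v.elt))
          (hfin : {k : ℤ | ModularK.matrixComponent σ k v.elt ≠ 0}.Finite)
          (c : ℤ → ModularK.K0Cone σ),
          (∀ k, ModularK.IsTwistedClass (hpi k) (c k)) ∧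
          T (ModularK.ModularK1.mk v) = ∑ k ∈ hfin.toFinset, c k := by
  refine ⟨ModularK.coneInclusion_injective σ, ModularK.ModularK1.toK0Cone σ, fun v => ?_,
    fun T hT => ModularK.ModularK1.hom_ext fun v => ?_⟩
  · exact ⟨v.isModular.isHomogeneousPI, v.isModular.finite_components, v.componentClass,
      v.isTwistedClass_componentClass,
      (ModularK.ModularK1.toK0Cone_mk v).trans (v.totalClass_eq_sum _)⟩
  -- A competing T may come with its own classes c, but injectivity of `coneInclusion` forces them
  -- to be the chosen ones.
  · obtain ⟨hpi, hfin, c, hc, hTv⟩ := hT v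
    rw [hTv, ModularK.ModularK1.toK0Cone_mk, v.totalClass_eq_sum hfin]
    exact Finset.sum_congr rfl fun k _ =>
      ModularK.IsTwistedClass.unique (hc k) (v.isTwistedClass_componentClass k)
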